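/- Let $X$ be a scheme locally of finite type over $\mathbb C$ (for instance a projective variety), let $p\ge 0$, and let $Z_{p-1}\subseteq\dots\subseteq Z_1\subseteq Z_0\subseteq X$ be closed subschemes with ideal sheaves $\mathcal I_{0}\subseteq\mathcal I_1\subseteq\dots\subseteq\mathcal I_{p-1}$. Let $t$ be the coordinate on $\mathbb C$, let $\mathbb C^*$ act on $X\times\mathbb C$ by scaling $t$, and let $$I=\mathcal I_0+t\mathcal I_1+\dots+t^{p-1}\mathcal I_{p-1}+(t^p)$$ on $X\times\mathbb C$. Let $\pi\colon B=\mathrm{Bl}_I(X\times\mathbb C)\to X\times\mathbb C$ be the blow-up, with exceptional divisor $P$. The iterated blow-up $Y_p\to Y_{p-1}\to\dots\to Y_0=X\times\mathbb C$ is defined as follows. For $0\le k<p$ let $\overline{Z_k\times\mathbb C}\subseteq Y_k$ be the proper transform of $Z_k\times\mathbb C$, that is, the scheme-theoretic closure in $Y_k$ of the preimage of $Z_k\times\mathbb C^*$ in $\{t\ne0\}\subseteq Y_k$, and let $Z_k^{(k)}$ be its scheme-theoretic fibre over $t=0$ (so $Z_0^{(0)}=Z_0\times\{0\}$). Then $\beta_k\colon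 Y_{k+1}\to Y_k$ is the blow-up of $Y_k$ in $Z_k^{(k)}$; let $E_k\subset Y_{k+1}$ be its exceptional divisor. Then the $\mathbb C^*$-action on $X\times\mathbb C$ lifts to actions on $B$ and on all $Y_k$ for which the maps $\beta_k$ are equivariant, and there is a $\mathbb C^*$-equivariant morphism $q\colon Y_p\to B$ over $X\times\mathbb C$ that is a contraction, i.e. proper, surjective and birational (an isomorphism over a dense open subset of $B$ with dense preimage). Moreover $q$ respects polarisations. Let $L$ be a line bundle on $X$ and $c\ge 0$ an integer. (A rational $c$ is treated by replacing $L$ and $c$ by $L^{r}$ and $rc$, where $r\geq 1$ and $rc$ is an integer.) Let $L(-cP)$ be the subsheaf $\mathcal O(-cP)\cdot L_B$ of the pullback $L_B$ of $L$ to $B$. On the iterated blow-up let $N_0$ be the pullback of $L$ to $Y_0$ and let $N_{k+1}=(\beta_k^*N_k)(-cE_k)$. Then $L(-cP)$ and $N_p$ are line bundles, both carry $\mathbb C^*$-linearisations induced from the trivial linearisation of $L$ through their natural maps to the pullbacks of $L$, and there is a $\mathbb C^*$-equivariant isomorphism $q^*\bigl(L(-cP)\bigr)\cong N_p$ that is compatible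 with the natural maps of both sides to the pullback of $L$ to $Y_p$. -/

import Mathlib

open CategoryTheory AlgebraicGeometry

universe u

noncomputable section

namespace IterBlowup

/-! ### Blow-ups -/

/-- An ideal sheaf is invertible (the ideal of an effective Cartier divisor) if locally it is
generated by one nonzerodivisor. -/
def IsInvertibleIdeal {Y : Scheme.{u}} (J : Y.IdealSheafData) : Prop :=
  ∀ y : Y, ∃ U : Y.affineOpens, y ∈ U.1 ∧
    ∃ f ∈ nonZeroDivisors Γ(Y, U.1), J.ideal U = Ideal.span {f}

/-- `π : Y' ⟶ Y` is the blow-up of `Y` in the ideal sheaf `J`: the inverse image ideal sheaf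
`J · 𝒪_{Y'}` is invertible, and `π` is universal (terminal) among the morphisms to `Y` with this
property. This determines `π` up to a unique isomorphism. The exceptional divisor is the
closed subscheme of `Y'` with ideal sheaf `J.comap π = J · 𝒪_{Y'}`. -/
structure IsBlowup {Y' Y : Scheme.{u}} (π : Y' ⟶ Y) (J : Y.IdealSheafData) : Prop where
  invertible : IsInvertibleIdeal (J.comap π)
  existsUnique_lift : ∀ {T : Scheme.{u}} (g : T ⟶ Y), IsInvertibleIdeal (J.comap g) →
    ∃! h : T ⟶ Y', h ≫ π = g

/-- A contraction: a proper surjective birational morphism, i.e. one that restricts to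
an isomorphism between the preimage of a dense open subset and that subset,
the preimage being dense too. -/
def IsContraction {Y Z : Scheme.{u}} (q : Y ⟶ Z) : Prop :=
  IsProper q ∧ Surjective q ∧
    ∃ U : Z.Opens, Dense (U : Set Z) ∧ Dense ((q ⁻¹ᵁ U : Y.Opens) : Set Y) ∧ IsIso (q ∣_ U)

/-! ### The product with the affine line -/

/-- `X × 𝔸¹`, which is `X × ℂ` for `X` over `ℂ`. -/
abbrev Line (X : Scheme.{u}) : Scheme.{u} := 𝔸(PUnit.{u + 1}; X)

variable {X : Scheme.{u}}

/-- The composition `Y ⟶ X × 𝔸¹ ⟶ X`. -/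
abbrev toBase {Y : Scheme.{u}} (π : Y ⟶ Line X) : Y ⟶ X := π ≫ (Line X ↘ X)

/-- The pullback to `Y` of the coordinate `t` of `𝔸¹`. -/
def coordinate {Y : Scheme.{u}} (π : Y ⟶ Line X) : Γ(Y, ⊤) :=
  π.appTop (AffineSpace.coord X PUnit.unit)

/-- The ideal sheaf `(t)` of the scheme-theoretic central fibre `t = 0` of `Y`. -/
def centralFibre {Y : Scheme.{u}} (π : Y ⟶ Line X) : Y.IdealSheafData :=
  Scheme.IdealSheafData.ofIdealTop (Ideal.span {coordinate π})

/-- The open subscheme `t ≠ 0` of `Y`. -/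
def generic {Y : Scheme.{u}} (π : Y ⟶ Line X) : Y.Opens := Y.basicOpen (coordinate π)

/-- The ideal sheaf of the proper transform in `Y` of `Z × 𝔸¹`, for `Z ⊆ X` the closed subscheme
with ideal sheaf `K`: the scheme-theoretic closure in `Y` of the closed subscheme of `{t ≠ 0} ⊆ Y`
that is the preimage of `Z × (𝔸¹ ∖ 0)`. -/
def properTransform {Y : Scheme.{u}} (π : Y ⟶ Line X) (K : X.IdealSheafData) :
    Y.IdealSheafData :=
  ((K.comap (toBase π)).comap (generic π).ι).map (generic π).ι

/-- The ideal sheaf of the central fibre of the proper transform of `Z × 𝔸¹`: the copy of `Z` in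
the central fibre of `Y` (for `Y = X × 𝔸¹` it is `Z × {0}`). -/
def center {Y : Scheme.{u}} (π : Y ⟶ Line X) (K : X.IdealSheafData) : Y.IdealSheafData :=
  properTransform π K + centralFibre π

/-- The ideal `I₀ + t I₁ + ⋯ + t^(p-1) I_(p-1) + t^p` on `X × 𝔸¹`. -/
def flagIdeal {p : ℕ} (I : Fin p → X.IdealSheafData) : (Line X).IdealSheafData :=
  ∑ j : Fin p, centralFibre (𝟙 (Line X)) ^ (j : ℕ) * (I j).comap (Line X ↘ X) +
    centralFibre (𝟙 (Line X)) ^ p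

/-- The iterated blow-up of `X × 𝔸¹` along a flag `Z_(p-1) ⊆ ⋯ ⊆ Z_0 ⊆ X` of closed subschemes
with ideal sheaves `I_0, …, I_(p-1)`. One starts with `X × 𝔸¹`, and the stage `k + 1` is the
blow-up of the stage `k` in the copy of `Z_k` in its central fibre, the central fibre of the
proper transform of `Z_k × 𝔸¹`. -/
structure IteratedBlowup {p : ℕ} (I : Fin p → X.IdealSheafData) where
  stage : Fin (p + 1) → Scheme.{u}
  toLine : ∀ k, stage k ⟶ Line X
  isIso_toLine_zero : IsIso (toLine 0)
  blowdown : ∀ k : Fin p, stage k.succ ⟶ stage k.castSucc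
  toLine_succ : ∀ k : Fin p, toLine k.succ = blowdown k ≫ toLine k.castSucc
  isBlowup : ∀ k : Fin p, IsBlowup (blowdown k) (center (toLine k.castSucc) (I k))

/-! ### Actions of the multiplicative group -/

/-- An action of the multiplicative group scheme `𝔾ₘ` on `Y`, by Yoneda's lemma given on the
functors of points: the group `𝔾ₘ(T) = Γ(T, 𝒪)ˣ` acts on the set `Y(T)`, naturally in the
scheme `T`. -/
structure GmAction (Y : Scheme.{u}) where
  act : ∀ {T : Scheme.{u}}, Γ(T, ⊤)ˣ → (T ⟶ Y) → (T ⟶ Y)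
  comp_act : ∀ {T' T : Scheme.{u}} (f : T' ⟶ T) (l : Γ(T, ⊤)ˣ) (y : T ⟶ Y),
    act (Units.map f.appTop.hom.toMonoidHom l) (f ≫ y) = f ≫ act l y
  one_act : ∀ {T : Scheme.{u}} (y : T ⟶ Y), act 1 y = y
  mul_act : ∀ {T : Scheme.{u}} (l m : Γ(T, ⊤)ˣ) (y : T ⟶ Y), act (l * m) y = act l (act m y)

/-- Equivariance of a morphism. -/
def IsEquivariant {Y Z : Scheme.{u}} (a : GmAction Y) (b : GmAction Z) (f : Y ⟶ Z) : Prop :=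
  ∀ {T : Scheme.{u}} (l : Γ(T, ⊤)ˣ) (y : T ⟶ Y), a.act l y ≫ f = b.act l (y ≫ f)

/-- The standard action on `X × 𝔸¹`: `l · (x, t) = (x, l t)`. -/
def lineAction (X : Scheme.{u}) : GmAction (Line X) where
  act l y := AffineSpace.homOfVector (y ≫ (Line X ↘ X)) fun _ ↦ l.val * coordinate y
  comp_act f l y := by
    rw [AffineSpace.comp_homOfVector]
    congr 1
    funext i
    simp [coordinate]
    rfl
  one_act y := by
    apply AffineSpace.hom_ext
    · simp
    · rintro ⟨⟩
      rw [AffineSpace.homOfVector_appTop_coord]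
      simp [coordinate]
  mul_act l m y := by
    apply AffineSpace.hom_ext
    · simp
    · rintro ⟨⟩
      simp only [AffineSpace.homOfVector_appTop_coord, coordinate, Units.val_mul, mul_assoc]

lemma lineAction_over (X : Scheme.{u}) {T : Scheme.{u}} (l : Γ(T, ⊤)ˣ) (y : T ⟶ Line X) :
    (lineAction X).act l y ≫ (Line X ↘ X) = y ≫ (Line X ↘ X) := by
  simp [lineAction]

/-- A lift along `π : Y ⟶ X × 𝔸¹` of the standard action on `X × 𝔸¹`. -/
structure LiftedAction {Y : Scheme.{u}} (π : Y ⟶ Line X) extends GmAction Y where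
  equivariant : IsEquivariant toGmAction (lineAction X) π

lemma LiftedAction.act_toBase {Y : Scheme.{u}} {π : Y ⟶ Line X} (a : LiftedAction π)
    {T : Scheme.{u}} (l : Γ(T, ⊤)ˣ) (y : T ⟶ Y) :
    a.act l y ≫ toBase π = y ≫ toBase π := by
  rw [← Category.assoc, a.equivariant, lineAction_over, Category.assoc]

/-! ### Line bundles and linearisations -/

open Scheme.Modules

/-- A line bundle: a sheaf of modules locally isomorphic to the structure sheaf. -/
def IsLineBundle {Y : Scheme.{u}} (M : Y.Modules) : Prop :=
  ∀ y : Y, ∃ U : Y.Opens, y ∈ U ∧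
    Nonempty (M.restrict U.ι ≅ SheafOfModules.unit U.toScheme.ringCatSheaf)

/-- `M(-D)` for the closed subscheme `i : D ⟶ Y` with ideal sheaf `J`: the kernel of the
restriction `M ⟶ M|_D = i_* i^* M`. For a line bundle `M` and an invertible `J` it is the line
bundle `M ⊗ 𝒪(-D)`. -/
def twist {Y : Scheme.{u}} (J : Y.IdealSheafData) (M : Y.Modules) : Y.Modules :=
  Limits.kernel ((pullbackPushforwardAdjunction J.subschemeι).unit.app M)

/-- The inclusion `M(-D) ⟶ M`. -/
def twistι {Y : Scheme.{u}} (J : Y.IdealSheafData) (M : Y.Modules) : twist J M ⟶ M :=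
  Limits.kernel.ι _

/-- A `𝔾ₘ`-linearisation of `N`: isomorphisms `(l · y)^* N ≅ y^* N`, natural in the `T`-point `y`
of `Y` and `l ∈ 𝔾ₘ(T)`, that satisfy the cocycle condition. -/
structure Linearisation {Y : Scheme.{u}} (a : GmAction Y) (N : Y.Modules) where
  iso : ∀ {T : Scheme.{u}} (l : Γ(T, ⊤)ˣ) (y : T ⟶ Y),
    (pullback (a.act l y)).obj N ≅ (pullback y).obj N
  naturality : ∀ {T' T : Scheme.{u}} (f : T' ⟶ T) (l : Γ(T, ⊤)ˣ) (y : T ⟶ Y),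
    iso (Units.map f.appTop.hom.toMonoidHom l) (f ≫ y) =
      (pullbackCongr (a.comp_act f l y)).app N ≪≫ ((pullbackComp f (a.act l y)).app N).symm ≪≫
        (pullback f).mapIso (iso l y) ≪≫ (pullbackComp f y).app N
  cocycle : ∀ {T : Scheme.{u}} (l m : Γ(T, ⊤)ˣ) (y : T ⟶ Y),
    iso (l * m) y = (pullbackCongr (a.mul_act l m y)).app N ≪≫ iso l (a.act m y) ≪≫ iso m y

/-- The isomorphism `(l · y)^* L_Y ≅ y^* L_Y` for the pullback `L_Y` to `Y` of a sheaf `L` on `X`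
with the trivial linearisation. -/
def baseIso {Y : Scheme.{u}} {π : Y ⟶ Line X} (a : LiftedAction π) (L : X.Modules)
    {T : Scheme.{u}} (l : Γ(T, ⊤)ˣ) (y : T ⟶ Y) :
    (pullback (a.act l y)).obj ((pullback (toBase π)).obj L) ≅
      (pullback y).obj ((pullback (toBase π)).obj L) :=
  (pullbackComp (a.act l y) (toBase π)).app L ≪≫
    (pullbackCongr (a.act_toBase l y)).app L ≪≫ ((pullbackComp y (toBase π)).app L).symm

/-- A sheaf `N` on `Y` with a morphism (in practice an inclusion of line bundles) to the pullback
of `L` to `Y`. -/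
abbrev Twisted {Y : Scheme.{u}} (π : Y ⟶ Line X) (L : X.Modules) :=
  Over ((pullback (toBase π)).obj L)

/-- The linearisation of `N` is induced from that of the pullback of `L`, along the given
morphism from `N` to this pullback. -/
def Linearisation.IsNatural {Y : Scheme.{u}} {π : Y ⟶ Line X} {a : LiftedAction π}
    {L : X.Modules} {N : Twisted π L} (Φ : Linearisation a.toGmAction N.left) : Prop :=
  ∀ {T : Scheme.{u}} (l : Γ(T, ⊤)ˣ) (y : T ⟶ Y),
    (Φ.iso l y).hom ≫ (pullback y).map N.hom =
      (pullback (a.act l y)).map N.hom ≫ (baseIso a L l y).hom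

/-- `β^* N`, as a sheaf with a morphism to the pullback of `L`, for `β : Y' ⟶ Y` over
`X × 𝔸¹`. -/
def pullbackTwisted {Y' Y : Scheme.{u}} {π' : Y' ⟶ Line X} {π : Y ⟶ Line X} (β : Y' ⟶ Y)
    (h : π' = β ≫ π) {L : X.Modules} (N : Twisted π L) : Twisted π' L :=
  Over.mk (Y := (pullback β).obj N.left) <|
    (pullback β).map N.hom ≫ (pullbackComp β (toBase π)).hom.app L ≫
      (pullbackCongr (show β ≫ toBase π = toBase π' by simp [h])).hom.app L

/-- `N(-D) ⟶ N`, as a sheaf with a morphism to the pullback of `L`. -/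
def twistTwisted {Y : Scheme.{u}} {π : Y ⟶ Line X} {L : X.Modules} (J : Y.IdealSheafData)
    (N : Twisted π L) : Twisted π L :=
  Over.mk (twistι J N.left ≫ N.hom)

/-- The pullback of `L` itself. -/
def pullbackBase {Y : Scheme.{u}} (π : Y ⟶ Line X) (L : X.Modules) : Twisted π L :=
  Over.mk (𝟙 ((pullback (toBase π)).obj L))

/-- The polarisation `L(-cP)` on a blow-up `π : B ⟶ X × 𝔸¹` in the ideal `J`, where `P` is the
exceptional divisor. -/
def polarisation {B : Scheme.{u}} (π : B ⟶ Line X) (J : (Line X).IdealSheafData)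
    (L : X.Modules) (c : ℕ) : Twisted π L :=
  twistTwisted (J.comap π ^ c) (pullbackBase π L)

/-- The natural polarisations on the stages of the iterated blow-up: start with `L` and, at each
stage, pull back and subtract `c` times the exceptional divisor. -/
def IteratedBlowup.polarisation {p : ℕ} {I : Fin p → X.IdealSheafData} (Y : IteratedBlowup I)
    (L : X.Modules) (c : ℕ) : ∀ k, Twisted (Y.toLine k) L :=
  Fin.induction (pullbackBase (Y.toLine 0) L) fun k N ↦
    twistTwisted ((center (Y.toLine k.castSucc) (I k)).comap (Y.blowdown k) ^ c)
      (pullbackTwisted (Y.blowdown k) (Y.toLine_succ k) N)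

/-- `φ : q^* M ≅ N` commutes with the linearisations of `M` and `N`, for `q` equivariant. -/
def IsEquivariantIso {Y Z : Scheme.{u}} {a : GmAction Y} {b : GmAction Z} {q : Y ⟶ Z}
    (hq : IsEquivariant a b q) {M : Z.Modules} {N : Y.Modules} (Ψ : Linearisation b M)
    (Φ : Linearisation a N) (φ : (pullback q).obj M ≅ N) : Prop :=
  ∀ {T : Scheme.{u}} (l : Γ(T, ⊤)ˣ) (y : T ⟶ Y),
    (pullback (a.act l y)).mapIso φ ≪≫ Φ.iso l y =
      (pullbackComp (a.act l y) q).app M ≪≫ (pullbackCongr (hq l y)).app M ≪≫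
        Ψ.iso l (y ≫ q) ≪≫ ((pullbackComp y q).app M).symm ≪≫ (pullback y).mapIso φ

end IterBlowup

end

open IterBlowup

noncomputable section

namespace IterBlowup

open Scheme

/-! ### Inverse images of ideal sheaves on affine open subschemes -/

/-! Write F_n = I_0 + t I_1 + ⋯ + t^(n-1) I_(n-1) + (t^n), which is `lineFlag` for the family
continued by the unit ideal, and K_k = F_1 ⋯ F_k, which is `lineProd`. The heart of the proof is
that the k-th stage Y_k is itself the blow-up of X × 𝔸¹ in K_k (`IteratedBlowup.isBlowup_toLine`).
This follows by induction from an identity on Y_k, `IsBlowup.comap_lineFlag_succ`: the inverse image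
of F_(k+1) is that of F_k times the ideal of the centre of the next blow-up. A product of ideals is
invertible exactly when its factors are, so making K_(k+1) invertible amounts to making K_k and then
the centre invertible. The two universal properties therefore compose (`IsBlowup.comp_lineProd`).

The identity is local. Near a point of Y_k the ideal F_k is generated by some g, and t^k = g m. If m
is a unit there, the point lies in the chart where t^(1+⋯+k) generates K_k. The chart ring is
generated over C, the functions on X × 𝔸¹, by the quotients of K_k by this power of t. The nesting
of the ideals shows that each element of this ring is a function from C plus an element which t^k
carries into I_0 + ⋯ + t^(k-1) I_(k-1). Since t is regular modulo I_k on X × 𝔸¹, this computes the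
proper transform (`map_flagPow_succ`). If m vanishes at the point, F_k is already generated by its
terms without t^k, so t^k lies in I_k. The proper transform of Z_k is then empty nearby, and both
sides equal F_k.

Consequently F_p becomes invertible on Y_p, and the universal property of B gives q. Blow-ups of
locally Noetherian schemes are proper by the valuative criterion, checked on charts
(`IsBlowup.isProper`). All ideals involved contain a power of t, so all blow-ups are isomorphisms
over t ≠ 0, and this locus is dense because t stays regular. Hence q is a contraction
(`isContraction_of_isBlowup`).

The ideals are 𝔾ₘ-invariant, so actions come from the universal property. An arbitrary T-point need
not pull an invertible ideal back to an invertible one, so everything is built and checked at the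
universal point of 𝔾ₘ × Y (or 𝔾ₘ × 𝔾ₘ × Y), which is flat over Y, and then pulled back
(`IsBlowup.liftedAction`, `linIso_mul`).

For the polarisations, `IsTwist` records that N ⟶ M is locally multiplication by a regular generator
of an ideal. Such an N is unique over M (`IsTwist.exists_iso`). Iterating the key identity shows
that N_p and q^*(L(-cP)) are both twists of the pullback of L by the c-th power of F_p. The same
uniqueness produces the linearisations, and the fact that such inclusions are monomorphisms forces
all compatibilities. -/

lemma comap_ideal_top {Y Z : Scheme.{u}} [IsAffine Y] [IsAffine Z] (I : Z.IdealSheafData)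
    (f : Y ⟶ Z) : (I.comap f).ideal ⟨⊤, isAffineOpen_top Y⟩ =
      (I.ideal ⟨⊤, isAffineOpen_top Z⟩).map f.appTop.hom := by
  apply le_antisymm
  -- By the adjunction with `map`, it is enough to test `I.comap f` against the sheaf associated
  -- with the extended ideal.
  · have h : I.comap f ≤ IdealSheafData.ofIdealTop
        ((I.ideal ⟨⊤, isAffineOpen_top Z⟩).map f.appTop.hom) := by
      rw [← IdealSheafData.le_map_iff_comap_le]
      apply IdealSheafData.le_of_isAffine
      rw [IdealSheafData.ideal_map _ _ _ (isAffineOpen_top Y)]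
      rw [← Ideal.map_le_iff_le_comap]
      have := IdealSheafData.equivOfIsAffine.apply_symm_apply
        ((I.ideal ⟨⊤, isAffineOpen_top Z⟩).map f.appTop.hom)
      exact this.ge
    have h2 := h ⟨⊤, isAffineOpen_top Y⟩
    have := IdealSheafData.equivOfIsAffine.apply_symm_apply
        ((I.ideal ⟨⊤, isAffineOpen_top Z⟩).map f.appTop.hom)
    exact h2.trans this.le
  · rw [Ideal.map_le_iff_le_comap]
    have := I.le_map_comap f ⟨⊤, isAffineOpen_top Z⟩
    rwa [IdealSheafData.ideal_map _ _ _ (isAffineOpen_top Y)] at this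

lemma ideal_comap_ι {Y : Scheme.{u}} (I : Y.IdealSheafData) (U : Y.affineOpens) :
    (I.comap U.1.ι).ideal ⟨⊤, haveI : IsAffine U.1 := U.2; isAffineOpen_top _⟩ =
      (I.ideal U).map U.1.topIso.inv.hom := by
  have : IsAffine U.1 := U.2
  rw [IdealSheafData.ideal_comap_of_isOpenImmersion]
  have h := I.map_ideal' (V := U) (U := ⟨U.1.ι ''ᵁ ⊤, (isAffineOpen_top _).image_of_isOpenImmersion _⟩)
    (eqToHom U.1.ι_image_top).op
  rw [Scheme.Opens.ι_appIso, Scheme.Opens.topIso_inv]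
  exact (Ideal.comap_id (I.ideal ⟨U.1.ι ''ᵁ ⊤,
    (isAffineOpen_top _).image_of_isOpenImmersion _⟩)).trans h.symm

/-- Inverse images commute with restriction to `U` and `V`, which reduces the claim to a morphism of
affine schemes and its global sections. The rest removes the identifications `topIso`. -/
theorem ideal_comap {Y Z : Scheme.{u}} (I : Z.IdealSheafData) (f : Y ⟶ Z) (U : Z.affineOpens)
    (V : Y.affineOpens) (h : V.1 ≤ f ⁻¹ᵁ U.1) :
    (I.comap f).ideal V = (I.ideal U).map (f.appLE U.1 V.1 h).hom := by
  have : IsAffine U.1 := U.2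
  have : IsAffine V.1 := V.2
  have e : (I.comap f).comap V.1.ι = (I.comap U.1.ι).comap (f.resLE U.1 V.1 h) := by
    rw [← IdealSheafData.comap_comp, ← IdealSheafData.comap_comp, Scheme.Hom.resLE_comp_ι]
  have e1 := congr_arg (fun J ↦ J.ideal ⟨⊤, isAffineOpen_top _⟩) e
  simp only [comap_ideal_top, ideal_comap_ι] at e1
  rw [Ideal.map_map, Scheme.Hom.appTop, Scheme.Hom.resLE_app_top, ← CommRingCat.hom_comp,
    Iso.inv_hom_id_assoc] at e1
  have e2 := congr_arg (Ideal.map V.1.topIso.hom.hom) e1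
  rwa [Ideal.map_map, Ideal.map_map, ← CommRingCat.hom_comp, ← CommRingCat.hom_comp, Category.assoc,
    Iso.inv_hom_id, Category.comp_id, CommRingCat.hom_id, Ideal.map_id] at e2

/-- Around every point of the source there are affine opens, as small as wanted, lying over
affine opens, as small as wanted, of the target. -/
lemma exists_affine_le {Y : Scheme.{u}} {W : Y.Opens} {y : Y} (hy : y ∈ W) :
    ∃ V : Y.affineOpens, y ∈ V.1 ∧ V.1 ≤ W := by
  obtain ⟨_, ⟨V, hV, rfl⟩, hyV, hVW⟩ :=
    Y.isBasis_affineOpens.exists_subset_of_mem_open hy W.isOpen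
  exact ⟨⟨V, hV⟩, hyV, hVW⟩

lemma IdealSheafData.ext_of_locally {Y : Scheme.{u}} {I J : Y.IdealSheafData}
    (h : ∀ y : Y, ∃ U : Y.affineOpens, y ∈ U.1 ∧ I.ideal U = J.ideal U) : I = J := by
  choose U hU h using h
  refine IdealSheafData.ext_of_iSup_eq_top U ?_ h
  exact eq_top_iff.mpr fun y _ ↦ TopologicalSpace.Opens.mem_iSup.mpr ⟨y, hU y⟩

lemma exists_affine_over {Y Z : Scheme.{u}} (f : Y ⟶ Z) (y : Y) (W : Y.Opens) (hy : y ∈ W) :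
    ∃ (U : Z.affineOpens) (V : Y.affineOpens), y ∈ V.1 ∧ V.1 ≤ f ⁻¹ᵁ U.1 ∧ V.1 ≤ W := by
  obtain ⟨U, hU, -⟩ := exists_affine_le (W := (⊤ : Z.Opens)) (y := f y) trivial
  obtain ⟨V, hV, hVW⟩ := exists_affine_le (W := f ⁻¹ᵁ U.1 ⊓ W) (y := y) ⟨hU, hy⟩
  exact ⟨U, V, hV, hVW.trans inf_le_left, hVW.trans inf_le_right⟩

lemma comap_mul {Y Z : Scheme.{u}} (I J : Z.IdealSheafData) (f : Y ⟶ Z) :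
    (I * J).comap f = I.comap f * J.comap f := by
  refine IdealSheafData.ext_of_locally fun y ↦ ?_
  obtain ⟨U, V, hV, h, -⟩ := exists_affine_over f y ⊤ trivial
  exact ⟨V, hV, by simp [ideal_comap _ f U V h, Ideal.map_mul]⟩

lemma comap_pow {Y Z : Scheme.{u}} (I : Z.IdealSheafData) (f : Y ⟶ Z) (n : ℕ) :
    (I ^ n).comap f = I.comap f ^ n := by
  refine IdealSheafData.ext_of_locally fun y ↦ ?_
  obtain ⟨U, V, hV, h, -⟩ := exists_affine_over f y ⊤ trivial
  exact ⟨V, hV, by simp [ideal_comap _ f U V h, Ideal.map_pow]⟩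

/-- The inverse image of ideal sheaves, as a homomorphism of semirings. -/
def comapHom {Y Z : Scheme.{u}} (f : Y ⟶ Z) : Z.IdealSheafData →+* Y.IdealSheafData where
  toFun I := I.comap f
  map_one' := IdealSheafData.comap_top f
  map_zero' := IdealSheafData.comap_bot f
  map_add' I J := IdealSheafData.comap_sup I J f
  map_mul' I J := comap_mul I J f

lemma comapHom_apply {Y Z : Scheme.{u}} (f : Y ⟶ Z) (I : Z.IdealSheafData) :
    comapHom f I = I.comap f := rfl

/-- Sections over an affine open, as a homomorphism of semirings. -/
def idealHom {Y : Scheme.{u}} (U : Y.affineOpens) : Y.IdealSheafData →+* Ideal Γ(Y, U.1) where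
  toFun I := I.ideal U
  map_one' := by simp [Ideal.one_eq_top]
  map_zero' := rfl
  map_add' _ _ := rfl
  map_mul' _ _ := rfl

/-! ### Regular sections -/

/-- Restriction of functions. -/
abbrev res {Y : Scheme.{u}} {V U : Y.Opens} (h : V ≤ U) : Γ(Y, U) →+* Γ(Y, V) :=
  (Y.presheaf.map (homOfLE h).op).hom

lemma res_res {Y : Scheme.{u}} {W V U : Y.Opens} (h : V ≤ U) (h' : W ≤ V) (f : Γ(Y, U)) :
    res h' (res h f) = res (h'.trans h) f := by
  simp only [← CommRingCat.comp_apply, ← Functor.map_comp, ← op_comp, homOfLE_comp]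

lemma appLE_res {Y Z : Scheme.{u}} (f : Y ⟶ Z) {U : Z.Opens} {V W : Y.Opens} (h : V ≤ f ⁻¹ᵁ U)
    (h' : W ≤ V) (s : Γ(Z, U)) :
    res h' ((f.appLE U V h).hom s) = (f.appLE U W (h'.trans h)).hom s := by
  rw [← Scheme.Hom.appLE_map f h (homOfLE h').op]; rfl

lemma res_appLE {Y Z : Scheme.{u}} (f : Y ⟶ Z) {U U' : Z.Opens} {V : Y.Opens} (h : V ≤ f ⁻¹ᵁ U')
    (h' : U' ≤ U) (s : Γ(Z, U)) :
    (f.appLE U' V h).hom (res h' s) =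
      (f.appLE U V (h.trans fun _ hx ↦ h' hx)).hom s := by
  rw [← Scheme.Hom.map_appLE f h (homOfLE h').op]; rfl

/-- A section that remains a nonzerodivisor on all smaller opens. -/
def IsRegularSection {Y : Scheme.{u}} {U : Y.Opens} (f : Γ(Y, U)) : Prop :=
  ∀ (V : Y.Opens) (h : V ≤ U), res h f ∈ nonZeroDivisors Γ(Y, V)

lemma mem_nonZeroDivisors_of_flat {A B : Type*} [CommRing A] [CommRing B] {φ : A →+* B}
    (hφ : φ.Flat) {a : A} (ha : a ∈ nonZeroDivisors A) : φ a ∈ nonZeroDivisors B := by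
  algebraize [φ]
  have := Module.Flat.isSMulRegular_of_nonZeroDivisors (M := B) ha
  refine mem_nonZeroDivisors_iff_right.mpr fun x hx ↦ this ?_
  change φ a * x = φ a * 0
  rw [mul_zero, mul_comm, hx]

lemma appLE_mem_nonZeroDivisors {Y Z : Scheme.{u}} (f : Y ⟶ Z) [Flat f] (U : Z.affineOpens)
    (V : Y.affineOpens) (h : V.1 ≤ f ⁻¹ᵁ U.1) {a : Γ(Z, U.1)} (ha : a ∈ nonZeroDivisors Γ(Z, U.1)) :
    (f.appLE U.1 V.1 h).hom a ∈ nonZeroDivisors Γ(Y, V.1) :=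
  mem_nonZeroDivisors_of_flat (HasRingHomProperty.appLE (P := @Flat) f inferInstance U V h) ha

lemma res_mem_nonZeroDivisors {Y : Scheme.{u}} {U V : Y.affineOpens} (h : V.1 ≤ U.1)
    {a : Γ(Y, U.1)} (ha : a ∈ nonZeroDivisors Γ(Y, U.1)) :
    res h a ∈ nonZeroDivisors Γ(Y, V.1) := by
  have := appLE_mem_nonZeroDivisors (𝟙 Y) U V h ha
  exact this

lemma eq_of_res_eq {Y : Scheme.{u}} {U : Y.Opens} {a b : Γ(Y, U)}
    (h : ∀ y ∈ U, ∃ (V : Y.Opens) (hV : V ≤ U), y ∈ V ∧ res hV a = res hV b) : a = b := by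
  choose V hV hy h using h
  exact Y.IsSheaf.section_ext fun y hyU ↦ ⟨V y hyU, hV y hyU, hy y hyU, h y hyU⟩

lemma isRegularSection_of_locally {Y : Scheme.{u}} {U : Y.Opens} {f : Γ(Y, U)}
    (h : ∀ y ∈ U, ∃ (V : Y.affineOpens) (hV : V.1 ≤ U), y ∈ V.1 ∧
      res hV f ∈ nonZeroDivisors Γ(Y, V.1)) : IsRegularSection f := by
  refine fun W hW ↦ mem_nonZeroDivisors_iff_right.mpr fun x hx ↦ eq_of_res_eq fun y hy ↦ ?_
  obtain ⟨V, hV, hyV, hf⟩ := h y (hW hy)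
  obtain ⟨V', hyV', hV'⟩ := exists_affine_le (W := V.1 ⊓ W) (y := y) ⟨hyV, hy⟩
  refine ⟨V'.1, hV'.trans inf_le_right, hyV', ?_⟩
  have h1 := res_mem_nonZeroDivisors (hV'.trans inf_le_left) hf
  rw [map_zero]
  refine (mem_nonZeroDivisors_iff_right.mp h1) _ ?_
  have h2 := congr_arg (res (hV'.trans inf_le_right)) hx
  rw [map_mul, map_zero, res_res] at h2
  rwa [res_res]

lemma IsRegularSection.res {Y : Scheme.{u}} {U V : Y.Opens} {f : Γ(Y, U)}
    (h : IsRegularSection f) (hV : V ≤ U) : IsRegularSection (res hV f) := fun W hW ↦ by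
  rw [res_res]; exact h _ _

/-- Divisibility by a regular section is a local condition. -/
lemma IsRegularSection.dvd_of_locally {Y : Scheme.{u}} {U : Y.Opens} {f g : Γ(Y, U)}
    (hf : IsRegularSection f)
    (h : ∀ y ∈ U, ∃ (V : Y.Opens) (hV : V ≤ U), y ∈ V ∧ IterBlowup.res hV f ∣ IterBlowup.res hV g) :
    f ∣ g := by
  choose V hV hy a ha using h
  have hcov : U ≤ ⨆ y : U, V y.1 y.2 := fun y hyU ↦
    TopologicalSpace.Opens.mem_iSup.mpr ⟨⟨y, hyU⟩, hy y hyU⟩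
  obtain ⟨s, hs, -⟩ := Y.sheaf.existsUnique_gluing' (fun y : U ↦ V y.1 y.2) U
    (fun y ↦ homOfLE (hV y.1 y.2)) hcov (fun y ↦ a y.1 y.2) (by
      intro y z
      have hle : V y.1 y.2 ⊓ V z.1 z.2 ≤ U := inf_le_left.trans (hV y.1 y.2)
      have h0 := hf _ hle
      change IterBlowup.res inf_le_left (a y.1 y.2) = IterBlowup.res inf_le_right (a z.1 z.2)
      -- Since `f` is regular on the overlap, the two local quotients agree there and can be glued.
      refine (mul_cancel_left_mem_nonZeroDivisors h0).mp ?_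
      have h1 := congr_arg (IterBlowup.res (inf_le_left : V y.1 y.2 ⊓ V z.1 z.2 ≤ _)) (ha y.1 y.2)
      have h2 := congr_arg (IterBlowup.res (inf_le_right : V y.1 y.2 ⊓ V z.1 z.2 ≤ _)) (ha z.1 z.2)
      rw [map_mul, res_res, res_res] at h1 h2
      rw [← h1, ← h2])
  refine ⟨(s : Γ(Y, U)), eq_of_res_eq fun y hyU ↦ ⟨V y hyU, hV y hyU, hy y hyU, ?_⟩⟩
  rw [ha]
  exact (congr_arg _ (hs ⟨y, hyU⟩).symm).trans (map_mul _ _ _).symm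

/-! ### Invertible ideal sheaves -/

lemma ideal_of_le {Y : Scheme.{u}} {J : Y.IdealSheafData} {U V : Y.affineOpens} (h : V.1 ≤ U.1)
    {f : Γ(Y, U.1)} (hf : J.ideal U = Ideal.span {f}) : J.ideal V = Ideal.span {res h f} := by
  rw [← J.map_ideal (U := V) (V := U) h, hf, Ideal.map_span, Set.image_singleton]
  rfl

lemma IsInvertibleIdeal.exists_le {Y : Scheme.{u}} {J : Y.IdealSheafData}
    (hJ : IsInvertibleIdeal J) {W : Y.Opens} {y : Y} (hy : y ∈ W) :
    ∃ U : Y.affineOpens, y ∈ U.1 ∧ U.1 ≤ W ∧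
      ∃ f ∈ nonZeroDivisors Γ(Y, U.1), J.ideal U = Ideal.span {f} := by
  obtain ⟨U, hyU, f, hf, hJf⟩ := hJ y
  obtain ⟨V, hyV, hV⟩ := exists_affine_le (W := U.1 ⊓ W) (y := y) ⟨hyU, hy⟩
  have h : V.1 ≤ U.1 := hV.trans inf_le_left
  exact ⟨V, hyV, hV.trans inf_le_right, res h f, res_mem_nonZeroDivisors h hf, ideal_of_le h hJf⟩

/-- Near each point a regular generator is a multiple of `f`, and a divisor of a nonzerodivisor is a
nonzerodivisor. -/
lemma isRegularSection_of_ideal_eq_span {Y : Scheme.{u}} {J : Y.IdealSheafData}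
    (hJ : IsInvertibleIdeal J) {U : Y.affineOpens} {f : Γ(Y, U.1)}
    (hf : J.ideal U = Ideal.span {f}) : IsRegularSection f := by
  refine isRegularSection_of_locally fun y hy ↦ ?_
  obtain ⟨V, hyV, hV, g, hg, hJg⟩ := hJ.exists_le hy
  refine ⟨V, hV, hyV, ?_⟩
  have h : g ∈ Ideal.span {res hV f} := by
    rw [← ideal_of_le hV hf, hJg]; exact Ideal.mem_span_singleton_self g
  obtain ⟨a, rfl⟩ := Ideal.mem_span_singleton.mp h
  exact (mul_mem_nonZeroDivisors.mp hg).1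

lemma isInvertibleIdeal_top {Y : Scheme.{u}} : IsInvertibleIdeal (⊤ : Y.IdealSheafData) := by
  intro y
  obtain ⟨U, hU, -⟩ := exists_affine_le (W := (⊤ : Y.Opens)) (y := y) trivial
  exact ⟨U, hU, 1, one_mem _, by simp⟩

lemma IsInvertibleIdeal.mul {Y : Scheme.{u}} {I J : Y.IdealSheafData} (hI : IsInvertibleIdeal I)
    (hJ : IsInvertibleIdeal J) : IsInvertibleIdeal (I * J) := by
  intro y
  obtain ⟨U, hyU, f, hf, hIf⟩ := hI y
  obtain ⟨V, hyV, hV, g, hg, hJg⟩ := hJ.exists_le hyU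
  refine ⟨V, hyV, res hV f * g, mul_mem (res_mem_nonZeroDivisors hV hf) hg, ?_⟩
  rw [IdealSheafData.ideal_mul, Pi.mul_apply, ideal_of_le hV hIf, hJg,
    Ideal.span_singleton_mul_span_singleton]

lemma IsInvertibleIdeal.pow {Y : Scheme.{u}} {I : Y.IdealSheafData} (hI : IsInvertibleIdeal I)
    (n : ℕ) : IsInvertibleIdeal (I ^ n) := by
  induction n with
  | zero => rw [pow_zero]; exact isInvertibleIdeal_top
  | succ n ih => rw [pow_succ]; exact ih.mul hI

/-- If all products `a * b` lay in `fP`, so would `f`, and cancelling `f` would put 1 in `P`. So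
some `a * b` is `f * c` with `c` outside `P`. For `x` in `I`, writing `x * b = f * d` and cancelling
`f` gives `c * x = a * d`: after inverting `c`, the ideal `I` is generated by `a`. -/
lemma exists_isUnit_mul_of_mul_eq_span {A : Type*} [CommRing A] {I J : Ideal A} {f : A}
    (hf : f ∈ nonZeroDivisors A) (h : I * J = Ideal.span {f}) (P : Ideal A) [P.IsPrime] :
    ∃ a ∈ I, ∃ c ∉ P, (∃ b, a * b = f * c) ∧ ∀ x ∈ I, ∃ d, c * x = a * d := by
  have hfm : f ∈ I * J := h ▸ Ideal.mem_span_singleton_self f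
  have key : ∃ a ∈ I, ∃ b ∈ J, ∃ c ∉ P, a * b = f * c := by
    by_contra! H
    have hle : I * J ≤ Ideal.span {f} * P := by
      refine Ideal.mul_le.mpr fun a ha b hb ↦ ?_
      have : a * b ∈ Ideal.span {f} := h ▸ Ideal.mul_mem_mul ha hb
      obtain ⟨c, hc⟩ := Ideal.mem_span_singleton.mp this
      by_cases hcP : c ∈ P
      · rw [hc]; exact Ideal.mul_mem_mul (Ideal.mem_span_singleton_self f) hcP
      · exact absurd hc (H a ha b hb c hcP)
    obtain ⟨c, hcP, hc⟩ := Ideal.mem_span_singleton_mul.mp (hle hfm)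
    have : f * c = f * 1 := by rw [hc, mul_one]
    rw [mul_cancel_left_mem_nonZeroDivisors hf] at this
    exact (Ideal.ne_top_iff_one P).mp ‹P.IsPrime›.ne_top (this ▸ hcP)
  obtain ⟨a, ha, b, hb, c, hc, habc⟩ := key
  refine ⟨a, ha, c, hc, ⟨b, habc⟩, fun x hx ↦ ?_⟩
  have : x * b ∈ Ideal.span {f} := h ▸ Ideal.mul_mem_mul hx hb
  obtain ⟨d, hd⟩ := Ideal.mem_span_singleton.mp this
  refine ⟨d, (mul_cancel_left_mem_nonZeroDivisors hf).mp ?_⟩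
  rw [← mul_assoc, ← habc, mul_assoc, mul_comm b, hd]
  ring

lemma exists_prime_of_mem {Y : Scheme.{u}} (U : Y.affineOpens) {y : Y} (hy : y ∈ U.1) :
    ∃ P : Ideal Γ(Y, U.1), P.IsPrime ∧ ∀ f : Γ(Y, U.1), f ∉ P ↔ y ∈ Y.basicOpen f := by
  refine ⟨(U.2.primeIdealOf ⟨y, hy⟩).asIdeal, inferInstance, fun f ↦ ?_⟩
  have h := U.2.fromSpec_primeIdealOf ⟨y, hy⟩
  have h2 := U.2.fromSpec_preimage_basicOpen f
  have h3 : (U.2.primeIdealOf ⟨y, hy⟩) ∈ U.2.fromSpec ⁻¹ᵁ Y.basicOpen f ↔ y ∈ Y.basicOpen f := by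
    change U.2.fromSpec _ ∈ Y.basicOpen f ↔ _
    rw [h]
  rw [← h3, h2]
  rfl

/-- On the locus where `c` is invertible, the element `a` generates the first factor. It is regular
because it divides the regular section `f * c`. -/
lemma IsInvertibleIdeal.of_mul_left {Y : Scheme.{u}} {I J : Y.IdealSheafData}
    (h : IsInvertibleIdeal (I * J)) : IsInvertibleIdeal I := by
  intro y
  obtain ⟨U, hyU, f, hf, hIf⟩ := h y
  obtain ⟨P, hP, hPy⟩ := exists_prime_of_mem U hyU
  obtain ⟨a, ha, c, hc, ⟨b, hab⟩, H⟩ := exists_isUnit_mul_of_mul_eq_span hf hIf P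
  let V := Y.affineBasicOpen c
  have hV : V.1 ≤ U.1 := Y.basicOpen_le c
  have hcu : IsUnit (res hV c) := RingedSpace.isUnit_res_basicOpen _ c
  refine ⟨V, (hPy c).mp hc, res hV a, ?_, ?_⟩
  · have h1 : res hV a * res hV b ∈ nonZeroDivisors _ := by
      rw [← map_mul, hab, map_mul]
      exact mul_mem (res_mem_nonZeroDivisors hV hf) hcu.mem_nonZeroDivisors
    exact (mul_mem_nonZeroDivisors.mp h1).1
  · rw [← I.map_ideal (U := V) (V := U) hV]
    apply le_antisymm
    · rw [Ideal.map_le_iff_le_comap]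
      intro x hx
      obtain ⟨d, hd⟩ := H x hx
      rw [Ideal.mem_comap, Ideal.mem_span_singleton, ← hcu.dvd_mul_left]
      exact ⟨res hV d, by rw [← map_mul, ← hd, map_mul]; rfl⟩
    · rw [Ideal.span_singleton_le_iff_mem]
      exact Ideal.mem_map_of_mem _ ha

lemma IsInvertibleIdeal.of_mul_right {Y : Scheme.{u}} {I J : Y.IdealSheafData}
    (h : IsInvertibleIdeal (I * J)) : IsInvertibleIdeal J :=
  IsInvertibleIdeal.of_mul_left (J := I) (mul_comm I J ▸ h)

lemma IsInvertibleIdeal.comap {Y Z : Scheme.{u}} {J : Z.IdealSheafData} (hJ : IsInvertibleIdeal J)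
    (g : Y ⟶ Z) [Flat g] : IsInvertibleIdeal (J.comap g) := by
  intro y
  obtain ⟨U, hU, f, hf, hJf⟩ := hJ (g y)
  obtain ⟨V, hV, hVU⟩ := exists_affine_le (W := g ⁻¹ᵁ U.1) (y := y) hU
  refine ⟨V, hV, _, appLE_mem_nonZeroDivisors g U V hVU hf, ?_⟩
  rw [ideal_comap _ g U V hVU, hJf, Ideal.map_span, Set.image_singleton]

/-- An open subset inside the support would contain a nonempty affine open on which the regular
generator has empty nonvanishing locus. The generator would be nilpotent there, making 0 a
nonzerodivisor and the open empty. -/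
lemma IsInvertibleIdeal.dense_compl_support {Y : Scheme.{u}} {J : Y.IdealSheafData}
    (hJ : IsInvertibleIdeal J) : Dense ((J.support : Set Y)ᶜ) := by
  rw [dense_iff_inter_open]
  rintro W hW ⟨y, hy⟩
  obtain ⟨U, hyU, hUW, f, hf, hJf⟩ := hJ.exists_le (W := ⟨W, hW⟩) hy
  by_contra H
  rw [Set.not_nonempty_iff_eq_empty] at H
  have hb : Y.basicOpen f = ⊥ := by
    ext z
    refine ⟨fun hz ↦ ?_, fun hz ↦ hz.elim⟩
    have hzU : z ∈ U.1 := Y.basicOpen_le f hz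
    have : z ∈ W ∩ (J.support : Set Y)ᶜ := by
      refine ⟨hUW hzU, fun hzJ ↦ ?_⟩
      rw [SetLike.mem_coe, IdealSheafData.mem_support_iff_of_mem hzU, hJf,
        Scheme.zeroLocus_span, Scheme.mem_zeroLocus_iff] at hzJ
      exact hzJ f rfl hz
    rw [H] at this
    exact this.elim
  have : Subsingleton Γ(Y, Y.basicOpen f) := by rw [hb]; infer_instance
  obtain ⟨n, hn⟩ := exists_pow_mul_eq_zero_of_res_basicOpen_eq_zero_of_isAffineOpen Y U.2 1 f
    (Subsingleton.elim _ _)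
  rw [mul_one] at hn
  have h0 : (0 : Γ(Y, U.1)) ∈ nonZeroDivisors _ := hn ▸ pow_mem hf n
  have : Subsingleton Γ(Y, U.1) := subsingleton_iff_zero_eq_one.mp
    ((mem_nonZeroDivisors_iff_right.mp h0 1 (mul_zero _)).symm)
  have hU : U.1 = ⊥ := by
    have := Y.basicOpen_le (1 : Γ(Y, U.1))
    have h1 : Y.basicOpen (1 : Γ(Y, U.1)) = U.1 := by simp
    rw [← h1, Subsingleton.elim (1 : Γ(Y, U.1)) 0, Scheme.basicOpen_zero]
  rw [hU] at hyU
  exact hyU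

/-! ### Affine blow-up algebras -/

section Algebra

variable {A : Type u} [CommRing A]

/-- The affine blow-up algebra `A[I/f] ⊆ A_f`. -/
def blowupAlgebra (I : Ideal A) (f : A) : Subalgebra A (Localization.Away f) :=
  Algebra.adjoin A {x | ∃ i ∈ I, algebraMap A _ f * x = algebraMap A _ i}

variable {I : Ideal A} {f : A}

lemma isUnit_algebraMap_away : IsUnit (algebraMap A (Localization.Away f) f) :=
  IsLocalization.Away.algebraMap_isUnit f

lemma algebraMap_mem_nonZeroDivisors_blowupAlgebra :
    algebraMap A (blowupAlgebra I f) f ∈ nonZeroDivisors (blowupAlgebra I f) := by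
  refine mem_nonZeroDivisors_iff_right.mpr fun x hx ↦ Subtype.ext ?_
  have := congr_arg Subtype.val hx
  exact (isUnit_algebraMap_away (f := f)).mul_left_eq_zero.mp this

lemma exists_pow_mul_eq_algebraMap (x : blowupAlgebra I f) :
    ∃ (n : ℕ) (a : A), algebraMap A (blowupAlgebra I f) f ^ n * x = algebraMap A _ a := by
  obtain ⟨n, a, h⟩ := IsLocalization.Away.surj f (x : Localization.Away f)
  exact ⟨n, a, Subtype.ext ((mul_comm _ _).trans h)⟩

lemma exists_pow_mul_eq_zero {a : A} (h : algebraMap A (blowupAlgebra I f) a = 0) :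
    ∃ n : ℕ, f ^ n * a = 0 := by
  have h1 : algebraMap A (Localization.Away f) a = 0 := congr_arg Subtype.val h
  obtain ⟨⟨_, n, rfl⟩, hm⟩ := (IsLocalization.map_eq_zero_iff (Submonoid.powers f) _ a).mp h1
  exact ⟨n, hm⟩

lemma map_blowupAlgebra (hf : f ∈ I) :
    I.map (algebraMap A (blowupAlgebra I f)) = Ideal.span {algebraMap A _ f} := by
  apply le_antisymm
  · refine Ideal.map_le_iff_le_comap.mpr fun i hi ↦ Ideal.mem_span_singleton.mpr ?_
    obtain ⟨w, hw⟩ : algebraMap A (Localization.Away f) f ∣ algebraMap A _ i :=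
      isUnit_algebraMap_away.dvd
    exact ⟨⟨w, Algebra.subset_adjoin ⟨i, hi, hw.symm⟩⟩, Subtype.ext hw⟩
  · rw [Ideal.span_singleton_le_iff_mem]
    exact Ideal.mem_map_of_mem _ hf

variable {C : Type*} [CommRing C]

/-- A power of `f` carries each element into the image of `A`, and this power can be cancelled in
`C`. -/
lemma blowupAlgebra_hom_ext {ψ₁ ψ₂ : blowupAlgebra I f →+* C}
    (h : ∀ a, ψ₁ (algebraMap A _ a) = ψ₂ (algebraMap A _ a))
    (hf : ψ₁ (algebraMap A _ f) ∈ nonZeroDivisors C) : ψ₁ = ψ₂ := by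
  ext x
  obtain ⟨n, a, hx⟩ := exists_pow_mul_eq_algebraMap x
  refine (mul_cancel_left_mem_nonZeroDivisors (pow_mem hf n)).mp ?_
  have h1 := congr_arg ψ₁ hx
  have h2 := congr_arg ψ₂ hx
  rw [map_mul, map_pow] at h1 h2
  rw [h1, h, h f, h2]

/-- Localise `φ` to a map from `A_f` to the localisation of `C` at `φ f`. Since `φ f` is regular,
`C` is a subring of the target, and divisibility says that the generators `i / f` land in it. -/
lemma exists_blowupAlgebra_lift (φ : A →+* C) (hf : φ f ∈ nonZeroDivisors C)
    (h : ∀ i ∈ I, φ f ∣ φ i) :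
    ∃ ψ : blowupAlgebra I f →+* C, ∀ a, ψ (algebraMap A _ a) = φ a := by
  let D := Localization.Away (φ f)
  let ι : C →+* D := algebraMap C D
  have hι : Function.Injective ι :=
    IsLocalization.injective D (Submonoid.powers_le.mpr hf)
  have hu : IsUnit (ι (φ f)) := IsLocalization.Away.algebraMap_isUnit _
  let θ : Localization.Away f →+* D := IsLocalization.Away.lift (g := ι.comp φ) f hu
  have hθ : ∀ a, θ (algebraMap A _ a) = ι (φ a) := fun a ↦ IsLocalization.Away.lift_eq f hu a
  have hrange : ∀ x : blowupAlgebra I f, θ x ∈ ι.range := by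
    rintro ⟨x, hx⟩
    refine Algebra.adjoin_induction (p := fun x _ ↦ θ x ∈ ι.range) ?_ ?_ ?_ ?_ hx
    · rintro x ⟨i, hi, hx⟩
      obtain ⟨c, hc⟩ := h i hi
      refine ⟨c, hu.mul_left_cancel ?_⟩
      have := congr_arg θ hx
      rw [map_mul, hθ, hθ, hc, map_mul] at this
      exact this.symm
    · exact fun a ↦ ⟨φ a, (hθ a).symm⟩
    · intro x y _ _ hx hy
      rw [map_add]; exact add_mem hx hy
    · intro x y _ _ hx hy
      rw [map_mul]; exact mul_mem hx hy
  let e : C ≃+* ι.range := RingEquiv.ofBijective ι.rangeRestrict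
    ⟨fun x y hxy ↦ hι (congr_arg Subtype.val hxy), ι.rangeRestrict_surjective⟩
  let θ' : blowupAlgebra I f →+* ι.range :=
    (θ.comp (blowupAlgebra I f).val.toRingHom).codRestrict ι.range hrange
  refine ⟨e.symm.toRingHom.comp θ', fun a ↦ ?_⟩
  change e.symm (θ' _) = _
  rw [RingEquiv.symm_apply_eq]
  exact Subtype.ext (hθ a)

end Algebra

/-! ### Affine charts of blow-ups -/

lemma isAffineOpen_coe {Y : Scheme.{u}} (U : Y.affineOpens) : IsAffineOpen U.1 := U.2

lemma SpecMap_fromSpec_appLE {Y : Scheme.{u}} {U : Y.Opens} (hU : IsAffineOpen U)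
    {R : CommRingCat.{u}} (φ : Γ(Y, U) ⟶ R) (h : ⊤ ≤ (Spec.map φ ≫ hU.fromSpec) ⁻¹ᵁ U) :
    (Spec.map φ ≫ hU.fromSpec).appLE U ⊤ h = φ ≫ (Scheme.ΓSpecIso R).inv := by
  rw [Scheme.Hom.comp_appLE, hU.fromSpec_app_self, Category.assoc]
  erw [Scheme.Hom.map_appLE]
  rw [ΓSpecIso_inv_naturality]
  congr 1

lemma opens_ι_comp_eq {Y Z : Scheme.{u}} (f : Y ⟶ Z) {U : Z.Opens} (hU : IsAffineOpen U)
    (V : Y.Opens) (h : V ≤ f ⁻¹ᵁ U) :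
    V.ι ≫ f = V.toSpecΓ ≫ Spec.map (f.appLE U V h) ≫ hU.fromSpec := by
  rw [Scheme.Opens.toSpecΓ_SpecMap_appLE_assoc, hU.toSpecΓ_fromSpec, Scheme.Hom.resLE_comp_ι]

lemma exists_affine_isUnit {Y : Scheme.{u}} {U : Y.affineOpens} {a : Γ(Y, U.1)} {y : Y}
    (hy : y ∈ Y.basicOpen a) :
    ∃ (V : Y.affineOpens) (h : V.1 ≤ U.1), y ∈ V.1 ∧ IsUnit (res h a) :=
  ⟨Y.affineBasicOpen a, Y.basicOpen_le a, hy, RingedSpace.isUnit_res_basicOpen _ a⟩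

/-- The open subscheme of `Y'` over `U` where `f` generates the inverse image of `J`. -/
def generatedBy {Y' Y : Scheme.{u}} (π : Y' ⟶ Y) (J : Y.IdealSheafData) (U : Y.affineOpens)
    (f : Γ(Y, U.1)) : Y'.Opens :=
  ⨆ W : {W : Y'.affineOpens // ∃ h : W.1 ≤ π ⁻¹ᵁ U.1,
    (J.comap π).ideal W = Ideal.span {(π.appLE U.1 W.1 h).hom f}}, W.1.1

section Chart

variable {Y' Y : Scheme.{u}} {π : Y' ⟶ Y} {J : Y.IdealSheafData} {U : Y.affineOpens}
  {f : Γ(Y, U.1)}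

lemma mem_generatedBy {y : Y'} : y ∈ generatedBy π J U f ↔ ∃ W : Y'.affineOpens, y ∈ W.1 ∧
    ∃ h : W.1 ≤ π ⁻¹ᵁ U.1, (J.comap π).ideal W = Ideal.span {(π.appLE U.1 W.1 h).hom f} := by
  rw [generatedBy, TopologicalSpace.Opens.mem_iSup]
  exact ⟨fun ⟨W, hy⟩ ↦ ⟨W.1, hy, W.2⟩, fun ⟨W, hy, h⟩ ↦ ⟨⟨W, h⟩, hy⟩⟩

lemma generatedBy_le : generatedBy π J U f ≤ π ⁻¹ᵁ U.1 :=
  iSup_le fun W ↦ W.2.choose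

lemma exists_mem_generatedBy {y : Y'} (hy : y ∈ generatedBy π J U f) {O : Y'.Opens}
    (hO : y ∈ O) :
    ∃ W : Y'.affineOpens, y ∈ W.1 ∧ W.1 ≤ O ∧ W.1 ≤ generatedBy π J U f ∧
      ∃ h : W.1 ≤ π ⁻¹ᵁ U.1,
        (J.comap π).ideal W = Ideal.span {(π.appLE U.1 W.1 h).hom f} := by
  obtain ⟨W, hyW, h, hW⟩ := mem_generatedBy.mp hy
  obtain ⟨V, hyV, hV⟩ := exists_affine_le (W := W.1 ⊓ O) (y := y) ⟨hyW, hO⟩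
  have hVW : V.1 ≤ W.1 := hV.trans inf_le_left
  have h2 : (J.comap π).ideal V = Ideal.span {(π.appLE U.1 V.1 (hVW.trans h)).hom f} := by
    rw [ideal_of_le hVW hW, appLE_res]
  exact ⟨V, hyV, hV.trans inf_le_right, fun z hz ↦ mem_generatedBy.mpr ⟨V, hz, _, h2⟩, _, h2⟩

lemma isRegularSection_generatedBy (hJ : IsInvertibleIdeal (J.comap π)) :
    IsRegularSection ((π.appLE U.1 (generatedBy π J U f) generatedBy_le).hom f) := by
  refine isRegularSection_of_locally fun y hy ↦ ?_
  obtain ⟨W, hyW, -, hW, h, hWf⟩ := exists_mem_generatedBy hy (O := ⊤) trivial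
  refine ⟨W, hW, hyW, ?_⟩
  rw [appLE_res]
  have := isRegularSection_of_ideal_eq_span hJ hWf W.1 le_rfl
  rwa [appLE_res] at this

lemma appLE_mem_ideal_comap {W : Y'.affineOpens} (h : W.1 ≤ π ⁻¹ᵁ U.1) {a : Γ(Y, U.1)}
    (ha : a ∈ J.ideal U) : (π.appLE U.1 W.1 h).hom a ∈ (J.comap π).ideal W := by
  rw [ideal_comap _ π U W h]; exact Ideal.mem_map_of_mem _ ha

lemma dvd_generatedBy (hJ : IsInvertibleIdeal (J.comap π)) {a : Γ(Y, U.1)}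
    (ha : a ∈ J.ideal U) :
    (π.appLE U.1 (generatedBy π J U f) generatedBy_le).hom f ∣
      (π.appLE U.1 (generatedBy π J U f) generatedBy_le).hom a := by
  refine (isRegularSection_generatedBy hJ).dvd_of_locally fun y hy ↦ ?_
  obtain ⟨W, hyW, -, hW, h, hWf⟩ := exists_mem_generatedBy hy (O := ⊤) trivial
  refine ⟨W.1, hW, hyW, ?_⟩
  rw [appLE_res, appLE_res, ← Ideal.mem_span_singleton, ← hWf]
  exact appLE_mem_ideal_comap h ha

lemma ideal_eq_span_of_le_generatedBy {W : Y'.affineOpens}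
    (hJ : IsInvertibleIdeal (J.comap π)) (hf : f ∈ J.ideal U)
    (hW : W.1 ≤ generatedBy π J U f) :
    (J.comap π).ideal W = Ideal.span {(π.appLE U.1 W.1 (hW.trans generatedBy_le)).hom f} := by
  apply le_antisymm
  · rw [ideal_comap _ π U W (hW.trans generatedBy_le), Ideal.map_le_iff_le_comap]
    intro a ha
    rw [Ideal.mem_comap, Ideal.mem_span_singleton]
    have := map_dvd (res hW) (dvd_generatedBy (f := f) hJ ha)
    rwa [appLE_res, appLE_res] at this
  · rw [Ideal.span_singleton_le_iff_mem]
    exact appLE_mem_ideal_comap _ hf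

/-- If `g ≫ π` pulls `J` back to an invertible ideal generated by `f`, then `g` maps to the open
subscheme where `f` generates the inverse image of `J`. -/
lemma mem_generatedBy_of_comp {T : Scheme.{u}} (g : T ⟶ Y') (hJ : IsInvertibleIdeal (J.comap π))
    (hJT : IsInvertibleIdeal (J.comap (g ≫ π))) (hf : f ∈ J.ideal U) {x : T}
    (hx : x ∈ generatedBy (g ≫ π) J U f) : g x ∈ generatedBy π J U f := by
  have hxU : g x ∈ π ⁻¹ᵁ U.1 := generatedBy_le (π := g ≫ π) hx
  obtain ⟨W, hgW, hWU, e, he, hWe⟩ := hJ.exists_le hxU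
  have hfW : (π.appLE U.1 W.1 hWU).hom f ∈ (J.comap π).ideal W := appLE_mem_ideal_comap hWU hf
  obtain ⟨a, ha⟩ := Ideal.mem_span_singleton.mp (hWe ▸ hfW)
  obtain ⟨V, hxV, hVW, hVgen, hVU, hV⟩ := exists_mem_generatedBy hx (O := g ⁻¹ᵁ W.1) hgW
  have h1 : (J.comap (g ≫ π)).ideal V = Ideal.span {(g.appLE W.1 V.1 hVW).hom e} := by
    rw [IdealSheafData.comap_comp, ideal_comap _ g W V hVW, hWe, Ideal.map_span,
      Set.image_singleton]
  have hreg := isRegularSection_of_ideal_eq_span hJT h1 V.1 le_rfl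
  rw [appLE_res] at hreg
  have h2 : ((g ≫ π).appLE U.1 V.1 hVU).hom f =
      (g.appLE W.1 V.1 hVW).hom e * (g.appLE W.1 V.1 hVW).hom a := by
    rw [← map_mul, ← ha, ← CommRingCat.comp_apply, Scheme.Hom.appLE_comp_appLE]
  have h3 : (g.appLE W.1 V.1 hVW).hom e ∈ Ideal.span {((g ≫ π).appLE U.1 V.1 hVU).hom f} := by
    rw [← hV, h1]; exact Ideal.mem_span_singleton_self _
  obtain ⟨b, hb⟩ := Ideal.mem_span_singleton.mp h3
  -- On `V` both `e` and `f = e * a` generate the same ideal and `e` is regular, so the factor `a`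
  -- is invertible.
  have hu : IsUnit ((g.appLE W.1 V.1 hVW).hom a) := by
    refine IsUnit.of_mul_eq_one b ((mul_cancel_left_mem_nonZeroDivisors hreg).mp ?_)
    rw [← mul_assoc, ← h2, ← hb, mul_one]
  have hga : g x ∈ Y'.basicOpen a := by
    have : x ∈ T.basicOpen ((g.appLE W.1 V.1 hVW).hom a) := by
      rw [Scheme.basicOpen_of_isUnit _ hu]; exact hxV
    exact ((Scheme.basicOpen_appLE g _ _ hVW a).le this).2
  obtain ⟨D, hDW, hD, hDu⟩ := exists_affine_isUnit hga
  refine mem_generatedBy.mpr ⟨D, hD, hDW.trans hWU, ?_⟩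
  rw [ideal_of_le hDW hWe, ← appLE_res π hWU hDW, ha, map_mul,
    Ideal.span_singleton_mul_right_unit hDu]

variable (J U f) in
/-- The spectrum of the affine blow-up algebra `Γ(U)[J/f]`. -/
abbrev chart : Scheme.{u} := Spec (.of (blowupAlgebra (J.ideal U) f))

variable (J U f) in
/-- The structure homomorphism of the affine blow-up algebra. -/
def chartHom : Γ(Y, U.1) ⟶ .of (blowupAlgebra (J.ideal U) f) :=
  CommRingCat.ofHom (algebraMap Γ(Y, U.1) (blowupAlgebra (J.ideal U) f))

variable (J U f) in
/-- The structure morphism of a chart. -/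
def chartMap : chart J U f ⟶ Y :=
  Spec.map (chartHom J U f) ≫ (isAffineOpen_coe U).fromSpec

lemma le_chartMap_preimage : ⊤ ≤ chartMap J U f ⁻¹ᵁ U.1 := by
  rw [chartMap, Scheme.Hom.comp_preimage]
  have h : (isAffineOpen_coe U).fromSpec ⁻¹ᵁ U.1 = ⊤ := (isAffineOpen_coe U).fromSpec_preimage_self
  rw [h]
  exact le_rfl

lemma chartMap_appLE : (chartMap J U f).appLE U.1 ⊤ le_chartMap_preimage =
    chartHom J U f ≫ (Scheme.ΓSpecIso _).inv :=
  SpecMap_fromSpec_appLE U.2 _ _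

lemma comap_chartMap_ideal_top (hf : f ∈ J.ideal U) :
    (J.comap (chartMap J U f)).ideal ⟨⊤, isAffineOpen_top _⟩ =
      Ideal.span {((chartMap J U f).appLE U.1 ⊤ le_chartMap_preimage).hom f} := by
  have h : (J.ideal U).map (chartHom J U f).hom = Ideal.span {(chartHom J U f).hom f} :=
    map_blowupAlgebra hf
  have h2 : (J.ideal U).map ((chartMap J U f).appLE U.1 ⊤ le_chartMap_preimage).hom =
      Ideal.span {((chartMap J U f).appLE U.1 ⊤ le_chartMap_preimage).hom f} := by
    rw [chartMap_appLE, CommRingCat.hom_comp, ← Ideal.map_map, h, Ideal.map_span,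
      Set.image_singleton]
    rfl
  exact (ideal_comap _ _ U ⟨⊤, isAffineOpen_top _⟩ le_chartMap_preimage).trans h2

lemma chartMap_appLE_mem_nonZeroDivisors :
    ((chartMap J U f).appLE U.1 ⊤ le_chartMap_preimage).hom f ∈
      nonZeroDivisors Γ(chart J U f, ⊤) := by
  rw [chartMap_appLE]
  let e := (Scheme.ΓSpecIso (.of (blowupAlgebra (J.ideal U) f))).symm.commRingCatIsoToRingEquiv
  exact MulEquivClass.map_nonZeroDivisors e ▸ Submonoid.mem_map_of_mem e
    (algebraMap_mem_nonZeroDivisors_blowupAlgebra (I := J.ideal U) (f := f))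

lemma isInvertibleIdeal_comap_chartMap (hf : f ∈ J.ideal U) :
    IsInvertibleIdeal (J.comap (chartMap J U f)) := fun _ ↦
  ⟨⟨⊤, isAffineOpen_top _⟩, trivial, _, chartMap_appLE_mem_nonZeroDivisors,
    comap_chartMap_ideal_top hf⟩

/-- The open subscheme of a blow-up where `f` generates the inverse image ideal is the spectrum of
the affine blow-up algebra. -/
theorem IsBlowup.exists_chart (hπ : IsBlowup π J) (hf : f ∈ J.ideal U) :
    IsAffineOpen (generatedBy π J U f) ∧
      ∃ ψ : blowupAlgebra (J.ideal U) f →+* Γ(Y', generatedBy π J U f), Function.Bijective ψ ∧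
        ∀ a, ψ (algebraMap _ _ a) =
          (π.appLE U.1 (generatedBy π J U f) generatedBy_le).hom a := by
  obtain ⟨ψ, hψ⟩ := exists_blowupAlgebra_lift (I := J.ideal U) (f := f)
    (π.appLE U.1 (generatedBy π J U f) generatedBy_le).hom
    (isRegularSection_generatedBy hπ.invertible _ le_rfl |> fun h ↦ by rwa [appLE_res] at h)
    (fun i hi ↦ dvd_generatedBy hπ.invertible hi)
  -- The morphism `s` to `Y'` comes from the universal property of the blow-up, and `r` below in the
  -- other direction from that of the blow-up algebra. Uniqueness in the two properties makes them
  -- mutually inverse once `s` is seen to land in `V`.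
  obtain ⟨s, hs, -⟩ := hπ.existsUnique_lift _ (isInvertibleIdeal_comap_chartMap hf)
  let V := generatedBy π J U f
  let r : V.toScheme ⟶ chart J U f := V.toSpecΓ ≫ Spec.map (CommRingCat.ofHom ψ)
  have hr : r ≫ chartMap J U f = V.ι ≫ π := by
    rw [opens_ι_comp_eq π (U := U.1) U.2 V generatedBy_le]
    have h : chartHom J U f ≫ CommRingCat.ofHom ψ =
        π.appLE U.1 V generatedBy_le := by
      ext a
      exact hψ a
    rw [← h, Spec.map_comp]
    simp only [r, chartMap, Category.assoc]
  have hsV : Set.range s ⊆ Set.range V.ι := by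
    rw [Scheme.Opens.range_ι]
    rintro _ ⟨x, rfl⟩
    refine mem_generatedBy_of_comp s hπ.invertible
      (hs ▸ isInvertibleIdeal_comap_chartMap hf) hf ?_
    rw [hs]
    exact mem_generatedBy.mpr ⟨⟨⊤, isAffineOpen_top _⟩, trivial, le_chartMap_preimage,
      comap_chartMap_ideal_top hf⟩
  let s' : chart J U f ⟶ V.toScheme := IsOpenImmersion.lift V.ι s hsV
  have hs' : s' ≫ V.ι = s := IsOpenImmersion.lift_fac _ _ _
  have h1 : r ≫ s' = 𝟙 _ := by
    rw [← cancel_mono V.ι, Category.assoc, hs', Category.id_comp]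
    have hinv : IsInvertibleIdeal (J.comap (V.ι ≫ π)) := by
      rw [IdealSheafData.comap_comp]; exact hπ.invertible.comap _
    refine (hπ.existsUnique_lift _ hinv).unique ?_ rfl
    rw [Category.assoc, hs, hr]
  have h2 : s' ≫ r = 𝟙 _ := by
    have h3 : (s' ≫ r) ≫ chartMap J U f = chartMap J U f := by
      rw [Category.assoc, hr, ← Category.assoc, hs', hs]
    obtain ⟨ρ, hρ⟩ := Spec.map_surjective (s' ≫ r)
    rw [← hρ, chartMap, ← Category.assoc, cancel_mono, ← Spec.map_comp] at h3
    have h4 := Spec.map_injective h3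
    have h5 : ρ.hom = RingHom.id _ := by
      refine blowupAlgebra_hom_ext (fun a ↦ ?_) ?_
      · exact congr($(h4).hom a)
      · have : ρ.hom (algebraMap _ _ f) = algebraMap _ (blowupAlgebra (J.ideal U) f) f :=
          congr($(h4).hom f)
        rw [this]
        exact algebraMap_mem_nonZeroDivisors_blowupAlgebra
    have h6 : ρ = 𝟙 _ := by ext x; exact congr($h5 x)
    rw [← hρ, h6, Spec.map_id]
  have hiso : IsIso r := ⟨s', h1, h2⟩
  have hV : IsAffineOpen V := IsAffine.of_isIso r
  refine ⟨hV, ψ, ?_, hψ⟩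
  have hV2 : IsIso V.toSpecΓ := by
    rw [← IsAffineOpen.isoSpec_hom hV]; infer_instance
  have hψi : IsIso (Spec.map (CommRingCat.ofHom ψ)) :=
    IsIso.of_isIso_fac_left (f := V.toSpecΓ) (h := r) rfl
  exact isIso_SpecMap_iff.mp hψi

end Chart

section Chart

variable {Y' Y : Scheme.{u}} {π : Y' ⟶ Y} {J : Y.IdealSheafData} {U : Y.affineOpens}
  {f : Γ(Y, U.1)}

/-- Each generator is `g` times some `a s`. If all `a s` vanished at `y`, then `g` would lie in `gP`
for the prime `P` of `y`, and cancelling `g` would give 1 in `P`. -/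
lemma exists_generator_isUnit (hJ : IsInvertibleIdeal (J.comap π)) {S : Set Γ(Y, U.1)}
    (hS : J.ideal U = Ideal.span S) {y : Y'} (hy : π y ∈ U.1) :
    ∃ (W : Y'.affineOpens) (h : W.1 ≤ π ⁻¹ᵁ U.1), y ∈ W.1 ∧
      ∃ g ∈ nonZeroDivisors Γ(Y', W.1), (J.comap π).ideal W = Ideal.span {g} ∧
        ∃ a : Γ(Y, U.1) → Γ(Y', W.1),
          (∀ s ∈ S, (π.appLE U.1 W.1 h).hom s = g * a s) ∧ ∃ s ∈ S, y ∈ Y'.basicOpen (a s) := by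
  obtain ⟨W, hyW, hWU, g, hg, hWg⟩ := hJ.exists_le (W := π ⁻¹ᵁ U.1) hy
  have h1 : ∀ s ∈ S, ∃ b, (π.appLE U.1 W.1 hWU).hom s = g * b := fun s hs ↦
    Ideal.mem_span_singleton.mp (hWg ▸ appLE_mem_ideal_comap hWU (hS ▸ Ideal.subset_span hs))
  choose! a ha using h1
  refine ⟨W, hWU, hyW, g, hg, hWg, a, ha, ?_⟩
  obtain ⟨P, hP, hPy⟩ := exists_prime_of_mem W hyW
  simp_rw [← hPy]
  by_contra! H
  have hle : (J.comap π).ideal W ≤ Ideal.span {g} * P := by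
    rw [ideal_comap _ π U W hWU, hS, Ideal.map_span, Ideal.span_le]
    rintro _ ⟨s, hs, rfl⟩
    rw [ha s hs]
    exact Ideal.mul_mem_mul (Ideal.mem_span_singleton_self g) (H s hs)
  rw [hWg] at hle
  obtain ⟨c, hcP, hc⟩ := Ideal.mem_span_singleton_mul.mp (hle (Ideal.mem_span_singleton_self g))
  have h2 : g * c = g * 1 := by rw [hc, mul_one]
  rw [mul_cancel_left_mem_nonZeroDivisors hg] at h2
  exact (Ideal.ne_top_iff_one P).mp hP.ne_top (h2 ▸ hcP)

lemma basicOpen_le_generatedBy {W : Y'.affineOpens} (h : W.1 ≤ π ⁻¹ᵁ U.1) {g a : Γ(Y', W.1)}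
    (hWg : (J.comap π).ideal W = Ideal.span {g})
    (ha : (π.appLE U.1 W.1 h).hom f = g * a) :
    Y'.basicOpen a ≤ generatedBy π J U f := by
  intro y hy
  obtain ⟨D, hDW, hD, hDu⟩ := exists_affine_isUnit hy
  refine mem_generatedBy.mpr ⟨D, hD, hDW.trans h, ?_⟩
  rw [ideal_of_le hDW hWg, ← appLE_res π h hDW, ha, map_mul,
    Ideal.span_singleton_mul_right_unit hDu]

lemma exists_mem_generatedBy_of_span (hJ : IsInvertibleIdeal (J.comap π)) {S : Set Γ(Y, U.1)}
    (hS : J.ideal U = Ideal.span S) {y : Y'} (hy : π y ∈ U.1) :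
    ∃ s ∈ S, y ∈ generatedBy π J U s := by
  obtain ⟨W, h, hyW, g, hg, hWg, a, ha, s, hs, hys⟩ := exists_generator_isUnit hJ hS hy
  exact ⟨s, hs, basicOpen_le_generatedBy h hWg (ha s hs) hys⟩

/-- The coordinate ring of a chart is generated by the quotients `i / f` for `i` in a set of
generators of the ideal. -/
lemma IsBlowup.subring_eq_top (hπ : IsBlowup π J) (hf : f ∈ J.ideal U) {S : Set Γ(Y, U.1)}
    (hS : J.ideal U = Ideal.span S) (T : Subring Γ(Y', generatedBy π J U f))
    (h1 : ∀ a, (π.appLE U.1 (generatedBy π J U f) generatedBy_le).hom a ∈ T)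
    (h2 : ∀ s ∈ S, ∀ q, (π.appLE U.1 (generatedBy π J U f) generatedBy_le).hom f * q =
      (π.appLE U.1 (generatedBy π J U f) generatedBy_le).hom s → q ∈ T) : T = ⊤ := by
  obtain ⟨-, ψ, ⟨-, hψs⟩, hψ⟩ := hπ.exists_chart hf
  have hreg : (π.appLE U.1 (generatedBy π J U f) generatedBy_le).hom f ∈ nonZeroDivisors _ := by
    have := isRegularSection_generatedBy (f := f) hπ.invertible _ le_rfl
    rwa [appLE_res] at this
  set φ := (π.appLE U.1 (generatedBy π J U f) generatedBy_le).hom with hφ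
  have h3 : ∀ i ∈ J.ideal U, ∃ q ∈ T, φ f * q = φ i := by
    intro i hi
    rw [hS] at hi
    refine Submodule.span_induction (fun s hs ↦ ?_) ?_ ?_ ?_ hi
    · obtain ⟨q, hq⟩ := dvd_generatedBy (f := f) hπ.invertible (hS ▸ Ideal.subset_span hs)
      exact ⟨q, h2 s hs q hq.symm, hq.symm⟩
    · exact ⟨0, zero_mem _, by simp⟩
    · rintro x y - - ⟨q, hq, hqx⟩ ⟨r, hr, hry⟩
      exact ⟨q + r, add_mem hq hr, by rw [mul_add, map_add, hqx, hry]⟩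
    · rintro a x - ⟨q, hq, hqx⟩
      exact ⟨φ a * q, mul_mem (h1 a) hq, by rw [smul_eq_mul, map_mul, ← hqx]; ring⟩
  rw [eq_top_iff]
  rintro z -
  obtain ⟨⟨x, hx⟩, rfl⟩ := hψs z
  refine Algebra.adjoin_induction (p := fun x hx ↦ ψ ⟨x, hx⟩ ∈ T) ?_ ?_ ?_ ?_ hx
  · rintro x ⟨i, hi, hxi⟩
    obtain ⟨q, hq, hqi⟩ := h3 i hi
    convert hq
    refine (mul_cancel_left_mem_nonZeroDivisors hreg).mp ?_
    rw [hqi, ← hψ, ← hψ, ← map_mul]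
    exact congr_arg ψ (Subtype.ext hxi)
  · intro a
    have : ψ ⟨algebraMap _ _ a, Subalgebra.algebraMap_mem _ a⟩ = φ a := hψ a
    rw [this]; exact h1 a
  · intro x y hx hy hx' hy'
    have := add_mem hx' hy'
    rwa [← map_add] at this
  · intro x y hx hy hx' hy'
    have := mul_mem hx' hy'
    rwa [← map_mul] at this

/-- The chart ring embeds in the localisation at `f`, so only `f`-power torsion is lost. -/
lemma IsBlowup.exists_pow_mul_eq_zero (hπ : IsBlowup π J) (hf : f ∈ J.ideal U) {a : Γ(Y, U.1)}
    (ha : (π.appLE U.1 (generatedBy π J U f) generatedBy_le).hom a = 0) :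
    ∃ n : ℕ, f ^ n * a = 0 := by
  obtain ⟨-, ψ, ⟨hψi, -⟩, hψ⟩ := hπ.exists_chart hf
  refine IterBlowup.exists_pow_mul_eq_zero (I := J.ideal U) (hψi ?_)
  rw [hψ, ha, map_zero]

/-- The chart ring is a subring of the localisation at `f`, in which regular elements of the base
stay regular. Blow-ups are not flat in general, so this replaces flatness. -/
lemma IsBlowup.appLE_mem_nonZeroDivisors (hπ : IsBlowup π J) (hf : f ∈ J.ideal U) {a : Γ(Y, U.1)}
    (ha : a ∈ nonZeroDivisors Γ(Y, U.1)) :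
    (π.appLE U.1 (generatedBy π J U f) generatedBy_le).hom a ∈ nonZeroDivisors _ := by
  obtain ⟨-, ψ, hb, hψ⟩ := hπ.exists_chart hf
  rw [← hψ, mem_nonZeroDivisors_iff_right]
  intro z hz
  obtain ⟨x, rfl⟩ := hb.2 z
  rw [← map_mul, map_eq_zero_iff _ hb.1] at hz
  have h1 : (x : Localization.Away f) * algebraMap _ _ a = 0 := congr_arg Subtype.val hz
  have h2 : algebraMap _ (Localization.Away f) a ∈ nonZeroDivisors _ :=
    IsLocalization.map_nonZeroDivisors_le (Submonoid.powers f) _ ⟨a, ha, rfl⟩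
  rw [map_eq_zero_iff _ hb.1]
  exact Subtype.ext (mem_nonZeroDivisors_iff_right.mp h2 _ h1)

/-- The inverse image of an invertible ideal sheaf under a blow-up is invertible. -/
lemma IsBlowup.isInvertibleIdeal_comap (hπ : IsBlowup π J) {M : Y.IdealSheafData}
    (hM : IsInvertibleIdeal M) : IsInvertibleIdeal (M.comap π) := by
  intro y
  obtain ⟨U, hyU, m, hm, hMm⟩ := hM (π y)
  obtain ⟨f, hf, hyf⟩ := exists_mem_generatedBy_of_span hπ.invertible
    (Ideal.span_eq (J.ideal U)).symm hyU
  have hA := (hπ.exists_chart hf).1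
  have hreg := hπ.appLE_mem_nonZeroDivisors hf hm
  have hle : generatedBy π J U f ≤ π ⁻¹ᵁ U.1 := generatedBy_le
  change (π.appLE U.1 _ hle).hom m ∈ _ at hreg
  clear hm
  generalize generatedBy π J U f = V at *
  refine ⟨⟨V, hA⟩, hyf, _, hreg, ?_⟩
  rw [ideal_comap M π U ⟨V, hA⟩ hle, hMm, Ideal.map_span, Set.image_singleton]

/-! ### Blow-ups are proper -/

/-- With finitely many generators of the ideal, a chart ring is generated by their finitely many
quotients by `f`. -/
lemma IsBlowup.locallyOfFiniteType [IsLocallyNoetherian Y] (hπ : IsBlowup π J) :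
    LocallyOfFiniteType π := by
  rw [HasRingHomProperty.iff_exists_appLE (P := @LocallyOfFiniteType) (RingHom.finiteType_stableUnderComposition.stableUnderCompositionWithLocalizationAway
    RingHom.finiteType_holdsForLocalizationAway).1]
  intro y
  obtain ⟨U, hyU, -⟩ := exists_affine_le (W := (⊤ : Y.Opens)) (y := π y) trivial
  have : IsNoetherianRing Γ(Y, U.1) := IsLocallyNoetherian.component_noetherian U
  obtain ⟨S, hS⟩ := (IsNoetherian.noetherian (J.ideal U) : (J.ideal U).FG)
  obtain ⟨f, hfS, hyf⟩ := exists_mem_generatedBy_of_span hπ.invertible hS.symm hyU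
  have hf : f ∈ J.ideal U := hS ▸ Ideal.subset_span hfS
  refine ⟨U, ⟨_, (hπ.exists_chart hf).1⟩, hyf, generatedBy_le, ?_⟩
  have hdvd : ∀ s ∈ S, ∃ q, (π.appLE U.1 (generatedBy π J U f) generatedBy_le).hom s =
      (π.appLE U.1 (generatedBy π J U f) generatedBy_le).hom f * q := fun s hs ↦
    dvd_generatedBy (f := f) hπ.invertible (hS ▸ Ideal.subset_span hs)
  choose! q hq using hdvd
  have hreg : (π.appLE U.1 (generatedBy π J U f) generatedBy_le).hom f ∈ nonZeroDivisors _ := by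
    have := isRegularSection_generatedBy (f := f) hπ.invertible _ le_rfl
    rwa [appLE_res] at this
  change (π.appLE U.1 (generatedBy π J U f) generatedBy_le).hom.FiniteType
  algebraize [(π.appLE U.1 (generatedBy π J U f) generatedBy_le).hom]
  classical
  refine ⟨⟨S.image q, ?_⟩⟩
  have h := hπ.subring_eq_top hf hS.symm
    (Algebra.adjoin Γ(Y, U.1) ((S.image q : Finset _) : Set _)).toSubring
    (fun a ↦ Subalgebra.algebraMap_mem _ a) (fun s hs r hr ↦ by
      have : r = q s := (mul_cancel_left_mem_nonZeroDivisors hreg).mp (hr.trans (hq s hs))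
      rw [this]
      exact Algebra.subset_adjoin (by simpa using ⟨s, hs, rfl⟩))
  rw [eq_top_iff]
  rintro z -
  have hz : z ∈ (⊤ : Subring _) := trivial
  rw [← h] at hz
  exact hz

lemma IsBlowup.quasiCompact [IsLocallyNoetherian Y] (hπ : IsBlowup π J) : QuasiCompact π := by
  rw [quasiCompact_iff_forall_isAffineOpen]
  intro U hU
  have : IsNoetherianRing Γ(Y, U) := IsLocallyNoetherian.component_noetherian ⟨U, hU⟩
  obtain ⟨S, hS⟩ := (IsNoetherian.noetherian (J.ideal ⟨U, hU⟩) : (J.ideal ⟨U, hU⟩).FG)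
  have h : (π ⁻¹ᵁ U : Set Y') = ⋃ s ∈ S, (generatedBy π J ⟨U, hU⟩ s : Set Y') := by
    ext y
    simp only [Set.mem_iUnion]
    constructor
    · intro hy
      obtain ⟨s, hs, h⟩ := exists_mem_generatedBy_of_span hπ.invertible hS.symm hy
      exact ⟨s, hs, h⟩
    · rintro ⟨s, hs, h⟩
      exact generatedBy_le h
  rw [h]
  refine S.isCompact_biUnion fun s hs ↦ ?_
  exact (hπ.exists_chart (hS ▸ Ideal.subset_span hs)).1.isCompact

end Chart

/-! ### Morphisms from spectra of local rings -/

section Local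

variable {Y : Scheme.{u}} {R : CommRingCat.{u}}

lemma exists_SpecMap_fromSpec [IsLocalRing R] (g : Spec R ⟶ Y) {V : Y.Opens}
    (hV : IsAffineOpen V) (h : g (IsLocalRing.closedPoint R) ∈ V) :
    ∃ l : Γ(Y, V) ⟶ R, g = Spec.map l ≫ hV.fromSpec := by
  have h' : ⊤ ≤ g ⁻¹ᵁ V := (preimage_eq_top_of_closedPoint_mem g h).ge
  refine ⟨g.appLE V ⊤ h' ≫ (ΓSpecIso R).hom, ?_⟩
  have h1 := hV.SpecMap_appLE_fromSpec g (isAffineOpen_top _) h'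
  rw [IsAffineOpen.fromSpec_top] at h1
  rw [Spec.map_comp, Category.assoc, h1, Scheme.isoSpec_Spec_inv, ← Spec.map_comp_assoc]
  simp

lemma SpecMap_fromSpec_injective {V : Y.Opens} (hV : IsAffineOpen V) {l m : Γ(Y, V) ⟶ R}
    (h : Spec.map l ≫ hV.fromSpec = Spec.map m ≫ hV.fromSpec) : l = m :=
  Spec.map_injective ((cancel_mono _).mp h)

lemma mem_basicOpen_iff_isUnit [IsLocalRing R] {g : Spec R ⟶ Y} {V : Y.Opens}
    (hV : IsAffineOpen V) {l : Γ(Y, V) ⟶ R} (hl : g = Spec.map l ≫ hV.fromSpec) (a : Γ(Y, V)) :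
    g (IsLocalRing.closedPoint R) ∈ Y.basicOpen a ↔ IsUnit (l.hom a) := by
  have h1 : g (IsLocalRing.closedPoint R) ∈ Y.basicOpen a ↔
      Spec.map l (IsLocalRing.closedPoint R) ∈ hV.fromSpec ⁻¹ᵁ Y.basicOpen a := by
    rw [hl]; rfl
  rw [h1, hV.fromSpec_preimage_basicOpen]
  change ¬ (l.hom a ∈ IsLocalRing.maximalIdeal R) ↔ _
  rw [IsLocalRing.mem_maximalIdeal, mem_nonunits_iff, not_not]

lemma closedPoint_mem [IsLocalRing R] {g : Spec R ⟶ Y} {V : Y.Opens}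
    (hV : IsAffineOpen V) {l : Γ(Y, V) ⟶ R} (hl : g = Spec.map l ≫ hV.fromSpec) :
    g (IsLocalRing.closedPoint R) ∈ V := by
  have := (mem_basicOpen_iff_isUnit hV hl 1).mpr (by simp)
  exact Y.basicOpen_le _ this

lemma factor_res {g : Spec R ⟶ Y} {V W : Y.Opens} (hV : IsAffineOpen V) (hW : IsAffineOpen W)
    (h : W ≤ V) {l : Γ(Y, V) ⟶ R} (hl : g = Spec.map l ≫ hV.fromSpec) {m : Γ(Y, W) ⟶ R}
    (hm : g = Spec.map m ≫ hW.fromSpec) (a : Γ(Y, V)) : m.hom (res h a) = l.hom a := by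
  have h1 := hV.map_fromSpec hW (homOfLE h).op
  have : Y.presheaf.map (homOfLE h).op ≫ m = l := by
    refine SpecMap_fromSpec_injective hV ?_
    rw [Spec.map_comp, Category.assoc, h1, ← hm, hl]
  rw [← this]; rfl

lemma factor_appLE {Z : Scheme.{u}} {g : Spec R ⟶ Y} (f : Y ⟶ Z) {V : Y.Opens} {W : Z.Opens}
    (hV : IsAffineOpen V) (hW : IsAffineOpen W)
    (h : V ≤ f ⁻¹ᵁ W) {l : Γ(Y, V) ⟶ R} (hl : g = Spec.map l ≫ hV.fromSpec) {m : Γ(Z, W) ⟶ R}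
    (hm : g ≫ f = Spec.map m ≫ hW.fromSpec) : f.appLE W V h ≫ l = m := by
  refine SpecMap_fromSpec_injective hW ?_
  rw [Spec.map_comp, Category.assoc, hW.SpecMap_appLE_fromSpec f hV h, ← hm, hl, Category.assoc]

end Local

/-! ### The valuative criterion on the charts of a blow-up -/

section Chart

variable {Y' Y : Scheme.{u}} {π : Y' ⟶ Y} {J : Y.IdealSheafData} 

/-- Take `j` with `x j` of largest valuation: all ratios `x s / x j` then have valuation at most 1.
-/
lemma ValuationRing.exists_max (R K : Type u) [CommRing R] [IsDomain R] [ValuationRing R]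
    [Field K] [Algebra R K] [IsFractionRing R K] {ι : Type*} (S : Finset ι) (x : ι → K)
    (h : ∃ s ∈ S, x s ≠ 0) :
    ∃ j ∈ S, x j ≠ 0 ∧ ∀ s ∈ S, ∀ z, z * x j = x s → z ∈ (algebraMap R K).range := by
  obtain ⟨s, hs, hs0⟩ := h
  obtain ⟨j, hj, hjm⟩ := S.exists_max_image (fun s ↦ ValuationRing.valuation R K (x s)) ⟨s, hs⟩
  have hj0 : x j ≠ 0 := by
    rintro h
    have := hjm s hs
    rw [h, map_zero, le_zero_iff, map_eq_zero] at this
    exact hs0 this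
  refine ⟨j, hj, hj0, fun s hs z hz ↦ ?_⟩
  have := hjm s hs
  rw [← hz, map_mul] at this
  have h1 : ValuationRing.valuation R K z ≤ 1 := by
    have h0 : 0 < ValuationRing.valuation R K (x j) := by
      rw [zero_lt_iff]; simpa using hj0
    exact (mul_le_iff_le_one_left h0).mp this
  exact (ValuationRing.mem_integer_iff R K z).mp h1

/-- At the given `K`-point the generators are `g * a s` for a common `g`. Choose `j` with `a j` of
maximal valuation. Its value is nonzero, so the point lies in the chart of `j`. The ring of this
chart is generated over the base by the quotients `s / j`, whose values `a s / a j` lie in `R`, so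
the ring map to `K` factors through `R`. -/
lemma IsBlowup.existence [IsLocallyNoetherian Y] (hπ : IsBlowup π J) :
    ValuativeCriterion.Existence π := by
  rintro ⟨R, K, i₁, i₂, ⟨w⟩⟩
  have : IsDomain (CommRingCat.of R) := ‹_›
  have : ValuationRing (CommRingCat.of R) := ‹_›
  have : IsLocalRing (CommRingCat.of R) := inferInstance
  let : Field (CommRingCat.of K) := ‹_›
  have hinj : Function.Injective (algebraMap R K) := FaithfulSMul.algebraMap_injective R K
  obtain ⟨U, hyU, -⟩ := exists_affine_le (W := (⊤ : Y.Opens))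
    (y := i₂ (IsLocalRing.closedPoint _)) trivial
  have : IsNoetherianRing Γ(Y, U.1) := IsLocallyNoetherian.component_noetherian U
  obtain ⟨S, hS⟩ := (IsNoetherian.noetherian (J.ideal U) : (J.ideal U).FG)
  obtain ⟨μ, hμ⟩ := exists_SpecMap_fromSpec i₂ (isAffineOpen_coe U) hyU
  have hμK : i₁ ≫ π = Spec.map (μ ≫ CommRingCat.ofHom (algebraMap R K)) ≫
      (isAffineOpen_coe U).fromSpec := by
    rw [w, hμ, Spec.map_comp, Category.assoc]
  have hyU' := closedPoint_mem _ hμK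
  obtain ⟨W, hWU, hyW, g, hg, hWg, a, ha, s₀, hs₀, hys₀⟩ :=
    exists_generator_isUnit hπ.invertible hS.symm hyU'
  obtain ⟨β, hβ⟩ := exists_SpecMap_fromSpec i₁ (isAffineOpen_coe W) hyW
  replace hys₀ := (mem_basicOpen_iff_isUnit _ hβ _).mp hys₀
  obtain ⟨j, hj, hj0, hjm⟩ := ValuationRing.exists_max R K S (fun s ↦ β.hom (a s))
    ⟨s₀, hs₀, hys₀.ne_zero⟩
  have hyj : i₁ (IsLocalRing.closedPoint _) ∈ Y'.basicOpen (a j) :=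
    (mem_basicOpen_iff_isUnit _ hβ _).mpr (isUnit_iff_ne_zero.mpr hj0)
  have hVj := basicOpen_le_generatedBy hWU hWg (ha j hj)
  have hfj : j ∈ J.ideal U := hS ▸ Ideal.subset_span hj
  have hV := (hπ.exists_chart hfj).1
  obtain ⟨γ, hγ⟩ := exists_SpecMap_fromSpec i₁ hV (hVj hyj)
  obtain ⟨D, hyD, hDj⟩ := exists_affine_le hyj
  have hDW : D.1 ≤ W.1 := hDj.trans (Y'.basicOpen_le _)
  obtain ⟨δ, hδ⟩ := exists_SpecMap_fromSpec i₁ (isAffineOpen_coe D) hyD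
  have hγμ := factor_appLE π hV (isAffineOpen_coe U) generatedBy_le hγ hμK
  have htop := hπ.subring_eq_top hfj hS.symm ((algebraMap R K).range.comap γ.hom)
    (fun x ↦ ⟨μ.hom x, congr($(hγμ).hom x).symm⟩) (by
      intro s hs q hq
      refine hjm s hs _ ?_
      rw [← factor_res hV (isAffineOpen_coe D) (hDj.trans hVj) hγ hδ,
        ← factor_res (isAffineOpen_coe W) (isAffineOpen_coe D) hDW hβ hδ,
        ← factor_res (isAffineOpen_coe W) (isAffineOpen_coe D) hDW hβ hδ, ← map_mul]
      congr 1
      have hgD : res hDW g ∈ nonZeroDivisors _ :=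
        isRegularSection_of_ideal_eq_span hπ.invertible hWg D.1 hDW
      refine (mul_cancel_left_mem_nonZeroDivisors hgD).mp ?_
      have h1 := congr_arg (res (hDj.trans hVj)) hq
      rw [map_mul, appLE_res, appLE_res, ← appLE_res π hWU hDW, ← appLE_res π hWU hDW,
        ha s hs, ha j hj, map_mul, map_mul] at h1
      rw [← h1]; ring)
  have hlift : ∀ x, ∃ r : R, algebraMap R K r = γ.hom x := fun x ↦ by
    have hx : x ∈ (⊤ : Subring _) := trivial
    rw [← htop] at hx
    exact hx
  choose l hl using hlift
  let L : Γ(Y', generatedBy π J U j) ⟶ CommRingCat.of R := CommRingCat.ofHom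
    { toFun := l
      map_one' := hinj (by rw [hl, map_one, map_one])
      map_mul' := fun x y ↦ hinj (by rw [hl, map_mul, map_mul, hl, hl])
      map_zero' := hinj (by rw [hl, map_zero, map_zero])
      map_add' := fun x y ↦ hinj (by rw [hl, map_add, map_add, hl, hl]) }
  have hL : L ≫ CommRingCat.ofHom (algebraMap R K) = γ := by
    ext x; exact hl x
  refine ⟨⟨⟨Spec.map L ≫ hV.fromSpec, ?_, ?_⟩⟩⟩
  · dsimp only
    rw [← Spec.map_comp_assoc, hL]
    exact hγ.symm
  · dsimp only
    rw [Category.assoc, ← hV.SpecMap_appLE_fromSpec π (U := U.1) (hU := isAffineOpen_coe U) generatedBy_le,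
      ← Spec.map_comp_assoc]
    refine Eq.trans ?_ hμ.symm
    congr 2
    ext x
    refine hinj ?_
    have := congr($(hγμ).hom x)
    exact (hl _).trans this

/-- The closed point may go to the chart of `s` under `l₁` and to that of `j` under `l₂`. The ratio
`a = j / s` takes a value in `R` along `l₁` and its inverse `b = s / j` takes one along `l₂`; their
product is 1 in `K`, hence in `R`. So `l₁` also factors through the chart of `j`, where the two ring
maps agree because `R` embeds in `K`. -/
lemma IsBlowup.eq_of_comp_eq (hπ : IsBlowup π J) {R K : Type u} [CommRing R] [IsDomain R]
    [ValuationRing R] [Field K] [Algebra R K] [IsFractionRing R K]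
    {l₁ l₂ : Spec (.of R) ⟶ Y'} (h : l₁ ≫ π = l₂ ≫ π)
    (hK : Spec.map (CommRingCat.ofHom (algebraMap R K)) ≫ l₁ =
      Spec.map (CommRingCat.ofHom (algebraMap R K)) ≫ l₂) : l₁ = l₂ := by
  have : IsDomain (CommRingCat.of R) := ‹_›
  have : ValuationRing (CommRingCat.of R) := ‹_›
  have : IsLocalRing (CommRingCat.of R) := inferInstance
  let : Field (CommRingCat.of K) := ‹_›
  have hinj : Function.Injective (algebraMap R K) := FaithfulSMul.algebraMap_injective R K
  obtain ⟨U, hyU, -⟩ := exists_affine_le (W := (⊤ : Y.Opens))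
    (y := (l₁ ≫ π) (IsLocalRing.closedPoint _)) trivial
  obtain ⟨s, hs, hys⟩ := exists_mem_generatedBy_of_span hπ.invertible (U := U)
    (Ideal.span_eq _).symm (y := l₁ (IsLocalRing.closedPoint _)) hyU
  obtain ⟨j, hj, hyj⟩ := exists_mem_generatedBy_of_span hπ.invertible (U := U)
    (Ideal.span_eq _).symm (y := l₂ (IsLocalRing.closedPoint _)) (congr($h (IsLocalRing.closedPoint _)) ▸ hyU : (l₂ ≫ π) _ ∈ U.1)
  have hVs := (hπ.exists_chart hs).1
  have hVj := (hπ.exists_chart hj).1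
  obtain ⟨m₁, hm₁⟩ := exists_SpecMap_fromSpec l₁ hVs hys
  obtain ⟨m₂, hm₂⟩ := exists_SpecMap_fromSpec l₂ hVj hyj
  have hi₁ : (Spec.map (CommRingCat.ofHom (algebraMap R K)) ≫ l₁) = Spec.map (m₁ ≫ CommRingCat.ofHom (algebraMap R K)) ≫ hVs.fromSpec := by
    rw [Spec.map_comp, Category.assoc, ← hm₁]
  have hi₂ : (Spec.map (CommRingCat.ofHom (algebraMap R K)) ≫ l₁) = Spec.map (m₂ ≫ CommRingCat.ofHom (algebraMap R K)) ≫ hVj.fromSpec := by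
    rw [Spec.map_comp, Category.assoc, ← hm₂, hK]
  obtain ⟨D, hyD, hD⟩ := exists_affine_le (W := generatedBy π J U s ⊓ generatedBy π J U j)
    ⟨closedPoint_mem hVs hi₁, closedPoint_mem hVj hi₂⟩
  have hDs := hD.trans inf_le_left
  have hDj := hD.trans inf_le_right
  obtain ⟨δ, hδ⟩ := exists_SpecMap_fromSpec (Spec.map (CommRingCat.ofHom (algebraMap R K)) ≫ l₁) (isAffineOpen_coe D) hyD
  obtain ⟨a, ha⟩ := dvd_generatedBy (f := s) hπ.invertible hj
  obtain ⟨b, hb⟩ := dvd_generatedBy (f := j) hπ.invertible hs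
  have hab : res hDs a * res hDj b = 1 := by
    have hreg := isRegularSection_generatedBy (f := s) hπ.invertible _ hDs
    rw [appLE_res] at hreg
    refine (mul_cancel_left_mem_nonZeroDivisors hreg).mp ?_
    have h3 := congr_arg (res hDs) ha
    have h4 := congr_arg (res hDj) hb
    rw [map_mul, appLE_res, appLE_res] at h3 h4
    rw [← mul_assoc, ← h3, ← h4, mul_one]
  have hunit : IsUnit (m₁.hom a) := by
    refine IsUnit.of_mul_eq_one (m₂.hom b) (hinj ?_)
    have h3 := factor_res hVs (isAffineOpen_coe D) hDs hi₁ hδ a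
    have h4 := factor_res hVj (isAffineOpen_coe D) hDj hi₂ hδ b
    have h5 := congr_arg δ.hom hab
    rw [map_mul, h3, h4] at h5
    rw [map_mul, map_one]
    exact h5.trans (map_one _)
  have hle : Y'.basicOpen a ≤ generatedBy π J U j := by
    have h6 := ideal_eq_span_of_le_generatedBy (W := ⟨_, hVs⟩) hπ.invertible hs le_rfl
    exact basicOpen_le_generatedBy (W := ⟨_, hVs⟩) generatedBy_le h6 ha
  obtain ⟨m, hm⟩ := exists_SpecMap_fromSpec l₁ hVj
    (hle ((mem_basicOpen_iff_isUnit hVs hm₁ a).mpr hunit))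
  have h7 : m ≫ CommRingCat.ofHom (algebraMap R K) = m₂ ≫ CommRingCat.ofHom (algebraMap R K) := by
    refine SpecMap_fromSpec_injective hVj ?_
    rw [← hi₂, Spec.map_comp, Category.assoc, ← hm]
  have h8 : m = m₂ := by
    ext x
    exact hinj congr($(h7).hom x)
  rw [hm, hm₂, h8]

lemma IsBlowup.uniqueness (hπ : IsBlowup π J) : ValuativeCriterion.Uniqueness π := by
  rintro ⟨R, K, i₁, i₂, ⟨w⟩⟩
  refine ⟨?_⟩
  rintro ⟨l₁, h₁, h₁'⟩ ⟨l₂, h₂, h₂'⟩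
  ext : 1
  exact hπ.eq_of_comp_eq (K := K) (h₁'.trans h₂'.symm) (h₁.trans h₂.symm)

/-- Blow-ups of locally Noetherian schemes are proper. -/
lemma IsBlowup.isProper [IsLocallyNoetherian Y] (hπ : IsBlowup π J) : IsProper π := by
  have := hπ.quasiCompact
  have := hπ.locallyOfFiniteType
  have : IsLocallyNoetherian Y' := LocallyOfFiniteType.isLocallyNoetherian π
  have : QuasiSeparated π := inferInstance
  exact IsProper.of_valuativeCriterion π (ValuativeCriterion.iff.mpr ⟨hπ.existence, hπ.uniqueness⟩)

end Chart

/-! ### The central fibre and proper transforms -/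

section Centers

lemma map_mem_map_iff_of_away {A B : Type*} [CommRing A] [CommRing B] (φ : A →+* B) (t : A)
    (h : @IsLocalization.Away A _ t B _ φ.toAlgebra) (I : Ideal A) (x : A) :
    φ x ∈ I.map φ ↔ ∃ n : ℕ, t ^ n * x ∈ I := by
  algebraize [φ]
  refine (IsLocalization.algebraMap_mem_map_algebraMap_iff (Submonoid.powers t) B I x).trans ?_
  constructor
  · rintro ⟨_, ⟨n, rfl⟩, h⟩
    exact ⟨n, h⟩
  · rintro ⟨n, h⟩
    exact ⟨_, ⟨n, rfl⟩, h⟩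

variable {X Y : Scheme.{u}} (π : Y ⟶ Line X)

lemma centralFibre_ideal (W : Y.affineOpens) :
    (centralFibre π).ideal W = Ideal.span {res (le_top : W.1 ≤ ⊤) (coordinate π)} := by
  rw [centralFibre, IdealSheafData.ofIdealTop_ideal, Ideal.map_span, Set.image_singleton]

lemma centralFibre_comp {Y' : Scheme.{u}} (f : Y' ⟶ Y) :
    centralFibre (f ≫ π) = (centralFibre π).comap f := by
  refine IdealSheafData.ext_of_locally fun y ↦ ?_
  obtain ⟨U, hyU, -⟩ := exists_affine_le (W := (⊤ : Y.Opens)) (y := f y) trivial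
  obtain ⟨W, hyW, hWU⟩ := exists_affine_le (W := f ⁻¹ᵁ U.1) hyU
  refine ⟨W, hyW, ?_⟩
  rw [ideal_comap _ f U W hWU, centralFibre_ideal, centralFibre_ideal, Ideal.map_span,
    Set.image_singleton, res_appLE]
  congr 2

/-- Taking the closure from t ≠ 0 means contracting an ideal from the localisation at t, which is
saturating it with respect to t. -/
lemma mem_properTransform_ideal (K : X.IdealSheafData) (W : Y.affineOpens) (x : Γ(Y, W.1)) :
    x ∈ (properTransform π K).ideal W ↔
      ∃ n : ℕ, res (le_top : W.1 ≤ ⊤) (coordinate π) ^ n * x ∈ (K.comap (toBase π)).ideal W := by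
  have hW : IsAffineOpen W.1 := W.2
  set t := res (le_top : W.1 ≤ ⊤) (coordinate π) with ht
  have heq : (generic π).ι ''ᵁ (generic π).ι ⁻¹ᵁ W.1 = Y.basicOpen t := by
    rw [Scheme.Hom.image_preimage_eq_opensRange_inf, Scheme.Opens.opensRange_ι, generic, ht]
    exact (inf_comm _ _).trans (Y.basicOpen_res _ _).symm
  have haff : IsAffineOpen ((generic π).ι ⁻¹ᵁ W.1) := by
    rw [← Scheme.Hom.isAffineOpen_iff_of_isOpenImmersion (generic π).ι, heq]
    exact hW.basicOpen t
  have hle : (generic π).ι ''ᵁ (generic π).ι ⁻¹ᵁ W.1 ≤ W.1 := heq.trans_le (Y.basicOpen_le _)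
  have hloc := hW.isLocalization_of_eq_basicOpen t (homOfLE hle) heq
  have : IsAffineHom (generic π).ι := by unfold generic; infer_instance
  rw [properTransform, IdealSheafData.ideal_map _ _ _ haff,
    ideal_comap (K.comap (toBase π)) (generic π).ι W ⟨_, haff⟩ le_rfl, Ideal.mem_comap]
  have h1 : (generic π).ι.appLE W.1 ((generic π).ι ⁻¹ᵁ W.1) le_rfl = (generic π).ι.app W.1 := by
    rw [Scheme.Hom.app_eq_appLE]
  rw [h1]
  refine map_mem_map_iff_of_away _ t ?_ _ _
  rw [Scheme.Opens.ι_app]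
  exact hloc

end Centers

/-! ### The product with the affine line -/

section Line

variable (X : Scheme.{u})

/-- The projection is a base change of the affine line over the integers, whose coordinate ring is a
free module. -/
instance flat_line : Flat (Line X ↘ X) := by
  have h : ∀ {P Q R : Scheme.{u}} (f : P ⟶ R) (g : Q ⟶ R) (_ : Flat g),
      Flat (Limits.pullback.fst f g) := fun f g _ ↦ inferInstance
  refine h _ _ ?_
  have := Limits.isIso_of_isTerminal specULiftZIsTerminal.{u} Limits.terminalIsTerminal (Limits.terminal.from _)
  rw [← Limits.terminal.comp_from (Spec.map (CommRingCat.ofHom MvPolynomial.C))]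
  have hf : Flat (Spec.map (CommRingCat.ofHom
      (MvPolynomial.C : ULift.{u} ℤ →+* MvPolynomial PUnit.{u + 1} (ULift.{u} ℤ)))) := by
    rw [Flat.SpecMap_iff, CommRingCat.hom_ofHom, ← MvPolynomial.algebraMap_eq,
      RingHom.flat_algebraMap_iff]
    have := Module.Free.of_basis (MvPolynomial.basisMonomials PUnit.{u + 1} (ULift.{u} ℤ))
    exact Module.Flat.of_free
  infer_instance

variable {X}

/-- The preimage of `U` is the affine line over the affine scheme `U`, hence has the polynomial ring
as its functions. The work is to match constants and coordinate under this identification. -/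
lemma line_bijective (U : X.affineOpens) :
    Function.Bijective (Polynomial.eval₂RingHom ((Line X ↘ X).app U.1).hom
      (res (le_top : (Line X ↘ X) ⁻¹ᵁ U.1 ≤ ⊤) (coordinate (𝟙 (Line X))))) := by
  have : IsAffine U.1 := U.2
  let f : Line U.1 ⟶ Line X := AffineSpace.map PUnit U.1.ι
  have : IsOpenImmersion f :=
    MorphismProperty.of_isPullback (P := @IsOpenImmersion) (AffineSpace.isPullback_map U.1.ι).flip inferInstance
  have hrange : f.opensRange = (Line X ↘ X) ⁻¹ᵁ U.1 := by
    have h := (AffineSpace.isPullback_map (n := PUnit) U.1.ι).isoPullback_hom_fst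
    have h2 : f = (AffineSpace.isPullback_map (n := PUnit) U.1.ι).isoPullback.hom ≫
      Limits.pullback.fst (Line X ↘ X) U.1.ι := h.symm
    ext1
    rw [Scheme.Hom.coe_opensRange, h2, ← Scheme.Hom.coe_opensRange, Scheme.Hom.opensRange_comp_of_isIso,
      Scheme.Hom.opensRange_pullbackFst, Scheme.Opens.opensRange_ι]
  have htop : f ⁻¹ᵁ (Line X ↘ X) ⁻¹ᵁ U.1 = ⊤ := by
    rw [← hrange, Scheme.Hom.preimage_opensRange]
  have hiso : IsIso (f.appLE ((Line X ↘ X) ⁻¹ᵁ U.1) ⊤ htop.ge) := by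
    have := f.isIso_app _ hrange.ge
    rw [Scheme.Hom.appLE]
    have : IsIso (homOfLE htop.ge).op := by
      have : homOfLE htop.ge = eqToHom htop.symm := rfl
      rw [this]; infer_instance
    infer_instance
  have hbij := ConcreteCategory.bijective_of_isIso (f.appLE ((Line X ↘ X) ⁻¹ᵁ U.1) ⊤ htop.ge)
  have hbij2 : Function.Bijective (MvPolynomial.eval₂Hom (Line U.1 ↘ (U.1 : Scheme)).appTop.hom
      (AffineSpace.coord (n := PUnit.{u+1}) (U.1 : Scheme))) := by
    have h := AffineSpace.isoOfIsAffine_hom_appTop (n := PUnit.{u+1}) (S := (U.1 : Scheme))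
    rw [← Iso.inv_comp_eq] at h
    have h3 : IsIso (AffineSpace.isoOfIsAffine PUnit.{u+1} (U.1 : Scheme)).hom.appTop := by
      have h0 : IsIso (AffineSpace.isoOfIsAffine PUnit.{u+1} (U.1 : Scheme)).hom := Iso.isIso_hom _
      have h4 : IsIso ((AffineSpace.isoOfIsAffine PUnit.{u+1} (U.1 : Scheme)).hom.app ⊤) :=
        inferInstanceAs (IsIso (Scheme.Hom.app _ _))
      exact h4
    have h2 := IsIso.comp_isIso (f := (ΓSpecIso (.of (MvPolynomial PUnit.{u+1} Γ(U.1, ⊤)))).inv)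
      (h := (AffineSpace.isoOfIsAffine PUnit.{u+1} (U.1 : Scheme)).hom.appTop)
    rw [h] at h2
    exact ConcreteCategory.bijective_of_isIso (CommRingCat.ofHom (MvPolynomial.eval₂Hom (Line U.1 ↘ (U.1 : Scheme)).appTop.hom
      (AffineSpace.coord (n := PUnit.{u+1}) (U.1 : Scheme))))
  rw [← Function.Bijective.of_comp_iff' hbij]
  let e : Polynomial Γ(X, U.1) ≃+* MvPolynomial PUnit.{u+1} Γ(U.1, ⊤) :=
    (MvPolynomial.uniqueAlgEquiv _ PUnit.{u+1}).symm.toRingEquiv.trans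
      (MvPolynomial.mapEquiv _ U.1.topIso.symm.commRingCatIsoToRingEquiv)
  have key : (f.appLE ((Line X ↘ X) ⁻¹ᵁ U.1) ⊤ htop.ge).hom.comp
      (Polynomial.eval₂RingHom ((Line X ↘ X).app U.1).hom
      (res (le_top : (Line X ↘ X) ⁻¹ᵁ U.1 ≤ ⊤) (coordinate (𝟙 (Line X))))) =
      (MvPolynomial.eval₂Hom (Line U.1 ↘ (U.1 : Scheme)).appTop.hom
      (AffineSpace.coord (n := PUnit.{u+1}) (U.1 : Scheme))).comp e.toRingHom := by
    refine Polynomial.ringHom_ext (fun a ↦ ?_) ?_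
    · have h1 : (Line X ↘ X).app U.1 ≫ f.appLE ((Line X ↘ X) ⁻¹ᵁ U.1) ⊤ htop.ge =
          U.1.topIso.inv ≫ (Line U.1 ↘ (U.1 : Scheme)).appTop := by
        have h2 : f ≫ (Line X ↘ X) = (Line U.1 ↘ (U.1 : Scheme)) ≫ U.1.ι := AffineSpace.map_over _
        rw [Scheme.Hom.app_eq_appLE, Scheme.Hom.appLE_comp_appLE]
        simp_rw [h2]
        rw [← Scheme.Hom.appLE_comp_appLE _ _ _ ⊤ ⊤ (by simp) le_top, Scheme.Opens.topIso_inv]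
        have h5 : U.1.ι.appLE U.1 ⊤ (by simp) = X.presheaf.map (eqToHom U.1.ι_image_top).op := by
          rw [Scheme.Opens.ι_appLE]; rfl
        rw [h5, Scheme.Hom.appTop, Scheme.Hom.app_eq_appLE]
        rfl
      have h3 : (f.appLE ((Line X ↘ X) ⁻¹ᵁ U.1) ⊤ htop.ge).hom (((Line X ↘ X).app U.1).hom a) =
          (Line U.1 ↘ (U.1 : Scheme)).appTop.hom (U.1.topIso.inv.hom a) := congr($(h1).hom a)
      simpa [e] using h3
    · simp only [RingHom.comp_apply]
      rw [Polynomial.coe_eval₂RingHom, Polynomial.eval₂_X, res_appLE]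
      have h1 : f.appTop (AffineSpace.coord X PUnit.unit) = AffineSpace.coord (U.1 : Scheme) PUnit.unit :=
        AffineSpace.map_appTop_coord _ _
      rw [Scheme.Hom.appTop, Scheme.Hom.app_eq_appLE] at h1
      simpa [e, coordinate] using h1
  have := hbij2.comp e.bijective
  convert this using 1
  exact congr_arg DFunLike.coe key

end Line

/-! ### Algebra of the flag ideals and of their products -/

section Algebra

/-- The sum `i₀ + t i₁ + ⋯ + t^(n-1) i_(n-1)`, in any commutative semiring. -/
def flagSum {S : Type*} [CommSemiring S] (t : S) (i : ℕ → S) (n : ℕ) : S :=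
  ∑ j ∈ Finset.range n, t ^ j * i j

lemma map_flagSum {S S' : Type*} [CommSemiring S] [CommSemiring S'] (f : S →+* S') (t : S)
    (i : ℕ → S) (n : ℕ) : f (flagSum t i n) = flagSum (f t) (f ∘ i) n := by
  simp [flagSum]

lemma flagSum_succ {S : Type*} [CommSemiring S] (t : S) (i : ℕ → S) (n : ℕ) :
    flagSum t i (n + 1) = flagSum t i n + t ^ n * i n := Finset.sum_range_succ _ _

/-- The ideal `i₀ + t i₁ + ⋯ + t^(n-1) i_(n-1) + t^n`. -/
def flagPow {S : Type*} [CommSemiring S] (t : S) (i : ℕ → S) (n : ℕ) : S :=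
  flagSum t i n + t ^ n

lemma map_flagPow {S S' : Type*} [CommSemiring S] [CommSemiring S'] (f : S →+* S') (t : S)
    (i : ℕ → S) (n : ℕ) : f (flagPow t i n) = flagPow (f t) (f ∘ i) n := by
  simp [flagPow, map_flagSum]

/-- The product of the first `k` of these ideals. -/
def flagProd {S : Type*} [CommSemiring S] (t : S) (i : ℕ → S) (k : ℕ) : S :=
  ∏ m ∈ Finset.range k, flagPow t i (m + 1)

lemma map_flagProd {S S' : Type*} [CommSemiring S] [CommSemiring S'] (f : S →+* S') (t : S)
    (i : ℕ → S) (n : ℕ) : f (flagProd t i n) = flagProd (f t) (f ∘ i) n := by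
  simp [flagProd, map_flagPow]

lemma flagProd_succ {S : Type*} [CommSemiring S] (t : S) (i : ℕ → S) (n : ℕ) :
    flagProd t i (n + 1) = flagProd t i n * flagPow t i (n + 1) := Finset.prod_range_succ _ _

variable {C A : Type*} [CommRing C] [CommRing A] {φ : C →+* A} {t : C} {i : ℕ → Ideal C} {k : ℕ}

/-- The exponent `1 + 2 + ⋯ + k`. -/
def tri (k : ℕ) : ℕ := ∑ m ∈ Finset.range k, (m + 1)

lemma tri_succ (k : ℕ) : tri (k + 1) = tri k + (k + 1) := Finset.sum_range_succ _ _

lemma pow_mem_flagPow (n : ℕ) : t ^ n ∈ flagPow (Ideal.span {t}) i n := by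
  rw [flagPow, Submodule.add_eq_sup]
  exact Ideal.mem_sup_right (Ideal.pow_mem_pow (Ideal.mem_span_singleton_self t) n)

lemma pow_tri_mem_flagProd (n : ℕ) : t ^ tri n ∈ flagProd (Ideal.span {t}) i n := by
  induction n with
  | zero => simp [flagProd]
  | succ n ih =>
    rw [flagProd_succ, tri_succ, pow_add]
    exact Ideal.mul_mem_mul ih (pow_mem_flagPow _)

lemma flagSum_le {J : Ideal C} {n : ℕ} {T : Ideal C} :
    flagSum T i n ≤ J ↔ ∀ j < n, T ^ j * i j ≤ J := by
  simp [flagSum, Ideal.sum_eq_sup, Finset.sup_le_iff]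

lemma flagSum_le_flagPow (n : ℕ) (T : Ideal C) : flagSum T i n ≤ flagPow T i n := by
  rw [flagPow, Submodule.add_eq_sup]; exact le_sup_left

/-- The product contains a power of t times the last factor. Cancelling this power leaves
divisibility of the last factor by `t ^ k`. -/
lemma map_flagPow_le (ht : φ t ∈ nonZeroDivisors A)
    (hK : (flagProd (Ideal.span {t}) i k).map φ ≤ Ideal.span {φ t ^ tri k}) :
    (flagPow (Ideal.span {t}) i k).map φ ≤ Ideal.span {φ t ^ k} := by
  cases k with
  | zero => simp
  | succ k =>
    rw [Ideal.map_le_iff_le_comap]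
    intro x hx
    have h1 := hK (Ideal.mem_map_of_mem φ (flagProd_succ (Ideal.span {t}) i k ▸
      Ideal.mul_mem_mul (pow_tri_mem_flagProd (i := i) (t := t) k) hx))
    rw [Ideal.mem_span_singleton, map_mul, tri_succ, map_pow, pow_add] at h1
    rw [Ideal.mem_comap, Ideal.mem_span_singleton]
    obtain ⟨c, hc⟩ := h1
    rw [mul_assoc, mul_cancel_left_mem_nonZeroDivisors (pow_mem ht _)] at hc
    exact ⟨c, hc⟩

/-- Since the ideals increase, multiplying the j-th term by `t ^ (k - n)` puts it in the term of
index `k - n + j`. -/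
lemma pow_mul_flagSum_le (hi : MonotoneOn i (Set.Iic k)) {n : ℕ} (hn : n ≤ k) {x : C}
    (hx : x ∈ flagSum (Ideal.span {t}) i n) :
    t ^ (k - n) * x ∈ flagSum (Ideal.span {t}) i k := by
  have h : flagSum (Ideal.span {t}) i n ≤
      Submodule.comap (LinearMap.mulLeft C (t ^ (k - n))) (flagSum (Ideal.span {t}) i k) := by
    rw [flagSum_le]
    intro j hj
    rw [Ideal.span_singleton_pow]
    intro y hy
    obtain ⟨z, hz, rfl⟩ := Ideal.mem_span_singleton_mul.mp hy
    refine (flagSum_le.mp le_rfl (k - n + j) (by omega) :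
      _ ≤ flagSum (Ideal.span {t}) i k) ?_
    rw [Ideal.span_singleton_pow]
    refine Ideal.mem_span_singleton_mul.mpr ⟨z, hi (Set.mem_Iic.mpr (by omega))
      (Set.mem_Iic.mpr (by omega)) (by omega) hz, ?_⟩
    rw [LinearMap.mulLeft_apply, pow_add, mul_assoc]
  exact h hx

/-- The local computation behind the key lemma. -/
theorem map_flagPow_succ (hi : MonotoneOn i (Set.Iic k)) (ht : φ t ∈ nonZeroDivisors A)
    (hK : (flagProd (Ideal.span {t}) i k).map φ ≤ Ideal.span {φ t ^ tri k})
    (h1 : ∀ T : Subring A, (∀ c, φ c ∈ T) → (∀ x ∈ flagProd (Ideal.span {t}) i k, ∀ q,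
      φ t ^ tri k * q = φ x → q ∈ T) → T = ⊤)
    (h2 : ∀ c, φ c = 0 → ∃ n : ℕ, t ^ n * c = 0)
    (h3 : ∀ c, t * c ∈ i k → c ∈ i k) {s : Ideal A}
    (hs : ∀ x, x ∈ s ↔ ∃ n : ℕ, φ t ^ n * x ∈ (i k).map φ) :
    (flagPow (Ideal.span {t}) i (k + 1)).map φ =
      (flagPow (Ideal.span {t}) i k).map φ * (s ⊔ Ideal.span {φ t}) := by
  have hJ := map_flagPow_le ht hK
  have hJk : (flagPow (Ideal.span {t}) i k).map φ = Ideal.span {φ t ^ k} := by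
    refine le_antisymm hJ ?_
    rw [Ideal.span_singleton_le_iff_mem, ← map_pow]
    exact Ideal.mem_map_of_mem _ (pow_mem_flagPow k)
  have h3' : ∀ (n : ℕ) (c : C), t ^ n * c ∈ i k → c ∈ i k := by
    intro n
    induction n with
    | zero => simp
    | succ n ih => exact fun c hc ↦ ih c (h3 _ (by rwa [← mul_assoc, ← pow_succ']))
  -- elements whose multiples lie in the truncated sum
  let b : Ideal A :=
    Submodule.comap (LinearMap.mulLeft A (φ t ^ k)) ((flagSum (Ideal.span {t}) i k).map φ)
  have hb : ∀ {a}, a ∈ b ↔ φ t ^ k * a ∈ (flagSum (Ideal.span {t}) i k).map φ := Iff.rfl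
  have hbS : ∀ x ∈ (flagSum (Ideal.span {t}) i k).map φ, ∃ q ∈ b, x = φ t ^ k * q := by
    intro x hx
    obtain ⟨q, rfl⟩ := Ideal.mem_span_singleton.mp
      (hJ (Ideal.map_mono (flagSum_le_flagPow k _) hx))
    exact ⟨q, hx, rfl⟩
  have hbs : b ≤ s := by
    intro a ha
    refine (hs a).mpr ⟨k, ?_⟩
    refine Ideal.map_mono (flagSum_le.mpr fun j hj ↦ ?_) (hb.mp ha)
    exact Ideal.mul_le_right.trans (hi (Set.mem_Iic.mpr hj.le) (Set.mem_Iic.mpr le_rfl) hj.le)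
  -- This is the subring φ(C) + b. It will turn out to be all of `A`: modulo `b`, every function on
  -- the chart comes from `C`.
  let S : Subring A := ((Ideal.Quotient.mk b).comp φ).range.comap (Ideal.Quotient.mk b)
  have hS : ∀ {a}, a ∈ S ↔ ∃ c, a - φ c ∈ b := by
    intro a
    refine exists_congr fun c ↦ ?_
    rw [← Ideal.Quotient.eq, eq_comm]; rfl
  have hφS : ∀ c, φ c ∈ S := fun c ↦ hS.mpr ⟨c, by simp⟩
  -- In the quotient by `t ^ n`, the part from the truncated sum falls in `b` after the index shift
  -- to `k`, and the multiple of `t ^ n` contributes an element of φ(C).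
  have hPow : ∀ n ≤ k, ∀ x ∈ flagPow (Ideal.span {t}) i n, ∃ q ∈ S, φ t ^ n * q = φ x := by
    intro n hn x hx
    rw [flagPow, Submodule.add_eq_sup, Ideal.span_singleton_pow] at hx
    obtain ⟨y, hy, z, hz, rfl⟩ := Submodule.mem_sup.mp hx
    obtain ⟨c, rfl⟩ := Ideal.mem_span_singleton.mp hz
    obtain ⟨q, hq, hqy⟩ := hbS _ (Ideal.mem_map_of_mem φ (pow_mul_flagSum_le hi hn hy))
    refine ⟨q + φ c, add_mem (hS.mpr ⟨0, by simpa using hq⟩) (hφS c), ?_⟩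
    have h4 : φ t ^ n * q = φ y := by
      refine (mul_cancel_left_mem_nonZeroDivisors (pow_mem ht (k - n))).mp ?_
      rw [← mul_assoc, ← pow_add, Nat.sub_add_cancel hn, ← hqy, map_mul, map_pow]
    rw [mul_add, h4, map_add, map_mul, map_pow]
  have hProd : ∀ n ≤ k, ∀ x ∈ flagProd (Ideal.span {t}) i n, ∃ q ∈ S,
      φ t ^ tri n * q = φ x := by
    intro n
    induction n with
    | zero => exact fun _ x _ ↦ ⟨φ x, hφS x, by simp [tri]⟩
    | succ n ih =>
      intro hn x hx
      rw [flagProd_succ] at hx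
      refine Submodule.mul_induction_on hx ?_ ?_
      · intro y hy z hz
        obtain ⟨q, hq, hqy⟩ := ih (by omega) y hy
        obtain ⟨r, hr, hrz⟩ := hPow _ hn z hz
        exact ⟨q * r, mul_mem hq hr, by rw [tri_succ, pow_add, map_mul, ← hqy, ← hrz]; ring⟩
      · rintro y z ⟨q, hq, hqy⟩ ⟨r, hr, hrz⟩
        exact ⟨q + r, add_mem hq hr, by rw [mul_add, hqy, hrz, map_add]⟩
  -- The chart ring is generated by the quotients of the product ideal by `t ^ tri k`, and these
  -- have just been placed in `S`.
  have hStop : S = ⊤ := h1 S hφS fun x hx q hq ↦ by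
    obtain ⟨r, hr, hrx⟩ := hProd k le_rfl x hx
    rwa [(mul_cancel_left_mem_nonZeroDivisors (pow_mem ht _)).mp (hq.trans hrx.symm)]
  -- These are the elements that some power of t brings into the image of `C`. The same generation
  -- principle shows that they exhaust `A`.
  let D : Subring A :=
    { carrier := {z | ∃ (m : ℕ) (c : C), φ t ^ m * z = φ c}
      mul_mem' := by
        rintro x y ⟨m, c, hc⟩ ⟨n, d, hd⟩
        exact ⟨m + n, c * d, by rw [map_mul, ← hc, ← hd]; ring⟩
      one_mem' := ⟨0, 1, by simp⟩
      add_mem' := by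
        rintro x y ⟨m, c, hc⟩ ⟨n, d, hd⟩
        exact ⟨m + n, t ^ n * c + t ^ m * d, by
          simp only [map_add, map_mul, map_pow, ← hc, ← hd]; ring⟩
      zero_mem' := ⟨0, 0, by simp⟩
      neg_mem' := by
        rintro x ⟨m, c, hc⟩
        exact ⟨m, -c, by rw [map_neg, ← hc]; ring⟩ }
  have hD : ∀ z, ∃ (m : ℕ) (c : C), φ t ^ m * z = φ c := by
    have : D = ⊤ := h1 D (fun c ↦ ⟨0, c, by simp⟩) fun x _ q hq ↦ ⟨_, x, hq⟩
    intro z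
    have hz : z ∈ (⊤ : Subring A) := trivial
    rwa [← this] at hz
  have hmap : ∀ w ∈ (i k).map φ, ∃ (m : ℕ), ∃ c ∈ i k, φ t ^ m * w = φ c := by
    intro w hw
    refine Submodule.span_induction ?_ ?_ ?_ ?_ hw
    · rintro _ ⟨c, hc, rfl⟩
      exact ⟨0, c, hc, by simp⟩
    · exact ⟨0, 0, zero_mem _, by simp⟩
    · rintro x y - - ⟨m, c, hci, hc⟩ ⟨n, d, hdi, hd⟩
      exact ⟨m + n, t ^ n * c + t ^ m * d, add_mem (Ideal.mul_mem_left _ _ hci)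
        (Ideal.mul_mem_left _ _ hdi), by
          simp only [map_add, map_mul, map_pow, ← hc, ← hd]; ring⟩
    · rintro a x - ⟨m, c, hci, hc⟩
      obtain ⟨n, d, hd⟩ := hD a
      exact ⟨m + n, d * c, Ideal.mul_mem_left _ _ hci, by
        rw [map_mul, ← hc, ← hd, smul_eq_mul]; ring⟩
  rw [hJk]
  have hexp : (flagPow (Ideal.span {t}) i (k + 1)).map φ =
      (flagSum (Ideal.span {t}) i k).map φ ⊔ Ideal.span {φ t ^ k} * (i k).map φ ⊔
        Ideal.span {φ t ^ (k + 1)} := by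
    rw [flagPow, flagSum_succ, Submodule.add_eq_sup, Submodule.add_eq_sup, Ideal.map_sup,
      Ideal.map_sup, Ideal.map_mul, Ideal.span_singleton_pow, Ideal.span_singleton_pow,
      Ideal.map_span, Ideal.map_span, Set.image_singleton, Set.image_singleton, map_pow, map_pow]
  rw [hexp]
  apply le_antisymm
  · refine sup_le (sup_le ?_ ?_) ?_
    · intro x hx
      obtain ⟨q, hq, rfl⟩ := hbS x hx
      exact Ideal.mul_mem_mul (Ideal.mem_span_singleton_self _) (Ideal.mem_sup_left (hbs hq))
    · refine Ideal.mul_mono_right (le_trans (fun x hx ↦ ?_) le_sup_left)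
      exact (hs x).mpr ⟨0, by simpa using hx⟩
    · rw [Ideal.span_singleton_le_iff_mem, pow_succ]
      exact Ideal.mul_mem_mul (Ideal.mem_span_singleton_self _)
        (Ideal.mem_sup_right (Ideal.mem_span_singleton_self _))
  · rw [Ideal.mul_sup]
    refine sup_le ?_ ?_
    · intro x hx
      obtain ⟨z, hz, rfl⟩ := Ideal.mem_span_singleton_mul.mp hx
      -- Split `z` as φ(c) plus an element of `b`. The latter lies in `s`, so φ(c) does too, and `t
      -- ^ k` carries it into the truncated sum by the definition of `b`. It remains to see that `c`
      -- lies in `i k`.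
      have hzS : z ∈ S := hStop ▸ trivial
      obtain ⟨c, hc⟩ := hS.mp hzS
      have hcs : φ c ∈ s := by
        have := sub_mem hz (hbs hc)
        rwa [sub_sub_cancel] at this
      obtain ⟨M, hM⟩ := (hs _).mp hcs
      obtain ⟨m, d, hdi, hd⟩ := hmap _ hM
      obtain ⟨n, hn⟩ := h2 (t ^ m * (t ^ M * c) - d) (by
        rw [map_sub, map_mul, map_mul, map_pow, map_pow, hd, sub_self])
      -- Up to t-power torsion, which is the kernel of φ, a power of t times `c` lies in `i k`; and
      -- t is regular modulo `i k`.
      have hci : c ∈ i k := by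
        refine h3' (n + m + M) c ?_
        have : t ^ (n + m + M) * c = t ^ n * d := by
          rw [mul_sub, sub_eq_zero] at hn
          rw [← hn]; ring
        rw [this]
        exact Ideal.mul_mem_left _ _ hdi
      have hzc : φ t ^ k * z = φ t ^ k * (z - φ c) + φ t ^ k * φ c := by ring
      rw [hzc]
      refine Ideal.mem_sup_left (add_mem (Ideal.mem_sup_left hc) (Ideal.mem_sup_right ?_))
      exact Ideal.mul_mem_mul (Ideal.mem_span_singleton_self _) (Ideal.mem_map_of_mem _ hci)
    · rw [Ideal.span_singleton_mul_span_singleton, ← pow_succ]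
      exact le_sup_right

end Algebra

/-! ### The coordinate on the product over an affine open -/

section LineRing

variable {X : Scheme.{u}}

lemma coordinate_id : coordinate (𝟙 (Line X)) = AffineSpace.coord X PUnit.unit := by
  simp [coordinate]

/-- The inverse image in `X × 𝔸¹` of an affine open subscheme of `X`. -/
def lineOpen (U : X.affineOpens) : (Line X).affineOpens :=
  ⟨(Line X ↘ X) ⁻¹ᵁ U.1, (isAffineOpen_coe U).preimage _⟩

/-- The coordinate on an affine open subscheme of this form. -/
def lineCoord (U : X.affineOpens) : Γ(Line X, (lineOpen U).1) :=
  res le_top (coordinate (𝟙 (Line X)))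

/-- Over `U` the functions are polynomials in t, and the ideal consists of those with coefficients
in `K`. Multiplication by t only shifts the coefficients. -/
lemma mem_ideal_of_lineCoord_mul_mem (U : X.affineOpens) (K : X.IdealSheafData)
    {c : Γ(Line X, (lineOpen U).1)}
    (hc : lineCoord U * c ∈ (K.comap (Line X ↘ X)).ideal (lineOpen U)) :
    c ∈ (K.comap (Line X ↘ X)).ideal (lineOpen U) := by
  let e : Polynomial Γ(X, U.1) ≃+* Γ(Line X, (lineOpen U).1) :=
    RingEquiv.ofBijective _ (line_bijective U)
  have he : ∀ p, e p = Polynomial.eval₂RingHom ((Line X ↘ X).app U.1).hom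
      (res (le_top : (Line X ↘ X) ⁻¹ᵁ U.1 ≤ ⊤) (coordinate (𝟙 (Line X)))) p := fun _ ↦ rfl
  have h1 : (K.comap (Line X ↘ X)).ideal (lineOpen U) =
      ((K.ideal U).map Polynomial.C).map e.toRingHom := by
    rw [ideal_comap K _ U (lineOpen U) le_rfl, Ideal.map_map]
    congr 1
    ext a
    have h2 : e.toRingHom (Polynomial.C a) = ((Line X ↘ X).app U.1).hom a := by
      rw [RingEquiv.toRingHom_eq_coe, RingHom.coe_coe, he, Polynomial.coe_eval₂RingHom,
        Polynomial.eval₂_C]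
    refine Eq.trans ?_ h2.symm
    rw [Scheme.Hom.app_eq_appLE]
    rfl
  have h3 : ∀ p, e p ∈ (K.comap (Line X ↘ X)).ideal (lineOpen U) ↔
      p ∈ (K.ideal U).map Polynomial.C := by
    intro p
    rw [h1]
    constructor
    · intro h
      obtain ⟨q, hq, hqp⟩ := (Ideal.mem_map_iff_of_surjective e.toRingHom e.surjective).mp h
      rwa [← e.injective hqp]
    · exact fun h ↦ Ideal.mem_map_of_mem e.toRingHom h
  obtain ⟨p, rfl⟩ := e.surjective c
  have h4 : lineCoord U = e Polynomial.X := by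
    rw [he, Polynomial.coe_eval₂RingHom, Polynomial.eval₂_X]; rfl
  rw [h4, ← map_mul, h3, Ideal.mem_map_C_iff] at hc
  rw [h3, Ideal.mem_map_C_iff]
  intro n
  have := hc (n + 1)
  rwa [Polynomial.coeff_X_mul] at this

lemma lineCoord_mem_nonZeroDivisors (U : X.affineOpens) :
    lineCoord U ∈ nonZeroDivisors Γ(Line X, (lineOpen U).1) := by
  rw [mem_nonZeroDivisors_iff]
  have h : ∀ c, lineCoord U * c = 0 → c = 0 := by
    intro c hc
    have h1 : ((⊥ : X.IdealSheafData).comap (Line X ↘ X)).ideal (lineOpen U) = ⊥ := by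
      rw [IdealSheafData.comap_bot, IdealSheafData.ideal_bot]; rfl
    have := mem_ideal_of_lineCoord_mul_mem U ⊥ (c := c) (by rw [h1, hc]; exact zero_mem _)
    rwa [h1] at this
  exact ⟨h, fun c hc ↦ h c (by rw [mul_comm, hc])⟩

lemma isInvertibleIdeal_centralFibre : IsInvertibleIdeal (centralFibre (𝟙 (Line X))) := by
  intro y
  obtain ⟨U, hU, -⟩ := exists_affine_le (W := (⊤ : X.Opens)) (y := (Line X ↘ X) y) trivial
  exact ⟨lineOpen U, hU, _, lineCoord_mem_nonZeroDivisors U, centralFibre_ideal _ _⟩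

end LineRing

/-! ### The key identity between flag ideals and centres -/

section Key

variable {C A : Type*} [CommRing C] [CommRing A] {φ : C →+* A} {t : C} {i : ℕ → Ideal C} {k : ℕ}

/-- Divisibility of the k-th flag ideal by `t ^ k` passes to the earlier ones, each with its own
exponent, because their sums are truncations of the k-th. This is a converse of `map_flagPow_le`. -/
lemma map_flagProd_le (h : (flagPow (Ideal.span {t}) i k).map φ ≤ Ideal.span {φ t ^ k}) :
    ∀ n ≤ k, (flagProd (Ideal.span {t}) i n).map φ ≤ Ideal.span {φ t ^ tri n} := by
  intro n
  induction n with
  | zero => intro _; simp [tri]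
  | succ n ih =>
    intro hn
    rw [flagProd_succ, tri_succ, pow_add, Ideal.map_mul, ← Ideal.span_singleton_mul_span_singleton]
    refine Ideal.mul_mono (ih (by omega)) ?_
    have hle : Ideal.span {φ t ^ k} ≤ Ideal.span {φ t ^ (n + 1)} :=
      Ideal.span_singleton_le_span_singleton.mpr (pow_dvd_pow _ hn)
    rw [flagPow, Submodule.add_eq_sup, Ideal.map_sup]
    refine sup_le (le_trans (Ideal.map_mono ?_) (h.trans hle)) ?_
    · refine le_trans (flagSum_le.mpr fun j hj ↦ ?_) (flagSum_le_flagPow k _)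
      exact flagSum_le.mp le_rfl j (by omega)
    · rw [Ideal.span_singleton_pow, Ideal.map_span, Set.image_singleton, map_pow]

variable {X Y : Scheme.{u}}

lemma ideal_comap_flagPow (T : X.IdealSheafData) (K : ℕ → X.IdealSheafData) (n : ℕ) (f : Y ⟶ X)
    (U : X.affineOpens) (V : Y.affineOpens) (h : V.1 ≤ f ⁻¹ᵁ U.1) :
    ((flagPow T K n).comap f).ideal V =
      (flagPow (T.ideal U) (fun j ↦ (K j).ideal U) n).map (f.appLE U.1 V.1 h).hom := by
  rw [ideal_comap _ f U V h]
  exact congr_arg _ (map_flagPow (idealHom U) T K n)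

/-- The ideals `I₀ + t I₁ + ⋯ + t^(n-1) I_(n-1) + t^n` on `X × 𝔸¹`. -/
def lineFlag (I : ℕ → X.IdealSheafData) (n : ℕ) : (Line X).IdealSheafData :=
  flagPow (centralFibre (𝟙 (Line X))) (fun j ↦ (I j).comap (Line X ↘ X)) n

/-- The product of the first `k` of these ideals. -/
def lineProd (I : ℕ → X.IdealSheafData) (k : ℕ) : (Line X).IdealSheafData :=
  flagProd (centralFibre (𝟙 (Line X))) (fun j ↦ (I j).comap (Line X ↘ X)) k

lemma lineProd_succ (I : ℕ → X.IdealSheafData) (k : ℕ) :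
    lineProd I (k + 1) = lineProd I k * lineFlag I (k + 1) := flagProd_succ _ _ _

lemma IsInvertibleIdeal.lineFlag_comap {I : ℕ → X.IdealSheafData} {k : ℕ} {π : Y ⟶ Line X}
    (h : IsInvertibleIdeal ((lineProd I k).comap π)) :
    IsInvertibleIdeal ((lineFlag I k).comap π) := by
  cases k with
  | zero =>
    have : lineFlag I 0 = ⊤ := by simp [lineFlag, flagPow, flagSum, IdealSheafData.one_eq_top]
    rw [this, IdealSheafData.comap_top]
    exact isInvertibleIdeal_top
  | succ k =>
    rw [lineProd_succ, comap_mul] at h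
    exact h.of_mul_right

/-- On the blow-up in the product of the first `k` ideals, the inverse image of the next one is
that of the `k`-th one times the ideal of the centre of the next blow-up. -/
theorem IsBlowup.comap_lineFlag_succ {I : ℕ → X.IdealSheafData} {k : ℕ} {π : Y ⟶ Line X}
    (hI : MonotoneOn I (Set.Iic k)) (hπ : IsBlowup π (lineProd I k)) :
    (lineFlag I (k + 1)).comap π = (lineFlag I k).comap π * center π (I k) := by
  refine IdealSheafData.ext_of_locally fun y ↦ ?_
  obtain ⟨U, hU, -⟩ := exists_affine_le (W := (⊤ : X.Opens)) (y := (Line X ↘ X) (π y)) trivial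
  have hyW : y ∈ π ⁻¹ᵁ (lineOpen U).1 := hU
  obtain ⟨V, hyV, hVW, g, hg, hVg⟩ := hπ.invertible.lineFlag_comap.exists_le hyW
  set t := lineCoord U with ht
  let i : ℕ → Ideal Γ(Line X, (lineOpen U).1) :=
    fun j ↦ ((I j).comap (Line X ↘ X)).ideal (lineOpen U)
  have hi : MonotoneOn i (Set.Iic k) := by
    intro a ha b hb hab
    have := hI ha hb hab
    have h2 : (I a).comap (Line X ↘ X) ≤ (I b).comap (Line X ↘ X) :=
      (IdealSheafData.map_gc _).monotone_l this
    exact h2 (lineOpen U)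
  have hT : (centralFibre (𝟙 (Line X))).ideal (lineOpen U) = Ideal.span {t} :=
    centralFibre_ideal _ _
  have hflag : ∀ (n : ℕ) (D : Y.affineOpens) (h : D.1 ≤ π ⁻¹ᵁ (lineOpen U).1),
      ((lineFlag I n).comap π).ideal D =
        (flagPow (Ideal.span {t}) i n).map (π.appLE (lineOpen U).1 D.1 h).hom := by
    intro n D h
    rw [lineFlag, ideal_comap_flagPow _ _ n π (lineOpen U) D h, hT]
  have hprod : (lineProd I k).ideal (lineOpen U) = flagProd (Ideal.span {t}) i k := by
    rw [← hT]
    exact map_flagProd (idealHom (lineOpen U)) _ _ k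
  have hcoord : ∀ (D : Y.affineOpens) (h : D.1 ≤ π ⁻¹ᵁ (lineOpen U).1),
      (π.appLE (lineOpen U).1 D.1 h).hom t = res (le_top : D.1 ≤ ⊤) (coordinate π) := by
    intro D h
    rw [ht, lineCoord, res_appLE, ← appLE_res π le_top le_top]
    congr 1
    rw [coordinate_id, coordinate, Scheme.Hom.appTop, Scheme.Hom.app_eq_appLE]
    rfl
  have hbase : ∀ (D : Y.affineOpens) (h : D.1 ≤ π ⁻¹ᵁ (lineOpen U).1) (j : ℕ),
      ((I j).comap (toBase π)).ideal D = (i j).map (π.appLE (lineOpen U).1 D.1 h).hom := by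
    intro D h j
    rw [toBase, IdealSheafData.comap_comp, ideal_comap _ π (lineOpen U) D h]
  have hideal : ∀ D : Y.affineOpens, ((lineFlag I k).comap π * center π (I k)).ideal D =
      ((lineFlag I k).comap π).ideal D * ((properTransform π (I k)).ideal D ⊔
        Ideal.span {res (le_top : D.1 ≤ ⊤) (coordinate π)}) := by
    intro D
    rw [← centralFibre_ideal]; rfl
  have htV : (π.appLE (lineOpen U).1 V.1 hVW).hom t ^ k ∈ ((lineFlag I k).comap π).ideal V := by
    rw [hflag k V hVW, ← map_pow]
    exact Ideal.mem_map_of_mem _ (pow_mem_flagPow k)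
  obtain ⟨m, hm⟩ := Ideal.mem_span_singleton.mp (hVg ▸ htV)
  -- Here t^k = g m for the generator g of the k-th flag ideal. Where m is invertible, t^k is itself
  -- a generator and the computation takes place on one chart. Otherwise the sum without t^k
  -- suffices to generate the ideal near `y`.
  by_cases hym : y ∈ Y.basicOpen m
  · obtain ⟨D, hDV, hyD, hmD⟩ := exists_affine_isUnit hym
    have hDW := hDV.trans hVW
    have hD : (flagPow (Ideal.span {t}) i k).map (π.appLE (lineOpen U).1 D.1 hDW).hom ≤
        Ideal.span {(π.appLE (lineOpen U).1 D.1 hDW).hom t ^ k} := by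
      rw [← hflag k D hDW, ideal_of_le hDV hVg, ← appLE_res π hVW hDV, ← map_pow, hm, map_mul,
        Ideal.span_singleton_mul_right_unit hmD]
    have hprodD := map_flagProd_le hD k le_rfl
    -- As t^k generates the k-th flag ideal here, `t ^ tri k` generates the whole product, which
    -- puts `y` in this chart.
    set f := t ^ tri k with hf
    have hfK : f ∈ (lineProd I k).ideal (lineOpen U) := by
      rw [hprod]; exact pow_tri_mem_flagProd k
    have hyf : y ∈ generatedBy π (lineProd I k) (lineOpen U) f := by
      refine mem_generatedBy.mpr ⟨D, hyD, hDW, ?_⟩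
      rw [ideal_comap _ π (lineOpen U) D hDW, hprod]
      refine le_antisymm (by rw [hf, map_pow]; exact hprodD) ?_
      rw [Ideal.span_singleton_le_iff_mem]
      exact Ideal.mem_map_of_mem _ (pow_tri_mem_flagProd k)
    have haff := (hπ.exists_chart hfK).1
    refine ⟨⟨_, haff⟩, hyf, ?_⟩
    rw [hideal, hflag _ _ generatedBy_le, hflag _ _ generatedBy_le, ← hcoord _ generatedBy_le]
    refine map_flagPow_succ hi ?_ ?_ ?_ ?_ ?_ ?_
    · exact hπ.appLE_mem_nonZeroDivisors hfK (lineCoord_mem_nonZeroDivisors U)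
    · rw [← hprod, ← map_pow]
      have h5 := ideal_eq_span_of_le_generatedBy (W := ⟨_, haff⟩) hπ.invertible hfK le_rfl
      rw [ideal_comap _ π (lineOpen U) ⟨_, haff⟩ generatedBy_le] at h5
      exact h5.le
    · intro S hS1 hS2
      refine hπ.subring_eq_top hfK (Ideal.span_eq _).symm S hS1 fun s hs q hq ↦ ?_
      refine hS2 s (hprod ▸ hs) q ?_
      rw [← map_pow]; exact hq
    · intro c hc
      obtain ⟨n, hn⟩ := hπ.exists_pow_mul_eq_zero hfK hc
      exact ⟨tri k * n, by rwa [pow_mul]⟩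
    · intro c hc
      exact mem_ideal_of_lineCoord_mul_mem U _ hc
    · intro x
      rw [mem_properTransform_ideal, hbase _ generatedBy_le, hcoord _ generatedBy_le]
  · obtain ⟨P, hP, hPy⟩ := exists_prime_of_mem V hyV
    have hmP : m ∈ P := by
      by_contra h
      exact hym ((hPy m).mp h)
    have hgV : g ∈ (flagSum (Ideal.span {t}) i k).map (π.appLE (lineOpen U).1 V.1 hVW).hom ⊔
        Ideal.span {(π.appLE (lineOpen U).1 V.1 hVW).hom t ^ k} := by
      have h1 := hVg ▸ Ideal.mem_span_singleton_self g
      rw [hflag k V hVW, flagPow, Submodule.add_eq_sup, Ideal.map_sup, Ideal.span_singleton_pow,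
        Ideal.map_span, Set.image_singleton, map_pow] at h1
      exact h1
    obtain ⟨j, hj, z, hz, hjz⟩ := Submodule.mem_sup.mp hgV
    obtain ⟨c, rfl⟩ := Ideal.mem_span_singleton.mp hz
    -- The generator is g = j + t^k c = j + g m c with j in the truncated sum. Since m vanishes at
    -- `y`, the factor 1 - m c is invertible nearby, so g lies in the truncated sum.
    have hyu : y ∈ Y.basicOpen (1 - m * c) := by
      refine (hPy _).mp fun h ↦ (Ideal.ne_top_iff_one P).mp hP.ne_top ?_
      simpa using add_mem h (P.mul_mem_right c hmP)
    obtain ⟨D, hDV, hyD, huD⟩ := exists_affine_isUnit hyu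
    have hDW := hDV.trans hVW
    refine ⟨D, hyD, ?_⟩
    have hgD : res hDV g ∈
        (flagSum (Ideal.span {t}) i k).map (π.appLE (lineOpen U).1 D.1 hDW).hom := by
      rw [← Ideal.mul_unit_mem_iff_mem _ huD, ← map_mul]
      have h2 : g * (1 - m * c) = j := by
        rw [mul_sub, mul_one, ← mul_assoc, ← hm]
        exact sub_eq_of_eq_add hjz.symm
      rw [h2]
      have h3 := Ideal.mem_map_of_mem (res hDV) hj
      rw [Ideal.map_map] at h3
      convert h3 using 2
      ext a
      exact (appLE_res π hVW hDV a).symm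
    have hDg := ideal_of_le hDV hVg
    have hle : ((lineFlag I k).comap π).ideal D ≤
        (flagSum (Ideal.span {t}) i k).map (π.appLE (lineOpen U).1 D.1 hDW).hom := by
      rw [hDg, Ideal.span_singleton_le_iff_mem]
      exact hgD
    have hsum : flagSum (Ideal.span {t}) i k ≤ i k :=
      flagSum_le.mpr fun a ha ↦ Ideal.mul_le_right.trans
        (hi (Set.mem_Iic.mpr ha.le) (Set.mem_Iic.mpr le_rfl) ha.le)
    -- The power t^k lies in the truncated sum, hence in the inverse image of `I k`, so the
    -- t-saturation is the unit ideal. The centre misses `D`, and it remains to identify two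
    -- consecutive flag ideals there.
    have htop : (properTransform π (I k)).ideal D = ⊤ := by
      rw [Ideal.eq_top_iff_one, mem_properTransform_ideal, hbase _ hDW, ← hcoord D hDW]
      refine ⟨k, Ideal.map_mono hsum (hle ?_)⟩
      rw [mul_one, hflag k D hDW, ← map_pow]
      exact Ideal.mem_map_of_mem _ (pow_mem_flagPow k)
    rw [hideal, htop, top_sup_eq, Ideal.mul_top]
    refine le_antisymm ?_ (hle.trans ?_)
    · rw [hflag _ D hDW, hflag _ D hDW]
      refine Ideal.map_mono ?_
      rw [flagPow, flagPow, flagSum_succ, Submodule.add_eq_sup, Submodule.add_eq_sup,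
        Submodule.add_eq_sup]
      exact sup_le (sup_le le_sup_left (Ideal.mul_le_left.trans le_sup_right))
        ((Ideal.pow_le_pow_right (Nat.le_succ k)).trans le_sup_right)
    · rw [hflag _ D hDW]
      refine Ideal.map_mono (le_trans ?_ (flagSum_le_flagPow _ _))
      rw [flagSum_succ, Submodule.add_eq_sup]
      exact le_sup_left

end Key

/-! ### Formal consequences of the universal property -/

section Universal

variable {Y' Y T : Scheme.{u}} {π : Y' ⟶ Y} {J : Y.IdealSheafData}

lemma IsBlowup.hom_ext (hπ : IsBlowup π J) {g h : T ⟶ Y'} (e : g ≫ π = h ≫ π)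
    (hJ : IsInvertibleIdeal (J.comap (g ≫ π))) : g = h :=
  (hπ.existsUnique_lift (g ≫ π) hJ).unique rfl e.symm

lemma IsBlowup.exists_lift (hπ : IsBlowup π J) (g : T ⟶ Y) (hg : IsInvertibleIdeal (J.comap g)) :
    ∃ h : T ⟶ Y', h ≫ π = g := (hπ.existsUnique_lift g hg).exists

lemma isBlowup_of_isIso [IsIso π] (hJ : IsInvertibleIdeal (J.comap π)) : IsBlowup π J :=
  ⟨hJ, fun g _ ↦ ⟨g ≫ inv π, by simp, fun h e ↦ by simp [← e]⟩⟩

/-- The ideal is the unit ideal on `W`, so the inclusion of `W` lifts to the blow-up. Uniqueness of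
lifts makes it an inverse. -/
lemma IsBlowup.isIso_of_le {W : Y.Opens} (hπ : IsBlowup π J) (hW : J.comap W.ι = ⊤) :
    IsIso (π ∣_ W) := by
  have h1 : IsInvertibleIdeal (J.comap W.ι) := hW ▸ isInvertibleIdeal_top
  obtain ⟨s, hs⟩ := hπ.exists_lift W.ι h1
  have hle : ⊤ ≤ s ⁻¹ᵁ π ⁻¹ᵁ W := by
    rw [← Scheme.Hom.comp_preimage, hs]; simp
  let s' : (W : Scheme) ⟶ (π ⁻¹ᵁ W : Y'.Opens) := IsOpenImmersion.lift (π ⁻¹ᵁ W).ι s (by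
    rw [Scheme.Opens.range_ι]
    rintro _ ⟨x, rfl⟩
    exact hle trivial)
  have hs' : s' ≫ (π ⁻¹ᵁ W).ι = s := IsOpenImmersion.lift_fac _ _ _
  refine ⟨s', ?_, ?_⟩
  · rw [← cancel_mono (π ⁻¹ᵁ W).ι, Category.assoc, hs', Category.id_comp]
    have e : (π ∣_ W ≫ s) ≫ π = (π ⁻¹ᵁ W).ι ≫ π := by
      rw [Category.assoc, hs, morphismRestrict_ι]
    refine hπ.hom_ext e ?_
    rw [Category.assoc, hs, IdealSheafData.comap_comp, hW, IdealSheafData.comap_top]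
    exact isInvertibleIdeal_top
  · rw [← cancel_mono W.ι, Category.assoc, morphismRestrict_ι, ← Category.assoc, hs', hs,
      Category.id_comp]

end Universal

/-! ### The stages as blow-ups of the product -/

section Stages

variable {X : Scheme.{u}}

/-- The next stage of the iterated blow-up. -/
lemma IsBlowup.comp_lineProd {I : ℕ → X.IdealSheafData} {k : ℕ} {Y Y' : Scheme.{u}}
    {π : Y ⟶ Line X} {β : Y' ⟶ Y} (hI : MonotoneOn I (Set.Iic k))
    (hπ : IsBlowup π (lineProd I k)) (hβ : IsBlowup β (center π (I k))) :
    IsBlowup (β ≫ π) (lineProd I (k + 1)) := by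
  -- The pullback of the next product is split into factors. If it is invertible, so is the pullback
  -- of the centre, which provides the lift along `β`.
  have key : ∀ {T : Scheme.{u}} (h : T ⟶ Y), (lineProd I (k + 1)).comap (h ≫ π) =
      ((lineProd I k).comap π).comap h * (((lineFlag I k).comap π).comap h *
        (center π (I k)).comap h) := by
    intro T h
    rw [IdealSheafData.comap_comp, lineProd_succ, comap_mul, hπ.comap_lineFlag_succ hI,
      comap_mul, comap_mul]
  refine ⟨?_, fun {T} g hg ↦ ?_⟩
  · rw [key]
    exact (hβ.isInvertibleIdeal_comap hπ.invertible).mul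
      ((hβ.isInvertibleIdeal_comap hπ.invertible.lineFlag_comap).mul hβ.invertible)
  · obtain ⟨h, rfl⟩ := hπ.exists_lift g (by
      rw [lineProd_succ, comap_mul] at hg
      exact hg.of_mul_left)
    rw [key] at hg
    have hc := hg.of_mul_right.of_mul_right
    obtain ⟨s, rfl⟩ := hβ.exists_lift h hc
    refine ⟨s, by simp, fun s' hs' ↦ ?_⟩
    have h2 : s' ≫ β = s ≫ β := by
      refine hπ.hom_ext (by simpa using hs') ?_
      rw [Category.assoc, hs']
      rw [IdealSheafData.comap_comp]
      exact hg.of_mul_left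
    exact hβ.hom_ext h2 (h2 ▸ hc)

/-- The extension of a finite sequence of ideal sheaves by the unit ideal. -/
def extend {p : ℕ} (I : Fin p → X.IdealSheafData) (n : ℕ) : X.IdealSheafData :=
  if h : n < p then I ⟨n, h⟩ else ⊤

lemma extend_val {p : ℕ} (I : Fin p → X.IdealSheafData) (k : Fin p) : extend I k = I k := by
  simp [extend]

lemma extend_monotone {p : ℕ} {I : Fin p → X.IdealSheafData} (hI : Monotone I) :
    Monotone (extend I) := by
  intro a b hab
  unfold extend
  split_ifs with h1 h2
  · exact hI hab
  · exact le_top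
  · omega
  · exact le_rfl

lemma flagIdeal_eq {p : ℕ} (I : Fin p → X.IdealSheafData) :
    flagIdeal I = lineFlag (extend I) p := by
  rw [flagIdeal, lineFlag, flagPow, flagSum, Finset.sum_range]
  simp_rw [extend_val]

variable {p : ℕ} {I : Fin p → X.IdealSheafData} (Y : IteratedBlowup I)

/-- The stages of the iterated blow-up are blow-ups of `X × 𝔸¹`. -/
theorem IteratedBlowup.isBlowup_toLine (hI : Monotone I) (k : Fin (p + 1)) :
    IsBlowup (Y.toLine k) (lineProd (extend I) k) := by
  induction k using Fin.induction with
  | zero =>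
    have := Y.isIso_toLine_zero
    have h : lineProd (extend I) ((0 : Fin (p + 1)) : ℕ) = ⊤ := by
      simp [lineProd, flagProd, IdealSheafData.one_eq_top]
    rw [h]
    exact isBlowup_of_isIso (by rw [IdealSheafData.comap_top]; exact isInvertibleIdeal_top)
  | succ k ih =>
    rw [Y.toLine_succ]
    have h := Y.isBlowup k
    rw [← extend_val I k] at h
    exact ih.comp_lineProd ((extend_monotone hI).monotoneOn _) h

/-- In terms of divisors: at each stage the divisor of the flag ideal is pulled back and the new
exceptional divisor is added. Iterated, it expresses the pullback of P as the sum of the pullbacks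
of all E_k, which is why the polarisations agree. -/
theorem IteratedBlowup.comap_lineFlag_succ (hI : Monotone I) (k : Fin p) :
    (lineFlag (extend I) k.succ).comap (Y.toLine k.succ) =
      ((lineFlag (extend I) k.castSucc).comap (Y.toLine k.castSucc)).comap (Y.blowdown k) *
        (center (Y.toLine k.castSucc) (I k)).comap (Y.blowdown k) := by
  have h := (Y.isBlowup_toLine hI k.castSucc).comap_lineFlag_succ
    ((extend_monotone hI).monotoneOn _)
  rw [show extend I (k.castSucc : ℕ) = I k from extend_val I k] at h
  have h2 := congr_arg (fun J ↦ J.comap (Y.blowdown k)) h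
  beta_reduce at h2
  rw [← IdealSheafData.comap_comp, ← Y.toLine_succ, comap_mul] at h2
  exact h2

lemma IteratedBlowup.isInvertibleIdeal_lineFlag (hI : Monotone I) (k : Fin (p + 1)) :
    IsInvertibleIdeal ((lineFlag (extend I) k).comap (Y.toLine k)) :=
  (Y.isBlowup_toLine hI k).invertible.lineFlag_comap

end Stages

/-! ### The contraction -/

section Contraction

variable {X : Scheme.{u}}

lemma support_centralFibre {Y : Scheme.{u}} (π : Y ⟶ Line X) :
    ((centralFibre π).support : Set Y) = (generic π : Set Y)ᶜ := by
  rw [centralFibre, IdealSheafData.coe_support_ofIdealTop, Scheme.zeroLocus_span,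
    Scheme.zeroLocus_singleton, generic]

lemma generic_comp {Y' Y : Scheme.{u}} (f : Y' ⟶ Y) (π : Y ⟶ Line X) :
    generic (f ≫ π) = f ⁻¹ᵁ generic π := by
  rw [generic, generic, Scheme.preimage_basicOpen_top]
  rfl

/-- The ideal contains a power of t, which is invertible off the central fibre. -/
lemma comap_ι_generic_eq_top {J : (Line X).IdealSheafData} {n : ℕ}
    (h : centralFibre (𝟙 (Line X)) ^ n ≤ J) : J.comap (generic (𝟙 (Line X))).ι = ⊤ := by
  have h1 : (centralFibre (𝟙 (Line X))).comap (generic (𝟙 (Line X))).ι = ⊤ := by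
    rw [← IdealSheafData.support_eq_bot_iff]
    ext y
    rw [IdealSheafData.support_comap]
    have hy := support_centralFibre (𝟙 (Line X))
    constructor
    · intro h
      have h2 : (generic (𝟙 (Line X))).ι y ∈ ((centralFibre (𝟙 (Line X))).support : Set _) := h
      rw [hy] at h2
      exact (h2 y.2).elim
    · exact False.elim
  rw [eq_top_iff]
  have h2 := (IdealSheafData.map_gc (generic (𝟙 (Line X))).ι).monotone_l h
  rw [← comapHom_apply, map_pow, comapHom_apply, h1] at h2
  exact le_trans (by rw [← IdealSheafData.one_eq_top, one_pow]) h2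

lemma pow_le_lineFlag (I : ℕ → X.IdealSheafData) (n : ℕ) :
    centralFibre (𝟙 (Line X)) ^ n ≤ lineFlag I n := le_sup_right

lemma pow_le_lineProd (I : ℕ → X.IdealSheafData) (n : ℕ) :
    centralFibre (𝟙 (Line X)) ^ tri n ≤ lineProd I n := by
  induction n with
  | zero => simp [lineProd, flagProd, tri]
  | succ n ih =>
    rw [lineProd_succ, tri_succ, pow_add]
    intro U
    exact Ideal.mul_mono (ih U) (pow_le_lineFlag I (n + 1) U)

/-- The ideal (t) is invertible on the product and stays invertible on the blow-up, so the central
fibre has dense complement. -/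
lemma IsBlowup.dense_generic {B : Scheme.{u}} {π : B ⟶ Line X} {J : (Line X).IdealSheafData}
    (hπ : IsBlowup π J) : Dense ((π ⁻¹ᵁ generic (𝟙 (Line X)) : B.Opens) : Set B) := by
  have h := (hπ.isInvertibleIdeal_comap isInvertibleIdeal_centralFibre).dense_compl_support
  rw [← centralFibre_comp, support_centralFibre, compl_compl, generic_comp] at h
  exact h

/-- Properness of `q` follows by cancellation from that of both blow-ups. Both are isomorphisms over
t ≠ 0, hence so is `q`. Its image is closed and contains a dense open subset, so it is everything.
-/
lemma isContraction_of_isBlowup [IsLocallyNoetherian (Line X)] {Y B : Scheme.{u}} {π : Y ⟶ Line X}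
    {ρ : B ⟶ Line X} {K J : (Line X).IdealSheafData} (hπ : IsBlowup π K) (hρ : IsBlowup ρ J)
    {m n : ℕ} (hK : centralFibre (𝟙 (Line X)) ^ m ≤ K) (hJ : centralFibre (𝟙 (Line X)) ^ n ≤ J)
    (q : Y ⟶ B) (hq : q ≫ ρ = π) : IsContraction q := by
  have := hπ.isProper
  have := hρ.isProper
  subst hq
  have hqp : IsProper q := MorphismProperty.of_postcomp (W := @IsProper) (W' := @IsSeparated) q ρ
    inferInstance inferInstance
  set G := generic (𝟙 (Line X)) with hG
  have hπG := hπ.isIso_of_le (W := G) (comap_ι_generic_eq_top hK)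
  have hρG := hρ.isIso_of_le (W := G) (comap_ι_generic_eq_top hJ)
  rw [morphismRestrict_comp] at hπG
  have hiso : IsIso (q ∣_ ρ ⁻¹ᵁ G) := @IsIso.of_isIso_comp_right _ _ _ _ _ _ (ρ ∣_ G) hρG hπG
  refine ⟨hqp, ⟨?_⟩, ρ ⁻¹ᵁ G, hρ.dense_generic, hπ.dense_generic, hiso⟩
  have hcl : IsClosed (Set.range q) := q.isClosedMap.isClosed_range
  have hsub : ((ρ ⁻¹ᵁ G : B.Opens) : Set B) ⊆ Set.range q := by
    intro x hx
    obtain ⟨y, hy⟩ := (q ∣_ ρ ⁻¹ᵁ G).surjective ⟨x, hx⟩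
    refine ⟨(q ⁻¹ᵁ ρ ⁻¹ᵁ G).ι y, ?_⟩
    rw [← Scheme.Hom.comp_apply, ← morphismRestrict_ι, Scheme.Hom.comp_apply, hy]
    rfl
  intro x
  have := hcl.closure_subset_iff.mpr hsub
  exact this (hρ.dense_generic x)

end Contraction

/-! ### The universal point of `𝔾ₘ × Y` -/

section Gm

variable {Y T : Scheme.{u}}

lemma isUnit_of_basicOpen_eq_top {f : Γ(Y, ⊤)} (h : Y.basicOpen f = ⊤) : IsUnit f := by
  have h1 : ∀ (V : Y.Opens) (hV : V ≤ ⊤), V = ⊤ → IsUnit (res hV f) → IsUnit f := by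
    rintro _ hV rfl h
    have h2 : res hV f = f := by
      have : (homOfLE hV).op = 𝟙 _ := rfl
      change (Y.presheaf.map (homOfLE hV).op).hom f = f
      rw [this, Y.presheaf.map_id]
      rfl
    rwa [h2] at h
  exact h1 _ (Y.basicOpen_le f) h (RingedSpace.isUnit_res_basicOpen _ f)

/-- The scheme `𝔾ₘ × Y`. -/
def gm (Y : Scheme.{u}) : Scheme.{u} := generic (𝟙 (Line Y))

/-- The inclusion in `Y × 𝔸¹`. -/
def gmι (Y : Scheme.{u}) : gm Y ⟶ Line Y := (generic (𝟙 (Line Y))).ι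

instance : IsOpenImmersion (gmι Y) := inferInstanceAs (IsOpenImmersion (Scheme.Opens.ι _))

/-- The projection `𝔾ₘ × Y ⟶ Y`. -/
def gmPr (Y : Scheme.{u}) : gm Y ⟶ Y := gmι Y ≫ (Line Y ↘ Y)

instance : Flat (gmPr Y) := by unfold gmPr; infer_instance

lemma isUnit_coordinate_gmι : IsUnit (coordinate (gmι Y)) := by
  apply isUnit_of_basicOpen_eq_top
  have h := generic_comp (gmι Y) (𝟙 (Line Y))
  rw [Category.comp_id] at h
  exact h.trans (Scheme.Opens.ι_preimage_self _)

/-- The universal unit. -/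
def gmUnit (Y : Scheme.{u}) : Γ(gm Y, ⊤)ˣ := isUnit_coordinate_gmι.unit

lemma exists_gmLift (l : Γ(T, ⊤)ˣ) (y : T ⟶ Y) :
    ∃ f : T ⟶ gm Y, f ≫ gmι Y = AffineSpace.homOfVector y fun _ ↦ l.val := by
  refine ⟨IsOpenImmersion.lift (gmι Y) (AffineSpace.homOfVector y fun _ ↦ l.val) ?_,
    IsOpenImmersion.lift_fac _ _ _⟩
  have h := generic_comp (AffineSpace.homOfVector y fun _ ↦ l.val) (𝟙 (Line Y))
  have h1 : coordinate (AffineSpace.homOfVector y (fun _ ↦ l.val) ≫ 𝟙 (Line Y)) = l.val := by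
    rw [Category.comp_id, coordinate]
    exact AffineSpace.homOfVector_appTop_coord _ _ _
  rw [generic, h1, Scheme.basicOpen_of_isUnit _ l.isUnit] at h
  have hr : Set.range (gmι Y) = (generic (𝟙 (Line Y)) : Set (Line Y)) := Scheme.Opens.range_ι _
  rw [hr]
  rintro _ ⟨x, rfl⟩
  exact h.le (trivial : x ∈ (⊤ : T.Opens))

/-- The morphism to `𝔾ₘ × Y` given by a unit and a morphism to `Y`. -/
def gmLift (l : Γ(T, ⊤)ˣ) (y : T ⟶ Y) : T ⟶ gm Y := (exists_gmLift l y).choose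

lemma gmLift_gmι (l : Γ(T, ⊤)ˣ) (y : T ⟶ Y) :
    gmLift l y ≫ gmι Y = AffineSpace.homOfVector y fun _ ↦ l.val :=
  (exists_gmLift l y).choose_spec

@[simp]
lemma gmLift_gmPr (l : Γ(T, ⊤)ˣ) (y : T ⟶ Y) : gmLift l y ≫ gmPr Y = y := by
  rw [gmPr, ← Category.assoc, gmLift_gmι, AffineSpace.homOfVector_over]

@[simp]
lemma gmLift_gmPr_assoc (l : Γ(T, ⊤)ˣ) (y : T ⟶ Y) {Z : Scheme.{u}} (h : Y ⟶ Z) :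
    gmLift l y ≫ gmPr Y ≫ h = y ≫ h := by
  rw [← Category.assoc, gmLift_gmPr]

/-- The pullback of units. -/
abbrev pbUnit {T' : Scheme.{u}} (f : T' ⟶ T) (l : Γ(T, ⊤)ˣ) : Γ(T', ⊤)ˣ :=
  Units.map f.appTop.hom.toMonoidHom l

lemma pbUnit_comp {T' T'' : Scheme.{u}} (g : T'' ⟶ T') (f : T' ⟶ T) (l : Γ(T, ⊤)ˣ) :
    pbUnit (g ≫ f) l = pbUnit g (pbUnit f l) := by
  ext; simp; rfl

@[simp]
lemma pbUnit_gmLift (l : Γ(T, ⊤)ˣ) (y : T ⟶ Y) : pbUnit (gmLift l y) (gmUnit Y) = l := by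
  ext
  have h : (gmLift l y).appTop.hom (coordinate (gmι Y)) = coordinate (gmLift l y ≫ gmι Y) := by
    simp [coordinate]; rfl
  refine h.trans ?_
  rw [gmLift_gmι, coordinate]
  exact AffineSpace.homOfVector_appTop_coord _ _ _

end Gm

/-! ### Actions on blow-ups -/

section Action

variable {X Y : Scheme.{u}} {π : Y ⟶ Line X} {J : (Line X).IdealSheafData}

/-- Invariance of an ideal sheaf on `X × 𝔸¹` under the standard action. -/
def IsInvariant (J : (Line X).IdealSheafData) : Prop :=
  ∀ {T : Scheme.{u}} (l : Γ(T, ⊤)ˣ) (z : T ⟶ Line X),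
    J.comap ((lineAction X).act l z) = J.comap z

lemma isInvariant_centralFibre : IsInvariant (centralFibre (𝟙 (Line X))) := by
  intro T l z
  rw [← centralFibre_comp, ← centralFibre_comp, Category.comp_id, Category.comp_id]
  have h : coordinate ((lineAction X).act l z) = l.val * coordinate z :=
    AffineSpace.homOfVector_appTop_coord _ _ _
  rw [centralFibre, centralFibre, h, Ideal.span_singleton_mul_left_unit l.isUnit]

lemma isInvariant_comap (K : X.IdealSheafData) : IsInvariant (K.comap (Line X ↘ X)) := by
  intro T l z
  rw [← IdealSheafData.comap_comp, ← IdealSheafData.comap_comp, lineAction_over]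

/-- Inverse image is a homomorphism of semirings, so a polynomial expression in invariant ideals is
invariant. -/
lemma isInvariant_lineFlag (I : ℕ → X.IdealSheafData) (n : ℕ) : IsInvariant (lineFlag I n) := by
  intro T l z
  have h : ∀ f : T ⟶ Line X, (lineFlag I n).comap f = _ := fun f ↦ map_flagPow (comapHom f) _ _ n
  rw [h, h, comapHom_apply, comapHom_apply, isInvariant_centralFibre]
  congr 1
  funext j
  exact isInvariant_comap (I j) l z

lemma isInvariant_lineProd (I : ℕ → X.IdealSheafData) (n : ℕ) : IsInvariant (lineProd I n) := by
  intro T l z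
  induction n with
  | zero => simp [lineProd, flagProd, IdealSheafData.one_eq_top]
  | succ n ih => rw [lineProd_succ, comap_mul, comap_mul, ih, isInvariant_lineFlag]

/-- The universal property applies only to morphisms pulling `J` back to an invertible ideal. This
may fail at an arbitrary point of `Y`, but the projection from 𝔾ₘ × Y is flat, and invariance
handles the action. -/
lemma IsBlowup.exists_action_gm (hπ : IsBlowup π J) (hJ : IsInvariant J) :
    ∃ s : gm Y ⟶ Y, s ≫ π = (lineAction X).act (gmUnit Y) (gmPr Y ≫ π) := by
  refine hπ.exists_lift _ ?_
  rw [hJ, IdealSheafData.comap_comp]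
  exact hπ.invertible.comap _

/-- Two morphisms from a flat `Y`-scheme to a blow-up agree if they agree after an action of a
unit. -/
lemma IsBlowup.hom_ext_of_act (hπ : IsBlowup π J) (hJ : IsInvariant J) {T Y' : Scheme.{u}}
    {π' : Y' ⟶ Line X} (hπ' : IsInvertibleIdeal (J.comap π')) (z : T ⟶ Y') [Flat z]
    (l : Γ(T, ⊤)ˣ) {g h : T ⟶ Y} (hg : g ≫ π = (lineAction X).act l (z ≫ π'))
    (hh : h ≫ π = (lineAction X).act l (z ≫ π')) : g = h := by
  refine hπ.hom_ext (hg.trans hh.symm) ?_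
  rw [hg, hJ, IdealSheafData.comap_comp]
  exact hπ'.comap z

/-- The action of `𝔾ₘ` on the blow-up of an invariant ideal sheaf. -/
def IsBlowup.liftedAction (hπ : IsBlowup π J) (hJ : IsInvariant J) : LiftedAction π :=
  have key : ∀ {T : Scheme.{u}} (l : Γ(T, ⊤)ˣ) (y : T ⟶ Y),
      (gmLift l y ≫ (hπ.exists_action_gm hJ).choose) ≫ π = (lineAction X).act l (y ≫ π) := by
    intro T l y
    rw [Category.assoc, (hπ.exists_action_gm hJ).choose_spec, ← (lineAction X).comp_act]
    change (lineAction X).act (pbUnit _ _) _ = _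
    rw [pbUnit_gmLift, gmLift_gmPr_assoc]
  have hlift : ∀ {T' T : Scheme.{u}} (f : T' ⟶ T) (l : Γ(T, ⊤)ˣ) (y : T ⟶ Y),
      gmLift (pbUnit f l) (f ≫ y) = f ≫ gmLift l y := by
    intro T' T f l y
    rw [← cancel_mono (gmι Y), Category.assoc, gmLift_gmι, gmLift_gmι,
      AffineSpace.comp_homOfVector]
    rfl
  have hcomp : ∀ {T' T : Scheme.{u}} (f : T' ⟶ T) (l : Γ(T, ⊤)ˣ) (y : T ⟶ Y),
      gmLift (pbUnit f l) (f ≫ y) ≫ (hπ.exists_action_gm hJ).choose =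
        f ≫ gmLift l y ≫ (hπ.exists_action_gm hJ).choose := by
    intro T' T f l y
    rw [hlift, Category.assoc]
  { act l y := gmLift l y ≫ (hπ.exists_action_gm hJ).choose
    comp_act f l y := hcomp f l y
    one_act {T} y := by
      have h1 : gmLift 1 (𝟙 Y) ≫ (hπ.exists_action_gm hJ).choose = 𝟙 Y := by
        refine hπ.hom_ext_of_act hJ hπ.invertible (𝟙 Y) 1 (key _ _) ?_
        rw [Category.id_comp, (lineAction X).one_act]
      have h2 := hcomp y 1 (𝟙 Y)
      rw [h1, Category.comp_id] at h2
      rwa [show pbUnit y (1 : Γ(Y, ⊤)ˣ) = 1 from map_one _] at h2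
    mul_act {T} l m y := by
      -- Associativity is checked at the universal triple over 𝔾ₘ × 𝔾ₘ × Y, again flat over `Y`, and
      -- pulled back along `u`.
      let G := gm (gm Y)
      let z : G ⟶ Y := gmPr (gm Y) ≫ gmPr Y
      let l₀ : Γ(G, ⊤)ˣ := gmUnit (gm Y)
      let m₀ : Γ(G, ⊤)ˣ := pbUnit (gmPr (gm Y)) (gmUnit Y)
      have h1 : gmLift (l₀ * m₀) z ≫ (hπ.exists_action_gm hJ).choose =
          gmLift l₀ (gmLift m₀ z ≫ (hπ.exists_action_gm hJ).choose) ≫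
            (hπ.exists_action_gm hJ).choose := by
        refine hπ.hom_ext_of_act hJ hπ.invertible z _ (key _ _) ?_
        rw [key, key, (lineAction X).mul_act]
      let u : T ⟶ G := gmLift l (gmLift m y)
      have hl : pbUnit u l₀ = l := pbUnit_gmLift _ _
      have hm : pbUnit u m₀ = m := by
        rw [← pbUnit_comp, gmLift_gmPr, pbUnit_gmLift]
      have hz : u ≫ z = y := by simp [u, z]
      have h2 := congr_arg (u ≫ ·) h1
      beta_reduce at h2
      rw [← hcomp, ← hcomp, ← hcomp, hl, hm, hz] at h2
      rw [show pbUnit u (l₀ * m₀) = pbUnit u l₀ * pbUnit u m₀ from map_mul _ _ _, hl, hm] at h2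
      exact h2
    equivariant l y := key l y }

/-- A morphism of blow-ups of `X × 𝔸¹` is equivariant. -/
lemma IsBlowup.isEquivariant (hπ : IsBlowup π J) (hJ : IsInvariant J) {Y' : Scheme.{u}}
    {π' : Y' ⟶ Line X} (hπ' : IsInvertibleIdeal (J.comap π')) (a : LiftedAction π')
    (b : LiftedAction π) (f : Y' ⟶ Y) (hf : π' = f ≫ π) :
    IsEquivariant a.toGmAction b.toGmAction f := by
  -- Equivariance, too, needs proof only at the universal point.
  have h1 : a.act (gmUnit Y') (gmPr Y') ≫ f = b.act (gmUnit Y') (gmPr Y' ≫ f) := by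
    refine hπ.hom_ext_of_act hJ hπ' (gmPr Y') (gmUnit Y') ?_ ?_
    · rw [Category.assoc, ← hf, a.equivariant]
    · rw [b.equivariant, Category.assoc, ← hf]
  intro T l y
  have h2 := congr_arg (gmLift l y ≫ ·) h1
  beta_reduce at h2
  rw [← Category.assoc, ← a.comp_act, ← b.comp_act] at h2
  have h3 := pbUnit_gmLift l y
  rw [pbUnit] at h3
  rwa [h3, gmLift_gmPr_assoc, gmLift_gmPr] at h2

end Action

/-! ### The structure sheaf as a module -/

section UnitSheaf

open Scheme.Modules Opposite

variable {Y Z : Scheme.{u}}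

/-- The structure sheaf as a sheaf of modules. -/
def unitSheaf (Y : Scheme.{u}) : Y.Modules := SheafOfModules.unit Y.ringCatSheaf

/-- The section of the structure sheaf given by a function. -/
def unitSec {U : Y.Opens} (a : Γ(Y, U)) : Γ(unitSheaf Y, U) := a

lemma map_unitSec {U V : Y.Opens} (h : V ≤ U) (a : Γ(Y, U)) :
    (unitSheaf Y).presheaf.map (homOfLE h).op (unitSec a) = unitSec (res h a) := rfl

lemma smul_unitSec {U : Y.Opens} (a b : Γ(Y, U)) : a • unitSec b = unitSec (a * b) := rfl

lemma unitSec_surjective {U : Y.Opens} (s : Γ(unitSheaf Y, U)) : ∃ a, s = unitSec a := ⟨s, rfl⟩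

lemma unitSec_inj {U : Y.Opens} {a b : Γ(Y, U)} : unitSec a = unitSec b ↔ a = b := Iff.rfl

lemma unitSec_zero {U : Y.Opens} : unitSec (0 : Γ(Y, U)) = 0 := rfl

/-- The restriction of sections of a sheaf of modules. -/
abbrev resSec {M : Y.Modules} {U V : Y.Opens} (h : V ≤ U) (s : Γ(M, U)) : Γ(M, V) :=
  M.presheaf.map (homOfLE h).op s

lemma app_resSec {M N : Y.Modules} (φ : M ⟶ N) {U V : Y.Opens} (h : V ≤ U) (s : Γ(M, U)) :
    φ.app V (resSec h s) = resSec h (φ.app U s) := by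
  have := φ.mapPresheaf.naturality (homOfLE h).op
  exact congr($this s)

lemma comp_app_apply {M N K : Y.Modules} (φ : M ⟶ N) (ψ : N ⟶ K) {U : Y.Opens} (s : Γ(M, U)) :
    (φ ≫ ψ).app U s = ψ.app U (φ.app U s) := rfl

lemma resSec_resSec {M : Y.Modules} {U V W : Y.Opens} (h : V ≤ U) (h' : W ≤ V) (s : Γ(M, U)) :
    resSec h' (resSec h s) = resSec (h'.trans h) s := by
  simp only [resSec, ← CategoryTheory.comp_apply, ← Functor.map_comp]
  rfl

lemma app_unitSec {M : Y.Modules} (φ : unitSheaf Y ⟶ M) {U : Y.Opens} (a : Γ(Y, U)) :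
    φ.app U (unitSec a) = a • resSec le_top (φ.app ⊤ (unitSec 1)) := by
  rw [← app_resSec, ← Hom.app_smul, resSec, map_unitSec, smul_unitSec, map_one, mul_one]

lemma unitSheaf_hom_ext {M : Y.Modules} {φ ψ : unitSheaf Y ⟶ M}
    (h : φ.app ⊤ (unitSec 1) = ψ.app ⊤ (unitSec 1)) : φ = ψ := by
  ext U s
  have h1 : ∀ a : Γ(Y, U), φ.app U (unitSec a) = ψ.app U (unitSec a) := fun a ↦ by
    rw [app_unitSec φ a, app_unitSec ψ a, h]
  exact h1 s

lemma exists_hom_of_section {M : Y.Modules} (s : Γ(M, ⊤)) :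
    ∃ φ : unitSheaf Y ⟶ M, φ.app ⊤ (unitSec 1) = s := by
  let t : SheafOfModules.sections M :=
    PresheafOfModules.sectionsMk (fun U ↦ M.presheaf.map (homOfLE (le_top (a := U.unop))).op s) (by
      intro U V f
      exact resSec_resSec (M := M) le_top f.unop.le s)
  refine ⟨(SheafOfModules.unitHomEquiv M).symm t, ?_⟩
  have h := SheafOfModules.unitHomEquiv_apply_coe M ((SheafOfModules.unitHomEquiv M).symm t) (op ⊤)
  rw [Equiv.apply_symm_apply] at h
  refine h.symm.trans ?_
  change M.presheaf.map (𝟙 _) s = s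
  rw [CategoryTheory.Functor.map_id]
  rfl

/-- The morphism from the structure sheaf given by a global section. -/
def homOfSection {M : Y.Modules} (s : Γ(M, ⊤)) : unitSheaf Y ⟶ M := (exists_hom_of_section s).choose

@[simp]
lemma homOfSection_app_one {M : Y.Modules} (s : Γ(M, ⊤)) :
    (homOfSection s).app ⊤ (unitSec 1) = s := (exists_hom_of_section s).choose_spec

/-- Multiplication by a function. -/
def mulHom (f : Γ(Y, ⊤)) : unitSheaf Y ⟶ unitSheaf Y := homOfSection (unitSec f)

lemma mulHom_app (f : Γ(Y, ⊤)) {U : Y.Opens} (a : Γ(Y, U)) :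
    (mulHom f).app U (unitSec a) = unitSec (a * res le_top f) := by
  rw [app_unitSec, mulHom, homOfSection_app_one, resSec, map_unitSec, smul_unitSec]

lemma mulHom_one : mulHom (1 : Γ(Y, ⊤)) = 𝟙 _ := unitSheaf_hom_ext (by simp [mulHom])

lemma mulHom_mul (f g : Γ(Y, ⊤)) : mulHom (f * g) = mulHom f ≫ mulHom g := by
  refine unitSheaf_hom_ext ?_
  rw [comp_app_apply]
  simp only [mulHom, homOfSection_app_one]
  have := mulHom_app g (U := ⊤) f
  rw [mulHom] at this
  rw [this]
  have h : res (le_top (a := (⊤ : Y.Opens))) g = g := by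
    change Y.presheaf.map (𝟙 _) g = g
    rw [Y.presheaf.map_id]; rfl
  rw [h]

lemma eq_mulHom (φ : unitSheaf Y ⟶ unitSheaf Y) : ∃ f, φ = mulHom f := by
  obtain ⟨f, hf⟩ := unitSec_surjective (φ.app ⊤ (unitSec 1))
  exact ⟨f, unitSheaf_hom_ext (by rw [hf, mulHom, homOfSection_app_one])⟩

lemma unitSheaf_comp_comm (φ ψ : unitSheaf Y ⟶ unitSheaf Y) : φ ≫ ψ = ψ ≫ φ := by
  obtain ⟨f, rfl⟩ := eq_mulHom φ
  obtain ⟨g, rfl⟩ := eq_mulHom ψ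
  rw [← mulHom_mul, ← mulHom_mul, mul_comm]

/-- Pulling back functions, as a morphism of sheaves of modules. -/
def unitToPushforward (g : Y ⟶ Z) : unitSheaf Z ⟶ (pushforward g).obj (unitSheaf Y) :=
  SheafOfModules.unitToPushforwardObjUnit g.toRingCatSheafHom

lemma unitToPushforward_app (g : Y ⟶ Z) {U : Z.Opens} (a : Γ(Z, U)) :
    (unitToPushforward g).app U (unitSec a) = unitSec (g.app U a) := rfl

/-- The pullback of the structure sheaf is the structure sheaf. -/
def pullbackUnitHom (g : Y ⟶ Z) : (pullback g).obj (unitSheaf Z) ⟶ unitSheaf Y :=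
  ((pullbackPushforwardAdjunction g).homEquiv _ _).symm (unitToPushforward g)

/-- By Yoneda: morphisms from either module to `M` are given by the image of 1, that is, by a global
section of `M`. -/
instance (g : Y ⟶ Z) : IsIso (pullbackUnitHom g) := by
  rw [isIso_iff_coyoneda_map_bijective]
  intro M
  let e : ((pullback g).obj (unitSheaf Z) ⟶ M) ≃ _ :=
    (pullbackPushforwardAdjunction g).homEquiv (unitSheaf Z) M
  have key : ∀ φ : unitSheaf Y ⟶ M, e (pullbackUnitHom g ≫ φ) =
      unitToPushforward g ≫ (pushforward g).map φ := by
    intro φ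
    rw [Adjunction.homEquiv_naturality_right, pullbackUnitHom, Equiv.apply_symm_apply]
  have key2 : ∀ φ : unitSheaf Y ⟶ M, (e (pullbackUnitHom g ≫ φ)).app ⊤ (unitSec 1) =
      φ.app ⊤ (unitSec 1) := by
    intro φ
    rw [key, comp_app_apply, unitToPushforward_app, map_one]
    rfl
  constructor
  · intro φ ψ h
    refine unitSheaf_hom_ext ?_
    rw [← key2, ← key2]
    exact congr_arg (fun x ↦ (e x).app ⊤ (unitSec 1)) h
  · intro ψ
    let s : Γ((pushforward g).obj M, ⊤) := (e ψ).app ⊤ (unitSec 1)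
    refine ⟨homOfSection (M := M) s, e.injective (unitSheaf_hom_ext ?_)⟩
    exact (key2 _).trans (homOfSection_app_one (M := M) s)

/-- The pullback of the structure sheaf is the structure sheaf. -/
def pullbackUnitIso (g : Y ⟶ Z) : (pullback g).obj (unitSheaf Z) ≅ unitSheaf Y :=
  asIso (pullbackUnitHom g)

lemma pullback_map_mulHom (g : Y ⟶ Z) (f : Γ(Z, ⊤)) :
    (pullback g).map (mulHom f) ≫ (pullbackUnitIso g).hom =
      (pullbackUnitIso g).hom ≫ mulHom (g.appTop f) := by
  change _ ≫ pullbackUnitHom g = pullbackUnitHom g ≫ _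
  apply ((pullbackPushforwardAdjunction g).homEquiv _ _).injective
  rw [Adjunction.homEquiv_naturality_left, Adjunction.homEquiv_naturality_right, pullbackUnitHom,
    Equiv.apply_symm_apply]
  refine unitSheaf_hom_ext ?_
  rw [comp_app_apply, comp_app_apply,
    unitToPushforward_app, mulHom, homOfSection_app_one, unitToPushforward_app, map_one]
  exact (homOfSection_app_one (M := unitSheaf Y) _).symm

end UnitSheaf

/-! ### Morphisms of invertible modules that are locally multiplications -/

section Principal

variable {Y Z T : Scheme.{u}}

/-- The ideal sheaf generated by a function. -/
def principalIdeal (f : Γ(Y, ⊤)) : Y.IdealSheafData := IdealSheafData.ofIdealTop (Ideal.span {f})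

lemma principalIdeal_ideal (f : Γ(Y, ⊤)) (W : Y.affineOpens) :
    (principalIdeal f).ideal W = Ideal.span {res (le_top : W.1 ≤ ⊤) f} := by
  rw [principalIdeal, IdealSheafData.ofIdealTop_ideal, Ideal.map_span, Set.image_singleton]

lemma principalIdeal_comap (f : Γ(Z, ⊤)) (g : Y ⟶ Z) :
    (principalIdeal f).comap g = principalIdeal (g.appTop f) := by
  refine IdealSheafData.ext_of_locally fun y ↦ ?_
  obtain ⟨U, hyU, -⟩ := exists_affine_le (W := (⊤ : Z.Opens)) (y := g y) trivial
  obtain ⟨W, hyW, hWU⟩ := exists_affine_le (W := g ⁻¹ᵁ U.1) hyU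
  refine ⟨W, hyW, ?_⟩
  rw [ideal_comap _ g U W hWU, principalIdeal_ideal, principalIdeal_ideal, Ideal.map_span,
    Set.image_singleton, res_appLE]
  congr 2

lemma principalIdeal_mul (f g : Γ(Y, ⊤)) :
    principalIdeal (f * g) = principalIdeal f * principalIdeal g := by
  ext W : 2
  change _ = (principalIdeal f).ideal W * (principalIdeal g).ideal W
  rw [principalIdeal_ideal, principalIdeal_ideal, principalIdeal_ideal,
    map_mul, Ideal.span_singleton_mul_span_singleton]

lemma principalIdeal_one : principalIdeal (1 : Γ(Y, ⊤)) = ⊤ := by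
  ext W : 2
  rw [principalIdeal_ideal, map_one]
  simp

lemma IsRegularSection.appTop {f : Γ(Z, ⊤)} (hf : IsRegularSection f) (g : Y ⟶ Z) [Flat g] :
    IsRegularSection (g.appTop f) := by
  refine isRegularSection_of_locally fun y _ ↦ ?_
  obtain ⟨U, hyU, -⟩ := exists_affine_le (W := (⊤ : Z.Opens)) (y := g y) trivial
  obtain ⟨W, hyW, hWU⟩ := exists_affine_le (W := g ⁻¹ᵁ U.1) hyU
  refine ⟨W, le_top, hyW, ?_⟩
  have h := appLE_mem_nonZeroDivisors g U W hWU (hf U.1 le_top)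
  rw [res_appLE] at h
  exact h

lemma IsRegularSection.mul {f g : Γ(Y, ⊤)} (hf : IsRegularSection f) (hg : IsRegularSection g) :
    IsRegularSection (f * g) := fun V h ↦ by
  rw [map_mul]; exact mul_mem_nonZeroDivisors.mpr ⟨hf V h, hg V h⟩

lemma isRegularSection_of_isInvertibleIdeal {f : Γ(Y, ⊤)}
    (h : IsInvertibleIdeal (principalIdeal f)) : IsRegularSection f := by
  refine isRegularSection_of_locally fun y _ ↦ ?_
  obtain ⟨U, hyU, -⟩ := exists_affine_le (W := (⊤ : Y.Opens)) (y := y) trivial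
  have := isRegularSection_of_ideal_eq_span h (principalIdeal_ideal f U) U.1 le_rfl
  rw [res_res] at this
  exact ⟨U, le_top, hyU, this⟩

lemma IsRegularSection.dvd_of_principalIdeal_le {f g : Γ(Y, ⊤)} (hf : IsRegularSection f)
    (h : principalIdeal g ≤ principalIdeal f) : f ∣ g := by
  refine hf.dvd_of_locally fun y _ ↦ ?_
  obtain ⟨U, hyU, -⟩ := exists_affine_le (W := (⊤ : Y.Opens)) (y := y) trivial
  refine ⟨U.1, le_top, hyU, ?_⟩
  have h1 := h U
  rw [principalIdeal_ideal, principalIdeal_ideal] at h1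
  exact Ideal.span_singleton_le_span_singleton.mp h1

end Principal

section IsMul

open Scheme.Modules Opposite

variable {Y Z T : Scheme.{u}}

/-- A morphism of sheaves of modules isomorphic to the multiplication by `f` on the structure
sheaf. -/
def IsMul {M N : Y.Modules} (n : N ⟶ M) (f : Γ(Y, ⊤)) : Prop :=
  ∃ (α : unitSheaf Y ≅ N) (β : unitSheaf Y ≅ M), α.hom ≫ n = mulHom f ≫ β.hom

variable {M N K : Y.Modules} {n : N ⟶ M} {f : Γ(Y, ⊤)}

lemma IsMul.of_iso (h : IsMul n f) {M' N' : Y.Modules} {n' : N' ⟶ M'} (a : N ≅ N') (b : M ≅ M')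
    (hab : a.hom ≫ n' = n ≫ b.hom) : IsMul n' f := by
  obtain ⟨α, β, hαβ⟩ := h
  refine ⟨α ≪≫ a, β ≪≫ b, ?_⟩
  simp only [Iso.trans_hom, Category.assoc, hab]
  rw [← Category.assoc, hαβ, Category.assoc]

lemma IsMul.of_natIso {M N : Z.Modules} {n : N ⟶ M} {F G : Z.Modules ⥤ Y.Modules}
    (h : IsMul (F.map n) f) (e : F ≅ G) : IsMul (G.map n) f :=
  h.of_iso (e.app _) (e.app _) (e.hom.naturality n).symm

lemma IsMul.pullback (h : IsMul n f) (g : T ⟶ Y) :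
    IsMul ((Modules.pullback g).map n) (g.appTop f) := by
  obtain ⟨α, β, hαβ⟩ := h
  refine ⟨(pullbackUnitIso g).symm ≪≫ (Modules.pullback g).mapIso α,
    (pullbackUnitIso g).symm ≪≫ (Modules.pullback g).mapIso β, ?_⟩
  simp only [Iso.trans_hom, Category.assoc, Iso.symm_hom, Functor.mapIso_hom]
  rw [Iso.inv_comp_eq, ← Functor.map_comp, hαβ, Functor.map_comp, ← Category.assoc (mulHom _),
    ← Category.assoc (pullbackUnitIso g).hom, ← Category.assoc (pullbackUnitIso g).hom,
    ← pullback_map_mulHom, Category.assoc, Category.assoc, Iso.hom_inv_id_assoc]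

/-- The two trivialisations of the middle module differ by an endomorphism of the structure sheaf,
which commutes with multiplication by `g`. -/
lemma IsMul.comp {m : M ⟶ K} {g : Γ(Y, ⊤)} (hn : IsMul n f) (hm : IsMul m g) :
    IsMul (n ≫ m) (f * g) := by
  obtain ⟨α, β, h⟩ := hn
  obtain ⟨α', γ, h'⟩ := hm
  refine ⟨α, (β ≪≫ α'.symm) ≪≫ γ, ?_⟩
  rw [← Category.assoc, h, mulHom_mul, Category.assoc, Category.assoc, Iso.trans_hom,
    ← Category.assoc (mulHom g), unitSheaf_comp_comm (mulHom g)]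
  simp [← h']

lemma IsMul.exists_comp_eq {N' : Y.Modules} {n' : N' ⟶ M} {f' : Γ(Y, ⊤)} (h : IsMul n f)
    (h' : IsMul n' f') (hf : f' ∣ f) : ∃ x, x ≫ n' = n := by
  obtain ⟨α, β, h⟩ := h
  obtain ⟨α', β', h'⟩ := h'
  obtain ⟨a, rfl⟩ := hf
  refine ⟨α.inv ≫ mulHom a ≫ (β ≪≫ β'.symm).hom ≫ α'.hom, ?_⟩
  simp only [Category.assoc, Iso.inv_comp_eq, h, h']
  rw [mul_comm, mulHom_mul, ← Category.assoc (Iso.hom _), unitSheaf_comp_comm (Iso.hom _)]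
  simp

lemma isMul_id (β : unitSheaf Y ≅ M) : IsMul (𝟙 M) 1 := ⟨β, β, by simp [mulHom_one]⟩

lemma IsMul.mono (h : IsMul n f) (hf : IsRegularSection f) : Mono n := by
  obtain ⟨α, β, h⟩ := h
  have : Mono (mulHom f) := by
    refine Preadditive.mono_of_cancel_zero _ fun {P} g hg ↦ ?_
    ext U s
    have h1 := congr_arg (fun φ ↦ φ.app U s) hg
    beta_reduce at h1
    rw [comp_app_apply] at h1
    have h2 : ∀ a : Γ(Y, U), (mulHom f).app U (unitSec a) = 0 → a = 0 := fun a ha ↦ by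
      rw [mulHom_app, ← unitSec_zero, unitSec_inj] at ha
      exact mem_nonZeroDivisors_iff_right.mp (hf U le_top) a ha
    exact h2 _ h1
  have h2 : n = α.inv ≫ mulHom f ≫ β.hom := by rw [← h, Iso.inv_hom_id_assoc]
  rw [h2]
  infer_instance

lemma eq_zero_of_locally {φ : N ⟶ M} (h : ∀ y : Y, ∃ (T : Scheme.{u}) (j : T ⟶ Y)
    (_ : IsOpenImmersion j), y ∈ Set.range j ∧ (Modules.pullback j).map φ = 0) : φ = 0 := by
  ext U s
  choose T j hj hy h using h
  refine TopCat.Sheaf.eq_of_locally_eq' ⟨M.presheaf, M.isSheaf⟩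
    (fun y : Y ↦ j y ''ᵁ (j y) ⁻¹ᵁ U) U (fun y ↦ homOfLE (Scheme.Hom.image_preimage_le _ _)) ?_ _ _
    fun y ↦ ?_
  · intro y hyU
    obtain ⟨t, ht⟩ := hy y
    exact TopologicalSpace.Opens.mem_iSup.mpr ⟨y, t, by simpa [ht] using hyU, ht⟩
  · have h1 : (restrictFunctor (j y)).map φ = 0 := by
      have h2 := (restrictFunctorIsoPullback (j y)).hom.naturality φ
      rw [h y, Limits.comp_zero] at h2
      rw [← cancel_mono ((restrictFunctorIsoPullback (j y)).hom.app M), h2, Limits.zero_comp]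
    have h3 := app_resSec φ (Scheme.Hom.image_preimage_le (j y) U) s
    refine h3.symm.trans ?_
    have h4 := congr_arg (fun ψ ↦ (Hom.app ψ ((j y) ⁻¹ᵁ U)).hom) h1
    exact (DFunLike.congr_fun h4 (resSec (Scheme.Hom.image_preimage_le (j y) U) s)).trans
      (map_zero (M.presheaf.map _).hom).symm

/-- Allowing arbitrary open immersions in place of open subsets permits common refinements and base
changes by fibre products. -/
lemma isLineBundle_iff : IsLineBundle M ↔ ∀ y : Y, ∃ (T : Scheme.{u}) (j : T ⟶ Y)
    (_ : IsOpenImmersion j), y ∈ Set.range j ∧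
      Nonempty (unitSheaf T ≅ (Modules.pullback j).obj M) := by
  refine forall_congr' fun y ↦ ⟨?_, ?_⟩
  · rintro ⟨U, hy, ⟨e⟩⟩
    exact ⟨U, U.ι, inferInstance, by simpa, ⟨e.symm ≪≫ (restrictFunctorIsoPullback U.ι).app M⟩⟩
  · rintro ⟨T, j, hj, hy, ⟨e⟩⟩
    refine ⟨j.opensRange, hy, ⟨(restrictFunctorIsoPullback _).app M ≪≫
      (pullbackCongr (show j.opensRange.ι = j.isoOpensRange.inv ≫ j by simp)).app M ≪≫
      ((pullbackComp _ _).app M).symm ≪≫ (Modules.pullback _).mapIso e.symm ≪≫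
      pullbackUnitIso _⟩⟩

end IsMul

/-! ### Twists of line bundles -/

section IsTwist

open Scheme.Modules Opposite

variable {Y Z T : Scheme.{u}} {M N K : Y.Modules} {J J' : Y.IdealSheafData} {n : N ⟶ M}

/-- After pullback along `j`, the morphism `n` is isomorphic to the multiplication by a regular
generator `f` of the ideal sheaf `J`. -/
def IsTwistAt (J : Y.IdealSheafData) (n : N ⟶ M) (j : T ⟶ Y) (f : Γ(T, ⊤)) : Prop :=
  IsRegularSection f ∧ J.comap j = principalIdeal f ∧ IsMul ((Modules.pullback j).map n) f

/-- The morphism `n` is locally isomorphic to the multiplication by a regular generator of the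
ideal sheaf `J`: up to isomorphism it is the inclusion of `M(-D)` in a line bundle `M`. -/
def IsTwist (J : Y.IdealSheafData) (n : N ⟶ M) : Prop :=
  ∀ y : Y, ∃ (T : Scheme.{u}) (j : T ⟶ Y) (_ : IsOpenImmersion j) (f : Γ(T, ⊤)),
    y ∈ Set.range j ∧ IsTwistAt J n j f

lemma isMul_pullback_comp {T' : Scheme.{u}} (g : T' ⟶ T) (j : T ⟶ Y) {f : Γ(T', ⊤)} :
    IsMul ((Modules.pullback g).map ((Modules.pullback j).map n)) f ↔
      IsMul ((Modules.pullback (g ≫ j)).map n) f :=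
  ⟨fun h ↦ IsMul.of_natIso (F := Modules.pullback j ⋙ Modules.pullback g) h (pullbackComp g j),
    fun h ↦ IsMul.of_natIso (G := Modules.pullback j ⋙ Modules.pullback g) h
      (pullbackComp g j).symm⟩

lemma IsTwistAt.comp_flat {j : T ⟶ Y} {f : Γ(T, ⊤)} (h : IsTwistAt J n j f) {T' : Scheme.{u}}
    (g : T' ⟶ T) [Flat g] : IsTwistAt J n (g ≫ j) (g.appTop f) :=
  ⟨h.1.appTop g, by rw [IdealSheafData.comap_comp, h.2.1, principalIdeal_comap],
    (isMul_pullback_comp g j).mp (h.2.2.pullback g)⟩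

lemma IsTwist.exists_common (h : IsTwist J n) {N' M' : Y.Modules} {n' : N' ⟶ M'}
    (h' : IsTwist J' n') (y : Y) : ∃ (T : Scheme.{u}) (j : T ⟶ Y) (_ : IsOpenImmersion j)
      (f f' : Γ(T, ⊤)), y ∈ Set.range j ∧ IsTwistAt J n j f ∧ IsTwistAt J' n' j f' := by
  obtain ⟨T, j, hj, f, hy, h⟩ := h y
  obtain ⟨T', j', hj', f', hy', h'⟩ := h' y
  refine ⟨Limits.pullback j j', Limits.pullback.fst j j' ≫ j, inferInstance, _,
    (Limits.pullback.snd j j').appTop f', ?_, h.comp_flat _, ?_⟩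
  · rw [IsOpenImmersion.range_pullback_to_base_of_left]
    exact ⟨hy, hy'⟩
  · rw [Limits.pullback.condition]
    exact h'.comp_flat _

lemma IsTwist.comp (hn : IsTwist J n) {m : M ⟶ K} (hm : IsTwist J' m) :
    IsTwist (J * J') (n ≫ m) := by
  intro y
  obtain ⟨T, j, hj, f, f', hy, h, h'⟩ := hn.exists_common hm y
  refine ⟨T, j, hj, f * f', hy, h.1.mul h'.1, ?_, ?_⟩
  · rw [comap_mul, h.2.1, h'.2.1, principalIdeal_mul]
  · rw [Functor.map_comp]
    exact h.2.2.comp h'.2.2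

lemma IsTwist.of_iso (h : IsTwist J n) {M' N' : Y.Modules} {n' : N' ⟶ M'} (a : N ≅ N') (b : M ≅ M')
    (hab : a.hom ≫ n' = n ≫ b.hom) : IsTwist J n' := by
  intro y
  obtain ⟨T, j, hj, f, hy, h1, h2, h3⟩ := h y
  refine ⟨T, j, hj, f, hy, h1, h2, h3.of_iso ((Modules.pullback j).mapIso a)
    ((Modules.pullback j).mapIso b) ?_⟩
  rw [Functor.mapIso_hom, Functor.mapIso_hom, ← Functor.map_comp, hab, Functor.map_comp]

lemma isTwist_id (hM : IsLineBundle M) : IsTwist ⊤ (𝟙 M) := by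
  intro y
  obtain ⟨T, j, hj, hy, ⟨e⟩⟩ := isLineBundle_iff.mp hM y
  refine ⟨T, j, hj, 1, hy, fun V h ↦ by rw [map_one]; exact one_mem _, ?_, ?_⟩
  · rw [principalIdeal_one]
    simp
  · rw [CategoryTheory.Functor.map_id]
    exact isMul_id e

/-- Everything except the regularity of the local generator is stable under pullback; regularity is
exactly what invertibility of the pulled-back ideal restores. -/
lemma IsTwist.pullback (h : IsTwist J n) (g : Z ⟶ Y) (hJ : IsInvertibleIdeal (J.comap g)) :
    IsTwist (J.comap g) ((Modules.pullback g).map n) := by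
  intro z
  obtain ⟨T, j, hj, f, hy, h1, h2, h3⟩ := h (g z)
  have hJ' : (J.comap g).comap (Limits.pullback.fst g j) =
      principalIdeal ((Limits.pullback.snd g j).appTop f) := by
    rw [← IdealSheafData.comap_comp, Limits.pullback.condition, IdealSheafData.comap_comp, h2,
      principalIdeal_comap]
  refine ⟨Limits.pullback g j, Limits.pullback.fst g j, inferInstance,
    (Limits.pullback.snd g j).appTop f, ?_, ?_, hJ', ?_⟩
  · rw [IsOpenImmersion.range_pullbackFst]
    exact hy
  · refine isRegularSection_of_isInvertibleIdeal ?_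
    rw [← hJ']
    exact hJ.comap _
  · rw [isMul_pullback_comp, Limits.pullback.condition, ← isMul_pullback_comp]
    exact h3.pullback _

lemma IsTwist.isLineBundle (h : IsTwist J n) : IsLineBundle N := by
  rw [isLineBundle_iff]
  intro y
  obtain ⟨T, j, hj, f, hy, h1, h2, α, -⟩ := h y
  exact ⟨T, j, hj, hy, ⟨α⟩⟩

lemma IsLineBundle.pullback (hM : IsLineBundle M) (g : Z ⟶ Y) :
    IsLineBundle ((Modules.pullback g).obj M) := by
  have h := (isTwist_id hM).pullback g (by simpa using isInvertibleIdeal_top)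
  exact h.isLineBundle

lemma IsTwist.mono (h : IsTwist J n) : Mono n := by
  refine Preadditive.mono_of_cancel_zero _ fun {P} g hg ↦ eq_zero_of_locally fun y ↦ ?_
  obtain ⟨T, j, hj, f, hy, h1, h2, h3⟩ := h y
  refine ⟨T, j, hj, hy, ?_⟩
  have := h3.mono h1
  rw [← cancel_mono ((Modules.pullback j).map n), ← Functor.map_comp, hg, Functor.map_zero,
    Limits.zero_comp]

/-- The obstruction is the composite of `n` with the cokernel of `n'`. It vanishes locally, where
both maps are multiplications by generators of the same ideal, hence globally; then `n` lifts
through the monomorphism `n'`. -/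
lemma IsTwist.exists_comp_eq (h : IsTwist J n) {N' : Y.Modules} {n' : N' ⟶ M}
    (h' : IsTwist J n') : ∃ x : N ⟶ N', x ≫ n' = n := by
  have := h'.mono
  have h0 : n ≫ Limits.cokernel.π n' = 0 := by
    refine eq_zero_of_locally fun y ↦ ?_
    obtain ⟨T, j, hj, f, f', hy, h1, h2⟩ := h.exists_common h' y
    refine ⟨T, j, hj, hy, ?_⟩
    obtain ⟨x, hx⟩ := h1.2.2.exists_comp_eq h2.2.2
      (h2.1.dvd_of_principalIdeal_le (by rw [← h1.2.1, ← h2.2.1]))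
    rw [Functor.map_comp, ← hx, Category.assoc, ← Functor.map_comp, Limits.cokernel.condition,
      Functor.map_zero, Limits.comp_zero]
  exact ⟨Abelian.monoLift n' n h0, Abelian.monoLift_comp _ _ _⟩

lemma IsTwist.exists_iso (h : IsTwist J n) {N' : Y.Modules} {n' : N' ⟶ M}
    (h' : IsTwist J n') : ∃ e : N ≅ N', e.hom ≫ n' = n := by
  obtain ⟨x, hx⟩ := h.exists_comp_eq h'
  obtain ⟨x', hx'⟩ := h'.exists_comp_eq h
  have := h.mono
  have := h'.mono
  exact ⟨⟨x, x', by rw [← cancel_mono n, Category.assoc, hx', hx, Category.id_comp],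
    by rw [← cancel_mono n', Category.assoc, hx, hx', Category.id_comp]⟩, hx⟩

end IsTwist

/-! ### The twist of a line bundle by an invertible ideal sheaf -/

section Twist

open Scheme.Modules Opposite

variable {Y D T : Scheme.{u}} {M N P : Y.Modules}

/-- Sections over an open subset. -/
def sectionsFunctor (U : Y.Opens) : Y.Modules ⥤ Ab := toPresheaf Y ⋙ (CategoryTheory.evaluation _ _).obj (op U)

instance (U : Y.Opens) : Limits.PreservesLimits (sectionsFunctor U) := by
  have : Limits.PreservesLimits ((CategoryTheory.evaluation Y.Opensᵒᵖ Ab.{u}).obj (op U)) :=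
    inferInstance
  exact Limits.comp_preservesLimits (toPresheaf Y) _

instance (U : Y.Opens) : (sectionsFunctor U).PreservesZeroMorphisms where
  map_zero _ _ := rfl

lemma app_injective_of_mono (n : N ⟶ M) [Mono n] (U : Y.Opens) :
    Function.Injective (n.app U) :=
  (AddCommGrpCat.mono_iff_injective ((sectionsFunctor U).map n)).mp inferInstance

lemma exists_kernel_section (η : M ⟶ P) {U : Y.Opens} (s : Γ(M, U)) (hs : η.app U s = 0) :
    ∃ t : Γ(Limits.kernel η, U), (Limits.kernel.ι η).app U t = s := by
  let S := ShortComplex.mk (Limits.kernel.ι η) η (Limits.kernel.condition η)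
  have hS : S.Exact := ShortComplex.exact_kernel η
  have h := hS.map_of_mono_of_preservesKernel (sectionsFunctor U)
    (inferInstanceAs (Mono (Limits.kernel.ι η))) inferInstance
  exact (ShortComplex.ab_exact_iff _).mp h s hs

/-- A section that vanishes after pullback is killed by all morphisms to a pushforward. -/
lemma app_eq_zero_of_unit {i : D ⟶ Y} {U : Y.Opens} {s : Γ(M, U)}
    (hs : ((pullbackPushforwardAdjunction i).unit.app M).app U s = 0) {Q : D.Modules}
    (φ : M ⟶ (pushforward i).obj Q) : φ.app U s = 0 := by
  have h : φ = (pullbackPushforwardAdjunction i).unit.app M ≫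
      (pushforward i).map (((pullbackPushforwardAdjunction i).homEquiv M Q).symm φ) := by
    refine Eq.trans ?_ (Adjunction.homEquiv_unit _ _ _ _)
    rw [Equiv.apply_symm_apply]
  rw [h, comp_app_apply, hs, map_zero]

/-- The morphism from a module, trivialised on an open subset, to the pushforward of functions on
the preimage of this subset in `D`. -/
def trivialisedRestriction {i : D ⟶ Y} {j : T ⟶ Y} [IsOpenImmersion j]
    (e : unitSheaf T ≅ (restrictFunctor j).obj M) {E : Scheme.{u}} {a : E ⟶ T} {k : E ⟶ D}
    (h : a ≫ j = k ≫ i) : M ⟶ (pushforward i).obj ((pushforward k).obj (unitSheaf E)) :=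
  (restrictAdjunction j).unit.app M ≫ (pushforward j).map e.inv ≫
    (pushforward j).map (unitToPushforward a) ≫ (pushforwardComp a j).hom.app _ ≫
      (pushforwardCongr h).hom.app _ ≫ (pushforwardComp k i).inv.app _

/-- The unit of the adjunction is universal among maps to pushforwards from `D`, so its kernel can
be bounded by any single such map. Here the test map is restriction of functions in a
trivialisation. -/
lemma app_eq_zero_of_restriction {i : D ⟶ Y} {j : T ⟶ Y} [IsOpenImmersion j]
    (e : unitSheaf T ≅ (restrictFunctor j).obj M) {E : Scheme.{u}} {a : E ⟶ T} {k : E ⟶ D}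
    (h : a ≫ j = k ≫ i) {W : T.Opens} (g : Γ(T, W))
    (hs : ((pullbackPushforwardAdjunction i).unit.app M).app (j ''ᵁ W)
      (e.hom.app W (unitSec g)) = 0) : a.app W g = 0 := by
  have h1 := app_eq_zero_of_unit hs (trivialisedRestriction e h)
  have hW : j ⁻¹ᵁ j ''ᵁ W = W := j.preimage_image_eq W
  have h2 : e.inv.app (j ⁻¹ᵁ j ''ᵁ W)
      (resSec (M := (restrictFunctor j).obj M) hW.le (e.hom.app W (unitSec g))) =
      unitSec (res hW.le g) := by
    rw [app_resSec, ← comp_app_apply, e.hom_inv_id]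
    rfl
  have h3 : (k ≫ i) ⁻¹ᵁ j ''ᵁ W ≤ a ⁻¹ᵁ j ⁻¹ᵁ j ''ᵁ W := by
    rw [← Scheme.Hom.comp_preimage, h]
  have h4 : res h3 (a.app _ (res hW.le g)) = 0 := by
    refine Eq.trans ?_ h1
    refine (congr_arg (fun x ↦ resSec (M := unitSheaf E) h3 ((unitToPushforward a).app _ x)) h2).symm
  have h5 : a ⁻¹ᵁ W ≤ (k ≫ i) ⁻¹ᵁ j ''ᵁ W := by
    rw [← h, Scheme.Hom.comp_preimage, hW]
  have h6 := congr_arg (res h5) h4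
  rw [map_zero] at h6
  refine Eq.trans ?_ h6
  rw [Scheme.Hom.app_eq_appLE, Scheme.Hom.app_eq_appLE, ← res_appLE, appLE_res, appLE_res]

lemma app_eq_zero_of_mem_ideal (J : Y.IdealSheafData) (V : Y.affineOpens) {f : Γ(Y, V.1)}
    (hf : f ∈ J.ideal V) : J.subschemeι.app V.1 f = 0 := by
  rw [← J.ker_subschemeι, Scheme.Hom.ker_apply] at hf
  exact hf

/-- The target is a pushforward from the closed subscheme, on which functions in `J` act as zero. -/
lemma twist_unit_smul_eq_zero (J : Y.IdealSheafData) (V : Y.affineOpens) {f : Γ(Y, V.1)}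
    (hf : f ∈ J.ideal V) (s : Γ(M, V.1)) :
    ((pullbackPushforwardAdjunction J.subschemeι).unit.app M).app V.1 (f • s) = 0 := by
  rw [Modules.Hom.app_smul]
  have h : ∀ (Q : J.subscheme.Modules) (t : Γ((pushforward J.subschemeι).obj Q, V.1)),
      f • t = 0 := by
    intro Q t
    have h1 : J.subschemeι.app V.1 f • (show Γ(Q, J.subschemeι ⁻¹ᵁ V.1) from t) = 0 := by
      rw [app_eq_zero_of_mem_ideal J V hf, zero_smul]
    exact h1
  exact h _ _

instance (J : Y.IdealSheafData) (M : Y.Modules) : Mono (twistι J M) :=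
  inferInstanceAs (Mono (Limits.kernel.ι _))

/-- In the trivialisation the section becomes a function vanishing on the base change of the closed
subscheme, whose ideal is (f). Local divisibility by `f` globalises because `f` is regular. -/
lemma dvd_of_unit_eq_zero {J : Y.IdealSheafData} {j : T ⟶ Y} [IsOpenImmersion j] {f : Γ(T, ⊤)}
    (hf : IsRegularSection f) (hJ : J.comap j = principalIdeal f)
    (e : unitSheaf T ≅ (restrictFunctor j).obj M) {W : T.Opens} (g : Γ(T, W))
    (hs : ((pullbackPushforwardAdjunction J.subschemeι).unit.app M).app (j ''ᵁ W)
      (e.hom.app W (unitSec g)) = 0) : res le_top f ∣ g := by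
  have h := app_eq_zero_of_restriction e (Limits.pullback.condition (f := j) (g := J.subschemeι))
    g hs
  refine (hf.res le_top).dvd_of_locally fun y hy ↦ ?_
  obtain ⟨A, hyA, hA⟩ := exists_affine_le hy
  refine ⟨A.1, hA, hyA, ?_⟩
  have h1 : res hA g ∈ (J.comap j).ideal A := by
    rw [IdealSheafData.comap, Scheme.Hom.ker_apply, RingHom.mem_ker]
    have h2 := congr_arg (res ((Limits.pullback.fst j J.subschemeι).preimage_mono hA)) h
    rw [map_zero, Scheme.Hom.app_eq_appLE, appLE_res] at h2
    rw [Scheme.Hom.app_eq_appLE, res_appLE]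
    exact h2
  rw [hJ, principalIdeal_ideal, Ideal.mem_span_singleton] at h1
  rwa [res_res]

/-- The section `f` times the trivialising one dies on the closed subscheme, so it lifts to the
kernel and defines `α`. On sections, `α` is injective since `f` is regular and surjective by
`dvd_of_unit_eq_zero`. -/
lemma isMul_restrict_twistι {J : Y.IdealSheafData} {j : T ⟶ Y} [IsOpenImmersion j] {f : Γ(T, ⊤)}
    (hf : IsRegularSection f) (hJ : J.comap j = principalIdeal f)
    (hT : IsAffineOpen (j ''ᵁ ⊤)) (hfJ : (j.appIso ⊤).inv f ∈ J.ideal ⟨j ''ᵁ ⊤, hT⟩)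
    (e : unitSheaf T ≅ (restrictFunctor j).obj M) :
    IsMul ((restrictFunctor j).map (twistι J M)) f := by
  obtain ⟨t, ht⟩ := exists_kernel_section
    ((pullbackPushforwardAdjunction J.subschemeι).unit.app M) (U := j ''ᵁ ⊤) _
      (twist_unit_smul_eq_zero J ⟨j ''ᵁ ⊤, hT⟩ hfJ (e.hom.app ⊤ (unitSec 1)))
  let α : unitSheaf T ⟶ (restrictFunctor j).obj (twist J M) :=
    homOfSection (M := (restrictFunctor j).obj (twist J M)) t
  have hα : α ≫ (restrictFunctor j).map (twistι J M) = mulHom f ≫ e.hom := by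
    refine unitSheaf_hom_ext ?_
    have h0 : α.app ⊤ (unitSec 1) = t :=
      homOfSection_app_one (M := (restrictFunctor j).obj (twist J M)) t
    rw [comp_app_apply, h0, comp_app_apply]
    have h1 : (mulHom f).app ⊤ (unitSec 1) = f • unitSec 1 := by
      rw [mulHom, homOfSection_app_one, smul_unitSec, mul_one]
    rw [h1, Modules.Hom.app_smul]
    exact ht
  have hinj : ∀ W, Function.Injective (((restrictFunctor j).map (twistι J M)).app W) :=
    fun W ↦ app_injective_of_mono (twistι J M) (j ''ᵁ W)
  have hα' : ∀ (W : T.Opens) (a : Γ(T, W)), ((restrictFunctor j).map (twistι J M)).app W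
      (α.app W (unitSec a)) = e.hom.app W (unitSec (a * res le_top f)) := fun W a ↦ by
    rw [← comp_app_apply, hα, comp_app_apply, mulHom_app]
  have heinj : ∀ W, Function.Bijective (e.hom.app W) := fun W ↦
    ConcreteCategory.bijective_of_isIso (e.hom.app W)
  have : IsIso α := by
    rw [Modules.Hom.isIso_iff_isIso_app]
    intro W
    rw [ConcreteCategory.isIso_iff_bijective]
    constructor
    · have h1 : ∀ a b : Γ(T, W), α.app W (unitSec a) = α.app W (unitSec b) → a = b := by
        intro a b hab
        have h2 := congr_arg (((restrictFunctor j).map (twistι J M)).app W) hab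
        rw [hα', hα'] at h2
        exact (mul_cancel_right_mem_nonZeroDivisors (hf W le_top)).mp ((heinj W).1 h2)
      exact h1
    · intro x
      obtain ⟨s, hs⟩ := (heinj W).2 (((restrictFunctor j).map (twistι J M)).app W x)
      have h1 : ∀ g : Γ(T, W), e.hom.app W (unitSec g) =
          ((restrictFunctor j).map (twistι J M)).app W x → ∃ a, α.app W (unitSec a) = x := by
        intro g hg
        have h2 : ((pullbackPushforwardAdjunction J.subschemeι).unit.app M).app (j ''ᵁ W)
            (e.hom.app W (unitSec g)) = 0 := by
          rw [hg]
          have h3 := congr_arg (fun φ ↦ (Modules.Hom.app φ (j ''ᵁ W)).hom) (Limits.kernel.condition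
            ((pullbackPushforwardAdjunction J.subschemeι).unit.app M))
          exact DFunLike.congr_fun h3 x
        obtain ⟨a, ha⟩ := dvd_of_unit_eq_zero hf hJ e g h2
        refine ⟨a, hinj W ?_⟩
        rw [hα', ← hg, ha, mul_comm]
      exact h1 s hs
  exact ⟨asIso α, e, hα⟩

/-- The inclusion of `M(-D)` in a line bundle `M` is locally the multiplication by a generator of
the invertible ideal sheaf of `D`. -/
lemma isTwist_twistι {J : Y.IdealSheafData} (hM : IsLineBundle M) (hJ : IsInvertibleIdeal J) :
    IsTwist J (twistι J M) := by
  intro y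
  obtain ⟨U, hyU, ⟨e⟩⟩ := hM y
  obtain ⟨V, hyV, hVU, f, hf, hJf⟩ := hJ.exists_le hyU
  have : IsAffine V.1.toScheme := V.2
  let j : V.1.toScheme ⟶ Y := V.1.ι
  have hT : IsAffineOpen (j ''ᵁ ⊤) := (isAffineOpen_top _).image_of_isOpenImmersion _
  have hle : j ''ᵁ ⊤ ≤ V.1 := V.1.ι_image_top.le
  let f₁ : Γ(Y, j ''ᵁ ⊤) := res hle f
  have hf₁ : J.ideal ⟨j ''ᵁ ⊤, hT⟩ = Ideal.span {f₁} := ideal_of_le hle hJf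
  let f' : Γ(V.1, ⊤) := (j.appIso ⊤).hom f₁
  have hf' : (j.appIso ⊤).inv f' = f₁ := by
    change ((j.appIso ⊤).hom ≫ (j.appIso ⊤).inv) f₁ = f₁
    rw [Iso.hom_inv_id]; rfl
  have hJ' : J.comap j = principalIdeal f' := by
    refine IdealSheafData.ext_of_isAffine ?_
    rw [ideal_comap J j ⟨j ''ᵁ ⊤, hT⟩ ⟨⊤, isAffineOpen_top _⟩ (j.preimage_image_eq ⊤).ge, hf₁,
      principalIdeal_ideal, Ideal.map_span, Set.image_singleton]
    have h1 : (j.appLE (j ''ᵁ ⊤) ⊤ (j.preimage_image_eq ⊤).ge).hom f₁ = res le_top f' := by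
      have h2 : ∀ x : Γ(V.1, ⊤), res le_top x = x := fun x ↦ by
        change V.1.toScheme.presheaf.map (𝟙 _) x = x
        rw [CategoryTheory.Functor.map_id]; rfl
      rw [h2, ← Scheme.Hom.appIso_hom']
    rw [h1]
  have hreg : IsRegularSection f' := by
    refine isRegularSection_of_isInvertibleIdeal ?_
    rw [← hJ']
    exact hJ.comap _
  let e' : unitSheaf V.1 ≅ (restrictFunctor j).obj M :=
    (pullbackUnitIso (Y.homOfLE hVU)).symm ≪≫ (Modules.pullback _).mapIso
      (e.symm ≪≫ (restrictFunctorIsoPullback U.ι).app M) ≪≫ (pullbackComp _ _).app M ≪≫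
        (pullbackCongr (by simp [j])).app M ≪≫ ((restrictFunctorIsoPullback j).app M).symm
  refine ⟨V.1, j, inferInstance, f', by simpa [j] using hyV, hreg, hJ', ?_⟩
  refine IsMul.of_natIso (isMul_restrict_twistι hreg hJ' hT ?_ e') (restrictFunctorIsoPullback j)
  rw [hf', hf₁]
  exact Ideal.mem_span_singleton_self f₁

end Twist

/-! ### Base change of morphisms between pullbacks -/

section BaseChange

open Scheme.Modules Opposite

variable {T T' T'' Y Y₁ Y₂ Y₃ : Scheme.{u}}

/-- The isomorphism `w^* z^* N ≅ x^* N` for `x = w ≫ z`. -/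
def pbComp {w : T' ⟶ T} {z : T ⟶ Y} {x : T' ⟶ Y} (h : w ≫ z = x) (N : Y.Modules) :
    (pullback w).obj ((pullback z).obj N) ≅ (pullback x).obj N :=
  (pullbackComp w z).app N ≪≫ (pullbackCongr h).app N

lemma pbComp_rfl (w : T' ⟶ T) (z : T ⟶ Y) (N : Y.Modules) :
    pbComp (rfl : w ≫ z = w ≫ z) N = (pullbackComp w z).app N := by
  ext1
  exact Category.comp_id _

lemma pbComp_naturality {w : T' ⟶ T} {z : T ⟶ Y} {x : T' ⟶ Y} (h : w ≫ z = x) {N M : Y.Modules}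
    (n : N ⟶ M) : (pullback w).map ((pullback z).map n) ≫ (pbComp h M).hom =
      (pbComp h N).hom ≫ (pullback x).map n := by
  subst h
  rw [pbComp_rfl, pbComp_rfl]
  exact (pullbackComp w z).hom.naturality n

lemma pbComp_naturality_assoc {w : T' ⟶ T} {z : T ⟶ Y} {x : T' ⟶ Y} (h : w ≫ z = x)
    {N M : Y.Modules} (n : N ⟶ M) {P : T'.Modules} (k : (pullback x).obj M ⟶ P) :
    (pullback w).map ((pullback z).map n) ≫ (pbComp h M).hom ≫ k =
      (pbComp h N).hom ≫ (pullback x).map n ≫ k := by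
  rw [← Category.assoc, pbComp_naturality, Category.assoc]

/-- The coherence of composed pullbacks, from `pseudofunctor_associativity`. Composites are named by
variables with equations, so that later base changes need no transport between types. -/
lemma pbComp_assoc {w : T'' ⟶ T'} {z : T' ⟶ T} {p : T ⟶ Y} {x : T'' ⟶ T} {s : T' ⟶ Y}
    {r : T'' ⟶ Y} (h : w ≫ z = x) (h' : z ≫ p = s) (h₁ : x ≫ p = r) (h₂ : w ≫ s = r)
    (N : Y.Modules) : (pbComp h ((pullback p).obj N)).hom ≫ (pbComp h₁ N).hom =
      (pullback w).map (pbComp h' N).hom ≫ (pbComp h₂ N).hom := by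
  subst h h' h₁
  have key := congr_arg (fun φ ↦ φ.app N) (pseudofunctor_associativity w z p)
  have key' : (pullbackComp w (z ≫ p)).inv.app N ≫
      (pullback w).map ((pullbackComp z p).inv.app N) ≫ 𝟙 _ ≫
        (pullbackComp w z).hom.app ((pullback p).obj N) ≫ (pullbackComp (w ≫ z) p).hom.app N =
      (pullbackCongr h₂).hom.app N := key
  rw [pbComp_rfl, pbComp_rfl, pbComp_rfl, pbComp, Iso.trans_hom, Iso.app_hom, Iso.app_hom,
    Iso.app_hom, Iso.app_hom, Iso.app_hom, ← key', Category.id_comp]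
  rw [Iso.hom_inv_id_app_assoc, ← Functor.map_comp_assoc, Iso.hom_inv_id_app]
  exact ((congr_arg (fun φ ↦ φ ≫ _) ((pullback w).map_id _)).trans (Category.id_comp _)).symm

/-- The base change along `w` of a morphism `z₁^* N₁ ⟶ z₂^* N₂`. -/
def bc {w : T' ⟶ T} {z₁ : T ⟶ Y₁} {z₂ : T ⟶ Y₂} {x₁ : T' ⟶ Y₁} {x₂ : T' ⟶ Y₂} (h₁ : w ≫ z₁ = x₁)
    (h₂ : w ≫ z₂ = x₂) {N₁ : Y₁.Modules} {N₂ : Y₂.Modules}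
    (θ : (pullback z₁).obj N₁ ⟶ (pullback z₂).obj N₂) :
    (pullback x₁).obj N₁ ⟶ (pullback x₂).obj N₂ :=
  (pbComp h₁ N₁).inv ≫ (pullback w).map θ ≫ (pbComp h₂ N₂).hom

section

variable {w : T' ⟶ T} {z₁ : T ⟶ Y₁} {z₂ : T ⟶ Y₂} {z₃ : T ⟶ Y₃} {x₁ : T' ⟶ Y₁} {x₂ : T' ⟶ Y₂}
  {x₃ : T' ⟶ Y₃} {N₁ : Y₁.Modules} {N₂ : Y₂.Modules} {N₃ : Y₃.Modules}

lemma bc_comp (h₁ : w ≫ z₁ = x₁) (h₂ : w ≫ z₂ = x₂) (h₃ : w ≫ z₃ = x₃)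
    (θ : (pullback z₁).obj N₁ ⟶ (pullback z₂).obj N₂)
    (θ' : (pullback z₂).obj N₂ ⟶ (pullback z₃).obj N₃) :
    bc h₁ h₃ (θ ≫ θ') = bc h₁ h₂ θ ≫ bc h₂ h₃ θ' := by
  simp [bc]

lemma bc_id (h₁ : w ≫ z₁ = x₁) : bc h₁ h₁ (𝟙 ((pullback z₁).obj N₁)) = 𝟙 _ := by
  simp [bc]

lemma bc_map {M₁ : Y₁.Modules} (h₁ : w ≫ z₁ = x₁) (n : N₁ ⟶ M₁) :
    bc h₁ h₁ ((pullback z₁).map n) = (pullback x₁).map n := by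
  rw [bc, Iso.inv_comp_eq, pbComp_naturality]

lemma bc_bc {w' : T'' ⟶ T'} {w'' : T'' ⟶ T} {r₁ : T'' ⟶ Y₁} {r₂ : T'' ⟶ Y₂} (h : w' ≫ w = w'')
    (h₁ : w ≫ z₁ = x₁) (h₂ : w ≫ z₂ = x₂) (k₁ : w' ≫ x₁ = r₁) (k₂ : w' ≫ x₂ = r₂)
    (l₁ : w'' ≫ z₁ = r₁) (l₂ : w'' ≫ z₂ = r₂)
    (θ : (pullback z₁).obj N₁ ⟶ (pullback z₂).obj N₂) :
    bc k₁ k₂ (bc h₁ h₂ θ) = bc l₁ l₂ θ := by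
  have e₂ := pbComp_assoc h h₂ l₂ k₂ N₂
  have e₁ := pbComp_assoc h h₁ l₁ k₁ N₁
  rw [bc, Iso.inv_comp_eq, bc, bc, Functor.map_comp, Functor.map_comp, Category.assoc,
    Category.assoc, ← e₂, pbComp_naturality_assoc]
  have e₃ : (pbComp k₁ N₁).hom ≫ (pbComp l₁ N₁).inv =
      (pullback w').map (pbComp h₁ N₁).inv ≫ (pbComp h ((pullback z₁).obj N₁)).hom := by
    rw [Iso.comp_inv_eq, Category.assoc, e₁, ← Category.assoc, ← Functor.map_comp, Iso.inv_hom_id,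
      CategoryTheory.Functor.map_id, Category.id_comp]
  rw [← Category.assoc, ← e₃, Category.assoc]

lemma bc_pbComp {f : Y₁ ⟶ Y} {r : T ⟶ Y} {r' : T' ⟶ Y} (h₁ : w ≫ z₁ = x₁) (h₂ : w ≫ r = r')
    (h : z₁ ≫ f = r) (h' : x₁ ≫ f = r') (M : Y.Modules) :
    bc h₁ h₂ (N₁ := (pullback f).obj M) (pbComp h M).hom = (pbComp h' M).hom := by
  rw [bc, Iso.inv_comp_eq, pbComp_assoc h₁ h h' h₂]

lemma bc_pbComp_inv {f : Y₁ ⟶ Y} {r : T ⟶ Y} {r' : T' ⟶ Y} (h₁ : w ≫ z₁ = x₁) (h₂ : w ≫ r = r')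
    (h : z₁ ≫ f = r) (h' : x₁ ≫ f = r') (M : Y.Modules) :
    bc h₂ h₁ (N₂ := (pullback f).obj M) (pbComp h M).inv = (pbComp h' M).inv := by
  rw [← cancel_epi (pbComp h' M).hom, ← bc_pbComp h₁ h₂ h h', ← bc_comp, Iso.hom_inv_id, bc_id,
    bc_pbComp h₁ h₂ h h', Iso.hom_inv_id]

lemma bc_pullbackCongr {z₁' : T ⟶ Y₁} {x₁' : T' ⟶ Y₁} (h : z₁ = z₁') (h' : x₁ = x₁')
    (h₁ : w ≫ z₁ = x₁) (h₁' : w ≫ z₁' = x₁') :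
    bc h₁ h₁' ((pullbackCongr h).app N₁).hom = ((pullbackCongr h').app N₁).hom := by
  subst h h'
  exact bc_id h₁

/-- The base change along `w` of an isomorphism `z₁^* N₁ ≅ z₂^* N₂`. -/
def bcIso (h₁ : w ≫ z₁ = x₁) (h₂ : w ≫ z₂ = x₂)
    (θ : (pullback z₁).obj N₁ ≅ (pullback z₂).obj N₂) :
    (pullback x₁).obj N₁ ≅ (pullback x₂).obj N₂ :=
  (pbComp h₁ N₁).symm ≪≫ (pullback w).mapIso θ ≪≫ pbComp h₂ N₂

lemma bcIso_hom (h₁ : w ≫ z₁ = x₁) (h₂ : w ≫ z₂ = x₂)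
    (θ : (pullback z₁).obj N₁ ≅ (pullback z₂).obj N₂) :
    (bcIso h₁ h₂ θ).hom = bc h₁ h₂ θ.hom := rfl

end

end BaseChange

/-! ### Polarisations -/

section Polarisation

open Scheme.Modules

variable {X Y Y' : Scheme.{u}} {π : Y ⟶ Line X} {π' : Y' ⟶ Line X} {L : X.Modules}
  {J K : Y.IdealSheafData}

/-- The morphism from `N` to the pullback of `L` is locally the multiplication by a regular
generator of `J`. -/
def IsTwisted (J : Y.IdealSheafData) (N : Twisted π L) : Prop :=
  IsTwist (M := (pullback (toBase π)).obj L) J N.hom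

lemma isTwisted_pullbackBase (hL : IsLineBundle L) : IsTwisted ⊤ (pullbackBase π L) :=
  isTwist_id (hL.pullback _)

lemma over_mk_map_comp_hom {C D E : Type*} [Category* C] [Category* D] [Category* E] {F : C ⥤ D}
    {G : D ⥤ E} {H H' : C ⥤ E} (e : F ⋙ G ≅ H) {e' e'' : H ≅ H'} (he : e' = e'') (L : C)
    (N : Over (F.obj L)) :
    (Over.mk (Y := G.obj N.left) (G.map N.hom ≫ e.hom.app L ≫ e'.hom.app L) : Over (H'.obj L)).hom =
      CategoryStruct.comp (X := G.obj N.left) (Y := G.obj (F.obj L))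
        (G.map (Y := F.obj L) N.hom) (e.app L ≪≫ e''.app L).hom := by
  subst he; rfl

lemma pullbackTwisted_hom (β : Y' ⟶ Y) (h : π' = β ≫ π) (h' : β ≫ toBase π = toBase π')
    (N : Twisted π L) :
    Eq (α := (pullback β).obj N.left ⟶ (pullback (toBase π')).obj L) (pullbackTwisted β h N).hom
      (CategoryStruct.comp (X := (pullback β).obj N.left)
        (Y := (pullback β).obj ((pullback (toBase π)).obj L))
          ((pullback β).map (Y := (pullback (toBase π)).obj L) N.hom) (pbComp h' L).hom) := by
  delta pullbackTwisted
  refine over_mk_map_comp_hom (G := pullback β) (pullbackComp β (toBase π)) ?_ L N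
  exact congr_arg (fun h ↦ pullbackCongr h) rfl

lemma IsTwisted.pullback {N : Twisted π L} (hN : IsTwisted J N) (β : Y' ⟶ Y) (h : π' = β ≫ π)
    (hJ : IsInvertibleIdeal (J.comap β)) : IsTwisted (J.comap β) (pullbackTwisted β h N) := by
  have h' : β ≫ toBase π = toBase π' := by simp [h]
  have e := pullbackTwisted_hom β h h' N
  exact (IsTwist.pullback hN β hJ).of_iso (Iso.refl ((Modules.pullback β).obj N.left)) (pbComp h' L)
    ((Category.id_comp _).trans e)

lemma IsTwisted.isLineBundle {N : Twisted π L} (hN : IsTwisted J N) : IsLineBundle N.left :=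
  IsTwist.isLineBundle hN

lemma IsTwisted.twist {N : Twisted π L} (hN : IsTwisted J N) (hK : IsInvertibleIdeal K) :
    IsTwisted (K * J) (twistTwisted K N) :=
  (isTwist_twistι hN.isLineBundle hK).comp hN

lemma IsTwisted.exists_iso {N N' : Twisted π L} (h : IsTwisted J N) (h' : IsTwisted J N') :
    Nonempty (N ≅ N') := by
  obtain ⟨e, he⟩ := IsTwist.exists_iso h h'
  exact ⟨Over.isoMk e he⟩

lemma isTwisted_polarisation {J : (Line X).IdealSheafData} (hL : IsLineBundle L)
    (hJ : IsInvertibleIdeal (J.comap π)) (c : ℕ) :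
    IsTwisted (J.comap π ^ c) (polarisation π J L c) := by
  have h := (isTwisted_pullbackBase (π := π) hL).twist (hJ.pow c)
  rwa [← IdealSheafData.one_eq_top, mul_one] at h

lemma lineFlag_zero (I : ℕ → X.IdealSheafData) : lineFlag I 0 = ⊤ := by
  rw [lineFlag, flagPow, flagSum, Finset.sum_range_zero, zero_add, pow_zero,
    IdealSheafData.one_eq_top]

lemma IteratedBlowup.polarisation_succ {p : ℕ} {I : Fin p → X.IdealSheafData}
    (Y : IteratedBlowup I) (L : X.Modules) (c : ℕ) (k : Fin p) : Y.polarisation L c k.succ =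
      twistTwisted ((center (Y.toLine k.castSucc) (I k)).comap (Y.blowdown k) ^ c)
        (pullbackTwisted (Y.blowdown k) (Y.toLine_succ k) (Y.polarisation L c k.castSucc)) := rfl

/-- Pulling back and twisting multiplies the ideal of the twist by the c-th power of the exceptional
ideal. By the key identity the product is the c-th power of the next flag ideal, starting from the
unit ideal at stage 0. -/
lemma IteratedBlowup.isTwisted_polarisation {p : ℕ} {I : Fin p → X.IdealSheafData}
    (Y : IteratedBlowup I) (hI : Monotone I) (hL : IsLineBundle L) (c : ℕ) (k : Fin (p + 1)) :
    IsTwisted ((lineFlag (extend I) k).comap (Y.toLine k) ^ c) (Y.polarisation L c k) := by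
  induction k using Fin.induction with
  | zero =>
    have h := isTwisted_pullbackBase (π := Y.toLine 0) hL
    have e : (lineFlag (extend I) (0 : Fin (p + 1))).comap (Y.toLine 0) ^ c = ⊤ := by
      rw [Fin.val_zero, lineFlag_zero, IdealSheafData.comap_top, ← IdealSheafData.one_eq_top,
        one_pow]
    rw [e]
    exact h
  | succ k ih =>
    have hinv := (Y.isInvertibleIdeal_lineFlag hI k.succ)
    rw [Y.comap_lineFlag_succ hI k] at hinv ⊢
    have h1 := IsTwisted.pullback ih (Y.blowdown k) (Y.toLine_succ k)
      (by rw [comap_pow]; exact hinv.of_mul_left.pow c)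
    rw [comap_pow] at h1
    have h2 := h1.twist (hinv.of_mul_right.pow c)
    rw [mul_pow, mul_comm]
    rw [← Y.polarisation_succ] at h2
    exact h2

end Polarisation

/-! ### Linearisations of twists -/

lemma app_trans_symm_hom {C D E : Type*} [Category* C] [Category* D] [Category* E] {F : C ⥤ D}
    {G G' : D ⥤ E} {H H' : C ⥤ E} (e₁ : F ⋙ G ≅ H) (e₂ : H ≅ H') (e₃ : F ⋙ G' ≅ H') (N : C) :
    (e₁.app N ≪≫ e₂.app N ≪≫ (e₃.app N).symm : G.obj (F.obj N) ≅ G'.obj (F.obj N)).hom =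
      (e₁.app N ≪≫ e₂.app N : G.obj (F.obj N) ≅ H'.obj N).hom ≫
        Iso.inv (X := G'.obj (F.obj N)) (e₃.app N) := by
  simp

section Linearise

open Scheme.Modules

variable {T T' X Y Z : Scheme.{u}}

lemma pullbackCongr_naturality {w w' : T ⟶ Y} (h : w = w') {N M : Y.Modules} (n : N ⟶ M) :
    ((pullbackCongr h).app N).hom ≫ (pullback w').map n =
      (pullback w).map n ≫ ((pullbackCongr h).app M).hom := by
  subst h
  exact (Category.id_comp _).trans (Category.comp_id _).symm

lemma pullbackCongr_pbComp {w w' : T ⟶ Y} (h : w = w') {z : Y ⟶ Z} {x : T ⟶ Z} (hw : w ≫ z = x)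
    (hw' : w' ≫ z = x) (N : Z.Modules) :
    ((pullbackCongr h).app ((pullback z).obj N)).hom ≫ (pbComp hw' N).hom = (pbComp hw N).hom := by
  subst h
  exact Category.id_comp _

lemma pullbackCongr_eq_bcIso {w : T' ⟶ T} {z₁ z₂ : T ⟶ Y} {x₁ : T' ⟶ Y} (h : x₁ = w ≫ z₁)
    (h' : w ≫ z₁ = x₁) {N : Y.Modules} (θ : (pullback z₁).obj N ≅ (pullback z₂).obj N) :
    (pullbackCongr h).app N ≪≫ ((pullbackComp w z₁).app N).symm ≪≫
      (pullback w).mapIso θ ≪≫ (pullbackComp w z₂).app N = bcIso h' rfl θ := by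
  subst h
  rw [bcIso, pbComp_rfl, pbComp_rfl]
  ext1
  exact Category.id_comp _

variable {π : Y ⟶ Line X} (a : LiftedAction π) (L : X.Modules)

lemma pbComp_hom_comp_inv {z₁ : T ⟶ Y} {z₂ : T ⟶ T'} {p₁ : Y ⟶ X} {p₂ : T' ⟶ X} {r r' : T ⟶ X}
    (h₁ : z₁ ≫ p₁ = r) (h₂ : z₂ ≫ p₂ = r) (h₁' : z₁ ≫ p₁ = r') (h₂' : z₂ ≫ p₂ = r')
    (L : X.Modules) : (pbComp h₁ L).hom ≫ (pbComp h₂ L).inv =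
      (pbComp h₁' L).hom ≫ (pbComp h₂' L).inv := by
  obtain rfl : r = r' := h₁.symm.trans h₁'
  exact congr_arg₂ (fun i j ↦ Iso.hom i ≫ Iso.inv j) (rfl : pbComp h₁ L = pbComp h₁' L)
    (rfl : pbComp h₂ L = pbComp h₂' L)

lemma baseIso_hom (l : Γ(T, ⊤)ˣ) (y : T ⟶ Y) {r : T ⟶ X} (h₁ : a.act l y ≫ toBase π = r)
    (h₂ : y ≫ toBase π = r) :
    (baseIso a L l y).hom = (pbComp h₁ L).hom ≫ (pbComp h₂ L).inv := by
  refine Eq.trans ?_ (pbComp_hom_comp_inv (a.act_toBase l y) rfl h₁ h₂ L)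
  rw [pbComp_rfl]
  delta baseIso pbComp
  exact app_trans_symm_hom _ _ _ L

lemma bc_comp_inv {T₀ : Scheme.{u}} {w : T' ⟶ T} {z₁ z₂ : T ⟶ Y} {x₁ x₂ : T' ⟶ Y} {p : Y ⟶ T₀}
    {r : T ⟶ T₀} {r' : T' ⟶ T₀} (h₁ : w ≫ z₁ = x₁) (h₂ : w ≫ z₂ = x₂) (hr : w ≫ r = r')
    (k₁ : z₁ ≫ p = r) (k₂ : z₂ ≫ p = r) (k₁' : x₁ ≫ p = r') (k₂' : x₂ ≫ p = r')
    (L : T₀.Modules) : bc h₁ h₂ ((pbComp k₁ L).hom ≫ (pbComp k₂ L).inv) =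
      (pbComp k₁' L).hom ≫ (pbComp k₂' L).inv := by
  rw [bc_comp h₁ hr h₂, bc_pbComp h₁ hr k₁ k₁', bc_pbComp_inv h₂ hr k₂ k₂']

lemma bc_baseIso {w : T' ⟶ T} {l : Γ(T, ⊤)ˣ} {y : T ⟶ Y} {l' : Γ(T', ⊤)ˣ} {y' : T' ⟶ Y}
    (hy : w ≫ y = y') (ha : w ≫ a.act l y = a.act l' y') :
    bc ha hy (baseIso a L l y).hom = (baseIso a L l' y').hom := by
  have h₂ : w ≫ y ≫ toBase π = y' ≫ toBase π := by rw [← Category.assoc, hy]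
  refine (congr_arg _ (baseIso_hom a L l y (a.act_toBase l y) rfl)).trans ?_
  refine Eq.trans ?_ (baseIso_hom a L l' y' (a.act_toBase l' y') rfl).symm
  exact bc_comp_inv ha hy h₂ (a.act_toBase l y) rfl (a.act_toBase l' y') rfl L

/-- Base change of a commutative square. -/
lemma bc_square {w : T' ⟶ T} {z₁ z₂ : T ⟶ Y} {x₁ x₂ : T' ⟶ Y} (h₁ : w ≫ z₁ = x₁)
    (h₂ : w ≫ z₂ = x₂) {N M : Y.Modules} {θ : (pullback z₁).obj N ⟶ (pullback z₂).obj N}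
    {ψ : (pullback z₁).obj M ⟶ (pullback z₂).obj M} {n : N ⟶ M}
    (h : θ ≫ (pullback z₂).map n = (pullback z₁).map n ≫ ψ) :
    bc h₁ h₂ θ ≫ (pullback x₂).map n = (pullback x₁).map n ≫ bc h₁ h₂ ψ := by
  rw [← bc_map h₂ n, ← bc_comp h₁ h₂ h₂, h, bc_comp h₁ h₁ h₂, bc_map h₁ n]

lemma act_gmLift (a : GmAction Y) (l : Γ(T, ⊤)ˣ) (y : T ⟶ Y) :
    gmLift l y ≫ a.act (gmUnit Y) (gmPr Y) = a.act l y := by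
  rw [← a.comp_act]
  change a.act (pbUnit _ _) _ = _
  rw [pbUnit_gmLift, gmLift_gmPr]

lemma gmLift_comp (f : T' ⟶ T) (l : Γ(T, ⊤)ˣ) (y : T ⟶ Y) :
    gmLift (pbUnit f l) (f ≫ y) = f ≫ gmLift l y := by
  rw [← cancel_mono (gmι Y), Category.assoc, gmLift_gmι, gmLift_gmι, AffineSpace.comp_homOfVector]
  rfl

variable {a L}

section

variable {N : Y.Modules}
  (θ : (pullback (a.act (gmUnit Y) (gmPr Y))).obj N ≅ (pullback (gmPr Y)).obj N)

/-- The isomorphisms `(l · y)^* N ≅ y^* N` obtained from the universal one by base change. -/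
def linIso (l : Γ(T, ⊤)ˣ) (y : T ⟶ Y) : (pullback (a.act l y)).obj N ≅ (pullback y).obj N :=
  bcIso (act_gmLift a.toGmAction l y) (gmLift_gmPr l y) θ

lemma linIso_hom (l : Γ(T, ⊤)ˣ) (y : T ⟶ Y) : (linIso θ l y).hom =
    bc (act_gmLift a.toGmAction l y) (gmLift_gmPr l y) θ.hom := by
  rw [linIso, bcIso_hom]

lemma bc_linIso {w : T' ⟶ T} {l : Γ(T, ⊤)ˣ} {y : T ⟶ Y} {l' : Γ(T', ⊤)ˣ} {y' : T' ⟶ Y}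
    (hl : pbUnit w l = l') (hy : w ≫ y = y') (ha : w ≫ a.act l y = a.act l' y') :
    bc ha hy (linIso θ l y).hom = (linIso θ l' y').hom := by
  subst hl hy
  rw [linIso_hom, linIso_hom]
  exact bc_bc (gmLift_comp w l y).symm _ _ _ _ _ _ _

lemma linIso_naturality (f : T' ⟶ T) (l : Γ(T, ⊤)ˣ) (y : T ⟶ Y) :
    linIso θ (Units.map f.appTop.hom.toMonoidHom l) (f ≫ y) =
      (pullbackCongr (a.comp_act f l y)).app N ≪≫ ((pullbackComp f (a.act l y)).app N).symm ≪≫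
        (pullback f).mapIso (linIso θ l y) ≪≫ (pullbackComp f y).app N := by
  rw [pullbackCongr_eq_bcIso _ (a.comp_act f l y).symm]
  ext1
  rw [bcIso_hom]
  exact (bc_linIso θ rfl rfl (a.comp_act f l y).symm).symm

lemma linIso_comp {n : N ⟶ (pullback (toBase π)).obj L}
    (hθ : θ.hom ≫ (pullback (gmPr Y)).map n =
      (pullback (a.act (gmUnit Y) (gmPr Y))).map n ≫ (baseIso a L (gmUnit Y) (gmPr Y)).hom)
    (l : Γ(T, ⊤)ˣ) (y : T ⟶ Y) : (linIso θ l y).hom ≫ (pullback y).map n =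
      (pullback (a.act l y)).map n ≫ (baseIso a L l y).hom := by
  refine (congr_arg (fun φ ↦ φ ≫ _) (linIso_hom θ l y)).trans ?_
  refine (bc_square _ _ hθ).trans (congr_arg (fun φ ↦ _ ≫ φ) ?_)
  exact bc_baseIso a L (gmLift_gmPr l y) (act_gmLift a.toGmAction l y)

end

end Linearise

/-! ### The cocycle condition and existence of linearisations -/

section Cocycle

open Scheme.Modules

variable {T T' X Y : Scheme.{u}} {π : Y ⟶ Line X} {a : LiftedAction π} {L : X.Modules}
  {N : Y.Modules} {n : N ⟶ (pullback (toBase π)).obj L}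
  {θ : (pullback (a.act (gmUnit Y) (gmPr Y))).obj N ≅ (pullback (gmPr Y)).obj N}

lemma baseIso_mul (l m : Γ(T, ⊤)ˣ) (y : T ⟶ Y) : (baseIso a L (l * m) y).hom =
    ((pullbackCongr (a.mul_act l m y)).app ((pullback (toBase π)).obj L)).hom ≫
      (baseIso a L l (a.act m y)).hom ≫ (baseIso a L m y).hom := by
  have h : a.act l (a.act m y) ≫ toBase π = y ≫ toBase π := by
    rw [a.act_toBase, a.act_toBase]
  have e₁ := baseIso_hom a L (l * m) y (a.act_toBase (l * m) y) rfl
  have e₂ := baseIso_hom a L l (a.act m y) h (a.act_toBase m y)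
  have e₃ := baseIso_hom a L m y (a.act_toBase m y) rfl
  have e₄ := pullbackCongr_pbComp (a.mul_act l m y) (a.act_toBase (l * m) y) h L
  rw [e₁, e₂, e₃, ← e₄]
  simp only [Category.assoc, Iso.inv_hom_id_assoc]

/-- Both sides are compatible with the trivial linearisation of the pullback of `L`, which is
multiplicative. They agree after composition with the pullback of `n`, which is cancelled. -/
lemma linIso_mul_of_mono (hθ : θ.hom ≫ (pullback (gmPr Y)).map n =
      (pullback (a.act (gmUnit Y) (gmPr Y))).map n ≫ (baseIso a L (gmUnit Y) (gmPr Y)).hom)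
    (l m : Γ(T, ⊤)ˣ) (y : T ⟶ Y) (hy : Mono ((pullback y).map n)) : (linIso θ (l * m) y).hom =
      ((pullbackCongr (a.mul_act l m y)).app N).hom ≫ (linIso θ l (a.act m y)).hom ≫
        (linIso θ m y).hom := by
  rw [← cancel_mono ((pullback y).map n), linIso_comp θ hθ, Category.assoc, Category.assoc,
    linIso_comp θ hθ, ← Category.assoc (linIso θ l (a.act m y)).hom, linIso_comp θ hθ,
    Category.assoc, ← Category.assoc (Iso.hom _), pullbackCongr_naturality, Category.assoc,
    baseIso_mul]

/-- At an arbitrary point the pullback of `n` may fail to be a monomorphism. The cocycle identity is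
therefore proved over 𝔾ₘ × 𝔾ₘ × Y, which is flat over `Y`, and base changed. -/
lemma linIso_mul {J : Y.IdealSheafData} (hn : IsTwist J n) (hJ : IsInvertibleIdeal J)
    (hθ : θ.hom ≫ (pullback (gmPr Y)).map n =
      (pullback (a.act (gmUnit Y) (gmPr Y))).map n ≫ (baseIso a L (gmUnit Y) (gmPr Y)).hom)
    (l m : Γ(T, ⊤)ˣ) (y : T ⟶ Y) : linIso θ (l * m) y =
      (pullbackCongr (a.mul_act l m y)).app N ≪≫ linIso θ l (a.act m y) ≪≫ linIso θ m y := by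
  let G := gm (gm Y)
  let z : G ⟶ Y := gmPr (gm Y) ≫ gmPr Y
  let l₀ : Γ(G, ⊤)ˣ := gmUnit (gm Y)
  let m₀ : Γ(G, ⊤)ˣ := pbUnit (gmPr (gm Y)) (gmUnit Y)
  have h := linIso_mul_of_mono hθ l₀ m₀ z (hn.pullback z (hJ.comap z)).mono
  let u : T ⟶ G := gmLift l (gmLift m y)
  have hl : pbUnit u l₀ = l := pbUnit_gmLift _ _
  have hm : pbUnit u m₀ = m := by rw [← pbUnit_comp, gmLift_gmPr, pbUnit_gmLift]
  have hlm : pbUnit u (l₀ * m₀) = l * m := by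
    rw [show pbUnit u (l₀ * m₀) = pbUnit u l₀ * pbUnit u m₀ from map_mul _ _ _, hl, hm]
  have hz : u ≫ z = y := by simp [u, z]
  have hact : ∀ {l₁ : Γ(G, ⊤)ˣ} {l₂ : Γ(T, ⊤)ˣ} {y₁ : G ⟶ Y} {y₂ : T ⟶ Y}, pbUnit u l₁ = l₂ →
      u ≫ y₁ = y₂ → u ≫ a.act l₁ y₁ = a.act l₂ y₂ := by
    rintro l₁ _ y₁ _ rfl rfl
    exact (a.comp_act u l₁ y₁).symm
  have h1 := hact hlm hz
  have h2 := hact hm hz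
  have h3 := hact hl h2
  have h' := congr_arg (bc h1 hz) h
  rw [bc_linIso θ hlm hz h1, bc_comp h1 h3 hz, bc_comp h3 h2 hz,
    bc_pullbackCongr _ (a.mul_act l m y) h1 h3, bc_linIso θ hl h2 h3, bc_linIso θ hm hz h2] at h'
  ext1
  exact h'

/-- The linearisation given by a universal isomorphism over `L`. -/
def linearisation {J : Y.IdealSheafData} (hn : IsTwist J n) (hJ : IsInvertibleIdeal J)
    (hθ : θ.hom ≫ (pullback (gmPr Y)).map n =
      (pullback (a.act (gmUnit Y) (gmPr Y))).map n ≫ (baseIso a L (gmUnit Y) (gmPr Y)).hom) :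
    Linearisation a.toGmAction N where
  iso l y := linIso θ l y
  naturality f l y := linIso_naturality θ f l y
  cocycle l m y := linIso_mul hn hJ hθ l m y

/-- By invariance, the pullbacks of `n` along action and projection are twists by one ideal of line
bundles identified by `baseIso`, and such twists are unique. -/
lemma exists_universal_iso {J : Y.IdealSheafData} (hn : IsTwist J n) (hJ : IsInvertibleIdeal J)
    (hinv : J.comap (a.act (gmUnit Y) (gmPr Y)) = J.comap (gmPr Y)) :
    ∃ θ : (pullback (a.act (gmUnit Y) (gmPr Y))).obj N ≅ (pullback (gmPr Y)).obj N,
      θ.hom ≫ (pullback (gmPr Y)).map n =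
        (pullback (a.act (gmUnit Y) (gmPr Y))).map n ≫ (baseIso a L (gmUnit Y) (gmPr Y)).hom := by
  have h := hn.pullback (gmPr Y) (hJ.comap (gmPr Y))
  have h' := hn.pullback (a.act (gmUnit Y) (gmPr Y)) (hinv ▸ hJ.comap (gmPr Y))
  rw [hinv] at h'
  exact (h'.of_iso (Iso.refl _) (baseIso a L (gmUnit Y) (gmPr Y)) (Category.id_comp _)).exists_iso h

/-- A twist of the pullback of `L` by an invariant ideal sheaf has a linearisation that is
induced by the one of `L`. -/
lemma exists_linearisation {N : Twisted π L} {J : Y.IdealSheafData} (hN : IsTwisted J N)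
    (hJ : IsInvertibleIdeal J)
    (hinv : J.comap (a.act (gmUnit Y) (gmPr Y)) = J.comap (gmPr Y)) :
    ∃ Φ : Linearisation a.toGmAction N.left, Φ.IsNatural := by
  obtain ⟨θ, hθ⟩ := exists_universal_iso hN hJ hinv
  exact ⟨linearisation hN hJ hθ, fun l y ↦ linIso_comp θ hθ l y⟩

end Cocycle

/-! ### Equivariance of isomorphisms of twists -/

lemma app_trans_trans_hom {C D E : Type*} [Category* C] [Category* D] [Category* E] {F : C ⥤ D}
    {G G' : D ⥤ E} {H H' H'' : C ⥤ E} (e₁ : F ⋙ G ≅ H) (e₂ : H ≅ H') (e₃ : F ⋙ G' ≅ H'') (M : C)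
    {K : E} (ψ : H'.obj M ≅ H''.obj M) (χ : G'.obj (F.obj M) ≅ K) :
    (e₁.app M ≪≫ e₂.app M ≪≫ ψ ≪≫ (e₃.app M).symm ≪≫ χ : G.obj (F.obj M) ≅ K).hom =
      (e₁.app M ≪≫ e₂.app M : G.obj (F.obj M) ≅ H'.obj M).hom ≫ ψ.hom ≫
        Iso.inv (X := G'.obj (F.obj M)) (e₃.app M) ≫ χ.hom := by
  simp

lemma over_mk_iso_hom_comp {C : Type*} [Category* C] {S X : C} (f : X ⟶ S) {B : Over S}
    (φ : Over.mk f ≅ B) (e : X ≅ B.left) (he : e = (Over.forget S).mapIso φ) :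
    e.hom ≫ B.hom = f := by
  subst he
  exact Over.w φ.hom

section Equivariant

open Scheme.Modules

variable {T T' X Y B : Scheme.{u}} {π : Y ⟶ Line X} {πB : B ⟶ Line X} {a : LiftedAction π}
  {b : LiftedAction πB} {L : X.Modules} {N : Y.Modules} {n : N ⟶ (pullback (toBase π)).obj L}
  {M : B.Modules} {m : M ⟶ (pullback (toBase πB)).obj L} {q : Y ⟶ B}

lemma bc_iso {a : GmAction Y} (Φ : Linearisation a N) {w : T' ⟶ T} {l : Γ(T, ⊤)ˣ} {y : T ⟶ Y}
    {l' : Γ(T', ⊤)ˣ} {y' : T' ⟶ Y} (hl : pbUnit w l = l') (hy : w ≫ y = y')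
    (ha : w ≫ a.act l y = a.act l' y') : bc ha hy (Φ.iso l y).hom = (Φ.iso l' y').hom := by
  subst hl hy
  have h : Φ.iso (pbUnit w l) (w ≫ y) = bcIso ha rfl (Φ.iso l y) :=
    (Φ.naturality w l y).trans (pullbackCongr_eq_bcIso _ ha _)
  rw [h, bcIso_hom]

lemma baseIso_comp (hqt : q ≫ toBase πB = toBase π) (l : Γ(T, ⊤)ˣ) {y : T ⟶ Y} {y' : T ⟶ B}
    (hy : y ≫ q = y') (hz : a.act l y ≫ q = b.act l y') :
    (pullback (a.act l y)).map (pbComp hqt L).hom ≫ (baseIso a L l y).hom =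
      (pbComp hz ((pullback (toBase πB)).obj L)).hom ≫ (baseIso b L l y').hom ≫
        (pbComp hy ((pullback (toBase πB)).obj L)).inv ≫ (pullback y).map (pbComp hqt L).hom := by
  have k₁ := a.act_toBase l y
  have k₂ : y ≫ toBase π = y ≫ toBase π := rfl
  have k₄ : y' ≫ toBase πB = y ≫ toBase π := by rw [← hy, Category.assoc, hqt]
  have k₃ : b.act l y' ≫ toBase πB = y ≫ toBase π := by rw [b.act_toBase, k₄]
  have e₁ := baseIso_hom a L l y k₁ k₂
  have e₂ := baseIso_hom b L l y' k₃ k₄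
  have e₃ := pbComp_assoc hz hqt k₃ k₁ L
  have e₄ := pbComp_assoc hy hqt k₄ k₂ L
  have e₅ : (pullback y).map (pbComp hqt L).hom =
      (pbComp hy ((pullback (toBase πB)).obj L)).hom ≫ (pbComp k₄ L).hom ≫ (pbComp k₂ L).inv := by
    rw [← Category.assoc, Iso.eq_comp_inv, e₄]
  rw [e₁, e₂, e₅, ← Category.assoc, ← e₃]
  simp only [Category.assoc, Iso.inv_hom_id_assoc]

/-- After composition with the monomorphism to the pullback of `L`, both sides are governed by the
trivial linearisation of `L`, which is compatible with pullback along `q`. -/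
lemma equivariant_of_mono (hqt : q ≫ toBase πB = toBase π)
    {Ψ : Linearisation b.toGmAction M} {Φ : Linearisation a.toGmAction N} {l : Γ(T, ⊤)ˣ}
    {y : T ⟶ Y} {y' : T ⟶ B}
    (hΨ : (Ψ.iso l y').hom ≫ (pullback y').map m =
      (pullback (b.act l y')).map m ≫ (baseIso b L l y').hom)
    (hΦ : (Φ.iso l y).hom ≫ (pullback y).map n =
      (pullback (a.act l y)).map n ≫ (baseIso a L l y).hom)
    {φ : (pullback q).obj M ⟶ N} (hφ : φ ≫ n = (pullback q).map m ≫ (pbComp hqt L).hom)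
    (hy : y ≫ q = y') (hz : a.act l y ≫ q = b.act l y') (hn : Mono ((pullback y).map n)) :
    (pullback (a.act l y)).map φ ≫ (Φ.iso l y).hom =
      (pbComp hz M).hom ≫ (Ψ.iso l y').hom ≫ (pbComp hy M).inv ≫ (pullback y).map φ := by
  have e₁ := baseIso_comp (L := L) hqt l hy hz
  have e₂ := pbComp_naturality hz m
  have e₃ : (pbComp hy M).inv ≫ (pullback y).map ((pullback q).map m) =
      (pullback y').map m ≫ (pbComp hy ((pullback (toBase πB)).obj L)).inv := by
    rw [Iso.inv_comp_eq, ← Category.assoc, ← pbComp_naturality hy m, Category.assoc,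
      Iso.hom_inv_id, Category.comp_id]
  have f₁ : ∀ z : T ⟶ Y, (pullback z).map φ ≫ (pullback z).map n =
      (pullback z).map ((pullback q).map m) ≫ (pullback z).map (pbComp hqt L).hom := fun z ↦ by
    rw [← Functor.map_comp, hφ, Functor.map_comp]
  rw [← cancel_mono ((pullback y).map n)]
  calc _ = (pullback (a.act l y)).map φ ≫ (Φ.iso l y).hom ≫ (pullback y).map n :=
        Category.assoc _ _ _
    _ = ((pullback (a.act l y)).map φ ≫ (pullback (a.act l y)).map n) ≫ (baseIso a L l y).hom := by
        rw [hΦ, Category.assoc]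
    _ = (pullback (a.act l y)).map ((pullback q).map m) ≫
          (pullback (a.act l y)).map (pbComp hqt L).hom ≫ (baseIso a L l y).hom := by
        rw [f₁, Category.assoc]
    _ = ((pbComp hz M).hom ≫ (pullback (b.act l y')).map m) ≫ (baseIso b L l y').hom ≫
        (pbComp hy ((pullback (toBase πB)).obj L)).inv ≫ (pullback y).map (pbComp hqt L).hom := by
        rw [e₁, ← Category.assoc, e₂]
    _ = (pbComp hz M).hom ≫ ((Ψ.iso l y').hom ≫ (pullback y').map m) ≫
        (pbComp hy ((pullback (toBase πB)).obj L)).inv ≫ (pullback y).map (pbComp hqt L).hom := by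
        rw [hΨ]; simp only [Category.assoc]
    _ = (pbComp hz M).hom ≫ (Ψ.iso l y').hom ≫ ((pullback y').map m ≫
        (pbComp hy ((pullback (toBase πB)).obj L)).inv) ≫ (pullback y).map (pbComp hqt L).hom := by
        simp only [Category.assoc]
    _ = (pbComp hz M).hom ≫ (Ψ.iso l y').hom ≫ (pbComp hy M).inv ≫
        (pullback y).map φ ≫ (pullback y).map n := by
        rw [← e₃, f₁, Category.assoc]
    _ = _ := by simp only [Category.assoc]

lemma equivariant_of_isTwist {J : Y.IdealSheafData} (hn : IsTwist J n) (hJ : IsInvertibleIdeal J)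
    (hqt : q ≫ toBase πB = toBase π) (hq : IsEquivariant a.toGmAction b.toGmAction q)
    {Ψ : Linearisation b.toGmAction M} {Φ : Linearisation a.toGmAction N}
    (hΨ : (Ψ.iso (gmUnit Y) (gmPr Y ≫ q)).hom ≫ (pullback (gmPr Y ≫ q)).map m =
      (pullback (b.act (gmUnit Y) (gmPr Y ≫ q))).map m ≫
        (baseIso b L (gmUnit Y) (gmPr Y ≫ q)).hom)
    (hΦ : (Φ.iso (gmUnit Y) (gmPr Y)).hom ≫ (pullback (gmPr Y)).map n =
      (pullback (a.act (gmUnit Y) (gmPr Y))).map n ≫ (baseIso a L (gmUnit Y) (gmPr Y)).hom)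
    {φ : (pullback q).obj M ⟶ N} (hφ : φ ≫ n = (pullback q).map m ≫ (pbComp hqt L).hom)
    (l : Γ(T, ⊤)ˣ) (y : T ⟶ Y) : (pullback (a.act l y)).map φ ≫ (Φ.iso l y).hom =
      (pbComp (hq l y) M).hom ≫ (Ψ.iso l (y ≫ q)).hom ≫ (pbComp (rfl : y ≫ q = y ≫ q) M).inv ≫
        (pullback y).map φ := by
  have h := equivariant_of_mono hqt hΨ hΦ hφ rfl (hq _ _) (hn.pullback _ (hJ.comap (gmPr Y))).mono
  have hl := pbUnit_gmLift l y
  have h₁ := act_gmLift a.toGmAction l y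
  have h₂ := gmLift_gmPr l y
  have h₄ : gmLift l y ≫ gmPr Y ≫ q = y ≫ q := by rw [← Category.assoc, h₂]
  have h₃ : gmLift l y ≫ b.act (gmUnit Y) (gmPr Y ≫ q) = b.act l (y ≫ q) := by
    rw [← hq, ← Category.assoc, h₁, hq]
  have h' := congr_arg (bc h₁ h₂) h
  rwa [bc_comp h₁ h₁ h₂, bc_map h₁, bc_iso Φ hl h₂ h₁, bc_comp h₁ h₃ h₂,
    bc_pbComp h₁ h₃ (hq _ _) (hq l y), bc_comp h₃ h₄ h₂, bc_iso Ψ hl h₄ h₃, bc_comp h₄ h₂ h₂,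
    bc_pbComp_inv h₂ h₄ rfl rfl, bc_map h₂] at h'

lemma isEquivariantIso_of_hom (hq : IsEquivariant a.toGmAction b.toGmAction q)
    {Ψ : Linearisation b.toGmAction M} {Φ : Linearisation a.toGmAction N}
    (φ : (pullback q).obj M ≅ N)
    (h : ∀ {T : Scheme.{u}} (l : Γ(T, ⊤)ˣ) (y : T ⟶ Y),
      (pullback (a.act l y)).map φ.hom ≫ (Φ.iso l y).hom =
        (pbComp (hq l y) M).hom ≫ (Ψ.iso l (y ≫ q)).hom ≫
          (pbComp (rfl : y ≫ q = y ≫ q) M).inv ≫ (pullback y).map φ.hom) :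
    IsEquivariantIso hq Ψ Φ φ := by
  intro T l y
  ext1
  refine (h l y).trans (Eq.trans ?_ (app_trans_trans_hom (pullbackComp (a.act l y) q)
    (pullbackCongr (hq l y)) (pullbackComp y q) M (Ψ.iso l (y ≫ q))
      ((pullback y).mapIso φ)).symm)
  rw [pbComp_rfl]
  rfl

lemma isEquivariantIso_of_isTwist {J : Y.IdealSheafData} (hn : IsTwist J n)
    (hJ : IsInvertibleIdeal J) (hqt : q ≫ toBase πB = toBase π)
    (hq : IsEquivariant a.toGmAction b.toGmAction q)
    {Ψ : Linearisation b.toGmAction M} {Φ : Linearisation a.toGmAction N}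
    (hΨ : (Ψ.iso (gmUnit Y) (gmPr Y ≫ q)).hom ≫ (pullback (gmPr Y ≫ q)).map m =
      (pullback (b.act (gmUnit Y) (gmPr Y ≫ q))).map m ≫
        (baseIso b L (gmUnit Y) (gmPr Y ≫ q)).hom)
    (hΦ : (Φ.iso (gmUnit Y) (gmPr Y)).hom ≫ (pullback (gmPr Y)).map n =
      (pullback (a.act (gmUnit Y) (gmPr Y))).map n ≫ (baseIso a L (gmUnit Y) (gmPr Y)).hom)
    (φ : (pullback q).obj M ≅ N) (hφ : φ.hom ≫ n = (pullback q).map m ≫ (pbComp hqt L).hom) :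
    IsEquivariantIso hq Ψ Φ φ := by
  apply isEquivariantIso_of_hom @hq
  intro T l y
  exact equivariant_of_isTwist hn hJ hqt @hq hΨ hΦ hφ l y

/-- Isomorphisms over `L` commute with the linearisations induced by the one of `L`. -/
lemma isEquivariantIso_of_isTwisted {J : Y.IdealSheafData} {N : Twisted π L} {M : Twisted πB L}
    (hN : IsTwisted J N) (hJ : IsInvertibleIdeal J)
    (hq : IsEquivariant a.toGmAction b.toGmAction q) (hqπ : π = q ≫ πB)
    {Ψ : Linearisation b.toGmAction M.left} {Φ : Linearisation a.toGmAction N.left}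
    (hΨ : Ψ.IsNatural) (hΦ : Φ.IsNatural) (φ : pullbackTwisted q hqπ M ≅ N) :
    IsEquivariantIso hq Ψ Φ ((Over.forget _).mapIso φ) := by
  have hqt : q ≫ toBase πB = toBase π := by simp [hqπ]
  have hφ := over_mk_iso_hom_comp (X := (pullback q).obj M.left) (pullbackTwisted q hqπ M).hom φ
    ((Over.forget _).mapIso φ) rfl
  apply isEquivariantIso_of_isTwist hN hJ hqt @hq (hΨ _ _) (hΦ _ _)
  exact hφ.trans (pullbackTwisted_hom q hqπ hqt M)

end Equivariant

/-! ### Polarisations on the two blow-ups -/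

section Main

variable {X : Scheme.{u}}

/-- This is how finite type over the base field enters: it makes the product locally Noetherian, as
properness of the blow-ups requires. -/
lemma isLocallyNoetherian_line {S : Scheme.{u}} [IsLocallyNoetherian S]
    (sX : X ⟶ S) [LocallyOfFiniteType sX] :
    IsLocallyNoetherian (Line X) :=
  LocallyOfFiniteType.isLocallyNoetherian ((Line X ↘ X) ≫ sX)

lemma IsInvariant.comap_pow_act {J : (Line X).IdealSheafData} (hJ : IsInvariant J)
    {Y : Scheme.{u}} {π : Y ⟶ Line X} (a : LiftedAction π) (c : ℕ) {T : Scheme.{u}}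
    (l : Γ(T, ⊤)ˣ) (y : T ⟶ Y) :
    (J.comap π ^ c).comap (a.act l y) = (J.comap π ^ c).comap y := by
  rw [comap_pow, comap_pow, ← IdealSheafData.comap_comp, ← IdealSheafData.comap_comp,
    a.equivariant, hJ]

variable {p : ℕ} {I : Fin p → X.IdealSheafData} (Y : IteratedBlowup I)

/-- The lifts of the standard action to the stages of the iterated blow-up. -/
def IteratedBlowup.action (hI : Monotone I) (k : Fin (p + 1)) : LiftedAction (Y.toLine k) :=
  (Y.isBlowup_toLine hI k).liftedAction (isInvariant_lineProd _ _)

lemma IteratedBlowup.isEquivariant_blowdown (hI : Monotone I) (k : Fin p) :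
    IsEquivariant (Y.action hI k.succ).toGmAction (Y.action hI k.castSucc).toGmAction
      (Y.blowdown k) := by
  refine (Y.isBlowup_toLine hI k.castSucc).isEquivariant (isInvariant_lineProd _ _) ?_ _ _ _
    (Y.toLine_succ k)
  have h := (Y.isBlowup_toLine hI k.succ).invertible
  rw [Fin.val_succ, lineProd_succ, comap_mul] at h
  exact h.of_mul_left

lemma exists_polarisation_iso {J : (Line X).IdealSheafData} (hJ : IsInvariant J) {B Y : Scheme.{u}}
    {πB : B ⟶ Line X} {π : Y ⟶ Line X} {q : Y ⟶ B} (hqπ : π = q ≫ πB)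
    (hB : IsInvertibleIdeal (J.comap πB)) (hY : IsInvertibleIdeal (J.comap π))
    {b : LiftedAction πB} {a : LiftedAction π} (hq : IsEquivariant a.toGmAction b.toGmAction q)
    {L : X.Modules} {c : ℕ} {M : Twisted πB L} {N : Twisted π L}
    (hM : IsTwisted (J.comap πB ^ c) M) (hN : IsTwisted (J.comap π ^ c) N) :
    ∃ (Ψ : Linearisation b.toGmAction M.left) (Φ : Linearisation a.toGmAction N.left)
      (φ : pullbackTwisted q hqπ M ≅ N), Ψ.IsNatural ∧ Φ.IsNatural ∧
        IsEquivariantIso hq Ψ Φ ((Over.forget _).mapIso φ) := by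
  obtain ⟨Ψ, hΨ⟩ := exists_linearisation (a := b) hM (hB.pow c) (hJ.comap_pow_act b c _ _)
  obtain ⟨Φ, hΦ⟩ := exists_linearisation (a := a) hN (hY.pow c) (hJ.comap_pow_act a c _ _)
  have e : (J.comap πB ^ c).comap q = J.comap π ^ c := by
    rw [comap_pow, ← IdealSheafData.comap_comp, ← hqπ]
  have h := hM.pullback q hqπ (e ▸ hY.pow c)
  rw [e] at h
  obtain ⟨φ⟩ := h.exists_iso hN
  exact ⟨Ψ, Φ, φ, hΨ, hΦ, isEquivariantIso_of_isTwisted hN (hY.pow c) hq hqπ hΨ hΦ φ⟩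

end Main

end IterBlowup

end

theorem mainTheorem5 (X : Scheme.{0}) (sX : X ⟶ Spec (.of ℂ)) [LocallyOfFiniteType sX]
    (p : ℕ) (I : Fin p → X.IdealSheafData) (hI : Monotone I)
    (B : Scheme.{0}) (πB : B ⟶ Line X) (hB : IsBlowup πB (flagIdeal I))
    (Y : IteratedBlowup I) :
    ∃ (b : LiftedAction πB) (a : ∀ k, LiftedAction (Y.toLine k))
      (q : Y.stage (Fin.last p) ⟶ B)
      (hq : IsEquivariant (a (Fin.last p)).toGmAction b.toGmAction q)
      (hqπ : Y.toLine (Fin.last p) = q ≫ πB),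
      (∀ k : Fin p, IsEquivariant (a k.succ).toGmAction (a k.castSucc).toGmAction
        (Y.blowdown k)) ∧
      IsContraction q ∧
      ∀ (L : X.Modules), IsLineBundle L → ∀ c : ℕ,
        IsLineBundle (polarisation πB (flagIdeal I) L c).left ∧
        IsLineBundle (Y.polarisation L c (Fin.last p)).left ∧
        ∃ (Ψ : Linearisation b.toGmAction (polarisation πB (flagIdeal I) L c).left)
          (Φ : Linearisation (a (Fin.last p)).toGmAction
            (Y.polarisation L c (Fin.last p)).left)
          (φ : pullbackTwisted q hqπ (polarisation πB (flagIdeal I) L c) ≅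
            Y.polarisation L c (Fin.last p)),
          Ψ.IsNatural ∧ Φ.IsNatural ∧
            IsEquivariantIso hq Ψ Φ ((Over.forget _).mapIso φ) := by
  have := isLocallyNoetherian_line sX
  have hJ : IsInvariant (flagIdeal I) := flagIdeal_eq I ▸ isInvariant_lineFlag (extend I) p
  have hY : IsInvertibleIdeal ((flagIdeal I).comap (Y.toLine (Fin.last p))) :=
    flagIdeal_eq I ▸ Y.isInvertibleIdeal_lineFlag hI (Fin.last p)
  obtain ⟨q, hq⟩ := hB.exists_lift _ hY
  have he : IsEquivariant (Y.action hI (Fin.last p)).toGmAction (hB.liftedAction hJ).toGmAction q :=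
    hB.isEquivariant hJ hY _ _ q hq.symm
  refine ⟨hB.liftedAction hJ, Y.action hI, q, he, hq.symm, Y.isEquivariant_blowdown hI,
    isContraction_of_isBlowup (Y.isBlowup_toLine hI _) hB (pow_le_lineProd _ _)
      (flagIdeal_eq I ▸ pow_le_lineFlag (extend I) p) q hq, fun L hL c ↦ ?_⟩
  have hM := isTwisted_polarisation hL hB.invertible c
  have hN := Y.isTwisted_polarisation hI hL c (Fin.last p)
  -- At the last stage the flag ideal is the ideal blown up by B, so both polarisations are twists
  -- by its c-th power.
  rw [Fin.val_last, ← flagIdeal_eq] at hN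
  exact ⟨hM.isLineBundle, hN.isLineBundle,
    exists_polarisation_iso hJ hq.symm hB.invertible hY he hM hN⟩
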